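/- **Setting.** Let $\pi:Y\to X$ be a smooth submersion (for instance a smooth fibre bundle) of finite-dimensional manifolds without boundary, $\dim X=n+1$. Let $\mathcal Z\to Y$ be the bundle whose fibre over $y$ consists of the $(n+1)$-forms on $T_yY$ that vanish as soon as two of their arguments are $\pi$-vertical; let $\Theta$ be its canonical $(n+1)$-form ($\Theta(z)$ is the pullback of $z$ to $\mathcal Z$), $\Omega=-d\Theta$, and $\pi_{X\mathcal Z}:\mathcal Z\to X$ the projection. Let $\mathcal G$ be a (possibly infinite-dimensional) Lie group with Lie algebra $\mathfrak g$, acting smoothly on $X$ and on $\mathcal Z$ so that $\pi_{X\mathcal Z}$ is equivariant and $\eta_{\mathcal Z}^*\Omega=\Omega$ for all $\eta\in\mathcal G$; here $\eta_X$, $\eta_{\mathcal Z}$ denote the actions of $\eta$. Let $J$ be a covariant momentum map: a linear map $\xi\mapsto\langle J,\xi\rangle$ from $\mathfrak g$ to the smooth $n$-forms on $\mathcal Z$ with $d\langle J,\xi\rangle=i_{\xi_{\mathcal Z}}\Omega$, where $\xi_{\mathcal Z}$ is the infinitesimal generator of $\xi$. It is called $\mathrm{Ad}^*$-equivariant if $\langle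 J,\mathrm{Ad}_{\eta^{-1}}\xi\rangle=\eta_{\mathcal Z}^*\langle J,\xi\rangle$ for all $\eta\in\mathcal G$, $\xi\in\mathfrak g$. Let $\Sigma$ be a compact oriented $n$-manifold without boundary, $\tau:\Sigma\to X$ a smooth embedding, and $\Sigma_\tau=\tau(\Sigma)$. Let $\mathcal Z_\tau$ be the space of smooth sections of $\mathcal Z$ over $\Sigma_\tau$ (equivalently, smooth $\sigma:\Sigma\to\mathcal Z$ with $\pi_{X\mathcal Z}\circ\sigma=\tau$); a tangent vector to it at $\sigma$ is a smooth $\pi_{X\mathcal Z}$-vertical vector field along $\sigma$. Set $\Theta_\tau(\sigma)(V)=\int_{\Sigma_\tau}\sigma^*(i_V\Theta)$ and $\Omega_\tau(\sigma)(V,W)=\int_{\Sigma_\tau}\sigma^*(i_Wi_V\Omega)$. Let $\mathcal G_\tau=\{\eta\in\mathcal G:\eta_X(\Sigma_\tau)=\Sigma_\tau\}$, let $\mathfrak g_\tau$ be its Lie algebra (the velocities at $1$ of the smooth curves of $\mathcal G$ lying in $\mathcal G_\tau$), and for $\eta\in\mathcal G_\tau$ put $\eta_\tau=\eta_X|_{\Sigma_\tau}$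 and $\eta_{\mathcal Z_\tau}(\sigma)=\eta_{\mathcal Z}\circ\sigma\circ\eta_\tau^{-1}$. Finally, for $\sigma\in\mathcal Z_\tau$ and $\xi\in\mathfrak g_\tau$, let $$\langle\mathcal J_\tau(\sigma),\xi\rangle=\int_{\Sigma_\tau}\sigma^*\langle J,\xi\rangle .$$ **Proposition 7.3.** (i) The maps $\eta_{\mathcal Z_\tau}$ define an action of $\mathcal G_\tau$ on $\mathcal Z_\tau$, and $\Omega_\tau=-d\Theta_\tau$, the exterior derivative being computed on smooth two-parameter families in $\mathcal Z_\tau$. (ii) $\mathcal J_\tau:\mathcal Z_\tau\to\mathfrak g_\tau^*$ is a momentum map for this action: each $\mathcal J_\tau(\sigma)$ is linear on $\mathfrak g_\tau$; for $\sigma\in\mathcal Z_\tau$, $\xi\in\mathfrak g_\tau$ and any smooth curve $c$ in $\mathcal G_\tau$ with $c(0)=1$ and velocity $\xi$, the curve $t\mapsto c(t)_{\mathcal Z_\tau}(\sigma)$ is smooth in $\mathcal Z_\tau$, and its velocity $\xi_{\mathcal Z_\tau}(\sigma)$ at $t=0$ satisfies $$d\langle\mathcal J_\tau,\xi\rangle(\sigma)(V)=\Omega_\tau(\sigma)\bigl(\xi_{\mathcal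 Z_\tau}(\sigma),V\bigr)$$ for all tangent vectors $V$ at $\sigma$, where the left side is the derivative at $0$ of $\langle\mathcal J_\tau,\xi\rangle$ along any smooth curve in $\mathcal Z_\tau$ through $\sigma$ with velocity $V$. (iii) If $J$ is $\mathrm{Ad}^*$-equivariant, then so is $\mathcal J_\tau$: $$\langle\mathcal J_\tau(\eta_{\mathcal Z_\tau}(\sigma)),\xi\rangle=\langle\mathcal J_\tau(\sigma),\mathrm{Ad}_{\eta^{-1}}\xi\rangle$$ for all $\sigma\in\mathcal Z_\tau$, $\xi\in\mathfrak g_\tau$ and all $\eta\in\mathcal G_\tau$ for which $\eta_\tau$ preserves the orientation of $\Sigma_\tau$. -/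

import Mathlib

open scoped Manifold ContDiff Topology

set_option linter.unusedSectionVars false

noncomputable section

namespace Multisymplectic

/-! ### Forms that vanish on two vertical vectors -/

section Fibre

theorem finiteDimensional_multilinear (W : Type*) [NormedAddCommGroup W] [NormedSpace ℝ W]
    [FiniteDimensional ℝ W] (k : ℕ) :
    FiniteDimensional ℝ (ContinuousMultilinearMap ℝ (fun _ : Fin k => W) ℝ) := by
  let f : ContinuousMultilinearMap ℝ (fun _ : Fin k => W) ℝ →ₗ[ℝ]
      MultilinearMap ℝ (fun _ : Fin k => W) ℝ :=
    { toFun := fun a => a.toMultilinearMap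
      map_add' := fun _ _ => rfl
      map_smul' := fun _ _ => rfl }
  exact FiniteDimensional.of_injective f ContinuousMultilinearMap.toMultilinearMap_injective

theorem finiteDimensional_forms (W : Type*) [NormedAddCommGroup W] [NormedSpace ℝ W]
    [FiniteDimensional ℝ W] (k : ℕ) : FiniteDimensional ℝ (W [⋀^Fin k]→L[ℝ] ℝ) := by
  have := finiteDimensional_multilinear W k
  refine FiniteDimensional.of_injective
    (ContinuousAlternatingMap.toContinuousMultilinearMapCLM ℝ :
      (W [⋀^Fin k]→L[ℝ] ℝ) →L[ℝ] ContinuousMultilinearMap ℝ (fun _ : Fin k => W) ℝ).toLinearMap ?_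
  exact ContinuousAlternatingMap.toContinuousMultilinearMap_injective

theorem contDiff_pullback (W : Type*) [NormedAddCommGroup W] [NormedSpace ℝ W]
    [FiniteDimensional ℝ W] (k : ℕ) :
    ContDiff ℝ ∞ (fun A : W →L[ℝ] W =>
      (ContinuousAlternatingMap.compContinuousLinearMapCLM A :
        (W [⋀^Fin k]→L[ℝ] ℝ) →L[ℝ] (W [⋀^Fin k]→L[ℝ] ℝ))) := by
  have := finiteDimensional_forms W k
  have := finiteDimensional_multilinear W k
  rw [contDiff_clm_apply_iff]
  intro a
  let inc : (W [⋀^Fin k]→L[ℝ] ℝ) →L[ℝ] ContinuousMultilinearMap ℝ (fun _ : Fin k => W) ℝ :=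
    ContinuousAlternatingMap.toContinuousMultilinearMapCLM ℝ
  obtain ⟨L, hL⟩ := inc.toLinearMap.exists_leftInverse_of_injective
    (LinearMap.ker_eq_bot.2 ContinuousAlternatingMap.toContinuousMultilinearMap_injective)
  have key : ContDiff ℝ ∞ (fun A : W →L[ℝ] W =>
      (inc a).compContinuousLinearMap (fun _ : Fin k => A)) := by
    have h1 : ContDiff ℝ ∞ (fun p : (Fin k → W →L[ℝ] W) ×
        ContinuousMultilinearMap ℝ (fun _ : Fin k => W) ℝ => p.2.compContinuousLinearMap p.1) :=
      contDiff_iff_contDiffAt.2 fun q =>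
        (ContinuousMultilinearMap.analyticAt_uncurry_compContinuousLinearMap (𝕜 := ℝ)
          (Fm := fun _ : Fin k => W) (Em := fun _ : Fin k => W) (G := ℝ) (q := q)).contDiffAt
    exact h1.comp (f := fun A : W →L[ℝ] W => ((fun _ : Fin k => A), inc a)) (by fun_prop)
  have h2 := (LinearMap.toContinuousLinearMap L).contDiff (n := ∞) |>.comp key
  have h3 : (fun A : W →L[ℝ] W => a.compContinuousLinearMap A) = fun A =>
      LinearMap.toContinuousLinearMap L ((inc a).compContinuousLinearMap (fun _ : Fin k => A)) :=
    funext fun A => (LinearMap.congr_fun hL (a.compContinuousLinearMap A)).symm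
  change ContDiff ℝ ∞ (fun A : W →L[ℝ] W => a.compContinuousLinearMap A)
  rw [h3]
  exact h2

/-- The `k`-forms on `B × F` (base directions times vertical directions) that vanish as soon as two
of their arguments are vertical. -/
def twoHorizontal (B F : Type*) [NormedAddCommGroup B] [NormedSpace ℝ B]
    [NormedAddCommGroup F] [NormedSpace ℝ F] (k : ℕ) :
    Submodule ℝ ((B × F) [⋀^Fin k]→L[ℝ] ℝ) where
  carrier := {a | ∀ (v : Fin k → B × F) (i j : Fin k), i ≠ j →
    (v i).1 = 0 → (v j).1 = 0 → a v = 0}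
  add_mem' := fun ha hb v i j hij hi hj => by
    simp [ha v i j hij hi hj, hb v i j hij hi hj]
  zero_mem' := fun _ _ _ _ _ _ => rfl
  smul_mem' := fun c a ha v i j hij hi hj => by simp [ha v i j hij hi hj]

theorem twoHorizontal_comp {B F : Type*} [NormedAddCommGroup B] [NormedSpace ℝ B]
    [NormedAddCommGroup F] [NormedSpace ℝ F] {k : ℕ} {a : (B × F) [⋀^Fin k]→L[ℝ] ℝ}
    (ha : a ∈ twoHorizontal B F k) {A : B × F →L[ℝ] B × F} (hA : ∀ f, (A (0, f)).1 = 0) :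
    a.compContinuousLinearMap A ∈ twoHorizontal B F k := by
  intro v i j hij hi hj
  have h : ∀ l, (v l).1 = 0 → (A (v l)).1 = 0 := fun l hl => by
    have : v l = (0, (v l).2) := Prod.ext hl rfl
    rw [this]; exact hA _
  exact ha (fun l => A (v l)) i j hij (h i hi) (h j hj)

/-- The space of `k`-forms on `B × F` that vanish on two vertical vectors, as a normed space: the
model fibre of the multimomentum phase space. -/
def PhaseFibre (B F : Type*) [NormedAddCommGroup B] [NormedSpace ℝ B]
    [NormedAddCommGroup F] [NormedSpace ℝ F] (k : ℕ) : Type _ := twoHorizontal B F k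

section PhaseFibre
variable (B F : Type*) [NormedAddCommGroup B] [NormedSpace ℝ B]
    [NormedAddCommGroup F] [NormedSpace ℝ F] (k : ℕ)

instance : NormedAddCommGroup (PhaseFibre B F k) :=
  inferInstanceAs (NormedAddCommGroup (twoHorizontal B F k))

instance : NormedSpace ℝ (PhaseFibre B F k) :=
  inferInstanceAs (NormedSpace ℝ (twoHorizontal B F k))

variable [FiniteDimensional ℝ B] [FiniteDimensional ℝ F]

instance : FiniteDimensional ℝ (PhaseFibre B F k) := by
  have := finiteDimensional_forms (B × F) k
  exact inferInstanceAs (FiniteDimensional ℝ (twoHorizontal B F k))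

/-- The inclusion of the model fibre in the space of all forms on `B × F`. -/
def PhaseFibre.form : PhaseFibre B F k →L[ℝ] (B × F) [⋀^Fin k]→L[ℝ] ℝ :=
  LinearMap.toContinuousLinearMap (twoHorizontal B F k).subtype

theorem PhaseFibre.form_injective : Function.Injective (PhaseFibre.form B F k) :=
  Subtype.val_injective

theorem exists_projection : ∃ P : ((B × F) [⋀^Fin k]→L[ℝ] ℝ) →L[ℝ] PhaseFibre B F k,
    ∀ a ∈ twoHorizontal B F k, PhaseFibre.form B F k (P a) = a := by
  have := finiteDimensional_forms (B × F) k
  obtain ⟨L, hL⟩ := (PhaseFibre.form B F k).toLinearMap.exists_leftInverse_of_injective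
    (LinearMap.ker_eq_bot.2 (PhaseFibre.form_injective B F k))
  refine ⟨LinearMap.toContinuousLinearMap L, fun a ha => ?_⟩
  exact congrArg Subtype.val (LinearMap.congr_fun hL ⟨a, ha⟩)

end PhaseFibre

end Fibre

/-! ### The bundle of forms on `Y` that vanish on two vectors vertical for `π : Y → X` -/

section Charts
variable {EY B F : Type*} [NormedAddCommGroup EY] [NormedSpace ℝ EY]
  [NormedAddCommGroup B] [NormedSpace ℝ B]
  [NormedAddCommGroup F] [NormedSpace ℝ F]
  {X Y : Type*} [TopologicalSpace X] [ChartedSpace B X] [TopologicalSpace Y] [ChartedSpace EY Y]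

variable (EY B F) in
/-- A chart of `Y` together with a chart of `X` in which `π` is the projection `B × F → B`. -/
structure AdaptedChart (π : Y → X) where
  chartY : OpenPartialHomeomorph Y EY
  chartX : OpenPartialHomeomorph X B
  split : EY ≃L[ℝ] B × F
  chartY_mem : chartY ∈ IsManifold.maximalAtlas 𝓘(ℝ, EY) ∞ Y
  chartX_mem : chartX ∈ IsManifold.maximalAtlas 𝓘(ℝ, B) ∞ X
  source_subset : chartY.source ⊆ π ⁻¹' chartX.source
  adapted : ∀ y ∈ chartY.source, (split (chartY y)).1 = chartX (π y)

namespace AdaptedChart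
variable {π : Y → X}

/-- The coordinates of a point, in `B × F`. -/
def coord (e : AdaptedChart EY B F π) (y : Y) : B × F := e.split (e.chartY y)

/-- The point with given coordinates. -/
def coordInv (e : AdaptedChart EY B F π) (w : B × F) : Y := e.chartY.symm (e.split.symm w)

/-- The derivative, at the point `y`, of the change of coordinates from `j` to `i`. -/
def jacobian (i j : AdaptedChart EY B F π) (y : Y) : B × F →L[ℝ] B × F :=
  fderiv ℝ (fun w => i.coord (j.coordInv w)) (j.coord y)

theorem coordInv_coord (e : AdaptedChart EY B F π) {y : Y} (hy : y ∈ e.chartY.source) :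
    e.coordInv (e.coord y) = y := by
  simp [coord, coordInv, hy]

/-- The coordinates, in `j`, of the points that also belong to the chart `i`. -/
def overlap (i j : AdaptedChart EY B F π) : Set (B × F) :=
  j.split.symm ⁻¹' (j.chartY.symm ≫ₕ i.chartY).source

theorem isOpen_overlap (i j : AdaptedChart EY B F π) : IsOpen (overlap i j) :=
  (j.chartY.symm ≫ₕ i.chartY).open_source.preimage j.split.symm.continuous

theorem mem_overlap (i j : AdaptedChart EY B F π) {y : Y} (hi : y ∈ i.chartY.source)
    (hj : y ∈ j.chartY.source) : j.coord y ∈ overlap i j := by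
  simp [overlap, coord, hi, hj, j.chartY.map_source hj]

theorem contDiffOn_transition (i j : AdaptedChart EY B F π) :
    ContDiffOn ℝ ∞ (fun w => i.coord (j.coordInv w)) (overlap i j) := by
  have h1 : ContDiffOn ℝ ∞ (fun w => i.chartY (j.chartY.symm w))
      (j.chartY.symm ≫ₕ i.chartY).source := by
    rw [← contMDiffOn_iff_contDiffOn]
    refine (contMDiffOn_of_mem_maximalAtlas i.chartY_mem).comp
      ((contMDiffOn_symm_of_mem_maximalAtlas j.chartY_mem).mono ?_) ?_
    · intro w hw; simp at hw; exact hw.1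
    · intro w hw; simp at hw; exact hw.2
  exact (i.split.contDiff.comp_contDiffOn h1).comp j.split.symm.contDiff.contDiffOn
    (fun w hw => hw)

theorem hasFDerivAt_transition (i j : AdaptedChart EY B F π) {y : Y} (hi : y ∈ i.chartY.source)
    (hj : y ∈ j.chartY.source) :
    HasFDerivAt (fun w => i.coord (j.coordInv w)) (jacobian i j y) (j.coord y) :=
  (((contDiffOn_transition i j).contDiffAt
    ((isOpen_overlap i j).mem_nhds (mem_overlap i j hi hj))).differentiableAt (by simp)).hasFDerivAt

theorem jacobian_self (i : AdaptedChart EY B F π) {y : Y} (hi : y ∈ i.chartY.source) :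
    jacobian i i y = ContinuousLinearMap.id ℝ (B × F) := by
  refine (hasFDerivAt_transition i i hi hi).unique ?_
  refine (hasFDerivAt_id _).congr_of_eventuallyEq ?_
  filter_upwards [(isOpen_overlap i i).mem_nhds (mem_overlap i i hi hi)] with w hw
  simp [overlap] at hw
  simp [coord, coordInv, hw]

theorem jacobian_comp (i j k : AdaptedChart EY B F π) {y : Y} (hi : y ∈ i.chartY.source)
    (hj : y ∈ j.chartY.source) (hk : y ∈ k.chartY.source) :
    (jacobian i j y).comp (jacobian j k y) = jacobian i k y := by
  have h1 := hasFDerivAt_transition i j hi hj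
  have h2 := hasFDerivAt_transition j k hj hk
  have e : j.coord (k.coordInv (k.coord y)) = j.coord y := by rw [coordInv_coord k hk]
  have h3 := HasFDerivAt.comp (k.coord y) (e ▸ h1 : HasFDerivAt _ _ (j.coord (k.coordInv (k.coord y)))) h2
  refine (h3.congr_of_eventuallyEq ?_).unique (hasFDerivAt_transition i k hi hk)
  filter_upwards [(isOpen_overlap j k).mem_nhds (mem_overlap j k hj hk)] with w hw
  simp [overlap] at hw
  simp [coord, coordInv, hw]

theorem contMDiffOn_coord (e : AdaptedChart EY B F π) :
    ContMDiffOn 𝓘(ℝ, EY) 𝓘(ℝ, B × F) ∞ e.coord e.chartY.source :=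
  e.split.contDiff.contMDiff.comp_contMDiffOn (contMDiffOn_of_mem_maximalAtlas e.chartY_mem)

theorem contMDiffOn_jacobian (i j : AdaptedChart EY B F π) :
    ContMDiffOn 𝓘(ℝ, EY) 𝓘(ℝ, B × F →L[ℝ] B × F) ∞ (jacobian i j)
      (i.chartY.source ∩ j.chartY.source) := by
  have h : ContDiffOn ℝ ∞ (fderiv ℝ (fun w => i.coord (j.coordInv w))) (overlap i j) :=
    (contDiffOn_transition i j).fderiv_of_isOpen (isOpen_overlap i j) (by simp)
  exact h.contMDiffOn.comp ((contMDiffOn_coord j).mono Set.inter_subset_right)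
    (fun y hy => mem_overlap i j hy.1 hy.2)

theorem jacobian_vertical (i j : AdaptedChart EY B F π) {y : Y} (hi : y ∈ i.chartY.source)
    (hj : y ∈ j.chartY.source) (f : F) : (jacobian i j y (0, f)).1 = 0 := by
  -- in the direction of the fibre the base coordinates are constant
  have h1 := hasFDerivAt_transition i j hi hj
  have hl : HasDerivAt (fun t : ℝ => j.coord y + t • ((0, f) : B × F)) (0, f) 0 := by
    simpa using ((hasDerivAt_id (0 : ℝ)).smul_const ((0, f) : B × F)).const_add (j.coord y)
  have h1' : HasFDerivAt (fun w => i.coord (j.coordInv w)) (jacobian i j y)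
      (j.coord y + (0 : ℝ) • ((0, f) : B × F)) := by simpa using h1
  have h2 := h1'.comp_hasDerivAt (0 : ℝ) hl
  have h3 := (ContinuousLinearMap.fst ℝ B F).hasFDerivAt.comp_hasDerivAt (0 : ℝ) h2
  refine h3.unique ((hasDerivAt_const (0 : ℝ) (i.chartX (π y))).congr_of_eventuallyEq ?_)
  have hc : ∀ᶠ t : ℝ in 𝓝 0, j.coord y + t • ((0, f) : B × F) ∈ overlap i j := by
    refine hl.continuousAt.eventually ?_
    simpa using (isOpen_overlap i j).mem_nhds (mem_overlap i j hi hj)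
  filter_upwards [hc] with t ht
  simp only [overlap, Set.mem_preimage, OpenPartialHomeomorph.trans_source,
    OpenPartialHomeomorph.symm_source, Set.mem_inter_iff] at ht
  have hz : j.coordInv (j.coord y + t • ((0, f) : B × F)) ∈ j.chartY.source :=
    j.chartY.map_target ht.1
  have hzi : j.coordInv (j.coord y + t • ((0, f) : B × F)) ∈ i.chartY.source := ht.2
  have e1 : (j.coord (j.coordInv (j.coord y + t • ((0, f) : B × F)))).1 = j.chartX (π y) := by
    have : j.coord (j.coordInv (j.coord y + t • ((0, f) : B × F)))
        = j.coord y + t • ((0, f) : B × F) := by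
      change j.split (j.chartY (j.chartY.symm (j.split.symm _))) = _
      rw [j.chartY.right_inv ht.1]; simp
    rw [this]
    simpa [coord] using j.adapted y hj
  have e2 : π (j.coordInv (j.coord y + t • ((0, f) : B × F))) = π y := by
    refine j.chartX.injOn (j.source_subset hz) (j.source_subset hj) ?_
    rw [← e1]; exact (j.adapted _ hz).symm
  change (i.coord (j.coordInv (j.coord y + t • ((0, f) : B × F)))).1 = i.chartX (π y)
  rw [← e2]
  exact i.adapted _ hzi

end AdaptedChart

theorem exists_adaptedChart {π : Y → X}
    (hπ : Manifold.IsSubmersionOfComplement F 𝓘(ℝ, EY) 𝓘(ℝ, B) ∞ π)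
    (y : Y) : ∃ e : AdaptedChart EY B F π, y ∈ e.chartY.source := by
  obtain ⟨φ, ψ, hφ, hψ, hφm, hψm, hsub, e, he⟩ := hπ y
  refine ⟨⟨φ, ψ, e, hφm, hψm, hsub, fun z hz => ?_⟩, hφ⟩
  have := he (x := φ z) (by simpa using φ.map_source hz)
  simpa [hz] using this.symm

section Core
variable [FiniteDimensional ℝ B] [FiniteDimensional ℝ F] {π : Y → X} (k : ℕ)


/-- The change of coordinates of forms from the chart `i` to the chart `j`: the pullback by the
Jacobian matrix of the change of charts from `j` to `i`, see `form_formTransition`.  (The projection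
to the model fibre does nothing where both charts are defined; it only makes the formula meaningful
at all other points.) -/
def formTransition (i j : AdaptedChart EY B F π) (y : Y) :
    PhaseFibre B F k →L[ℝ] PhaseFibre B F k :=
  ((exists_projection B F k).choose.comp
    (ContinuousAlternatingMap.compContinuousLinearMapCLM (i.jacobian j y))).comp
      (PhaseFibre.form B F k)

theorem form_formTransition (i j : AdaptedChart EY B F π) {y : Y} (hi : y ∈ i.chartY.source)
    (hj : y ∈ j.chartY.source) (a : PhaseFibre B F k) :
    PhaseFibre.form B F k (formTransition k i j y a) =
      (PhaseFibre.form B F k a).compContinuousLinearMap (i.jacobian j y) :=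
  (exists_projection B F k).choose_spec _
    (twoHorizontal_comp a.2 (AdaptedChart.jacobian_vertical i j hi hj))

theorem contMDiffOn_formTransition (i j : AdaptedChart EY B F π) :
    ContMDiffOn 𝓘(ℝ, EY) 𝓘(ℝ, PhaseFibre B F k →L[ℝ] PhaseFibre B F k) ∞
      (formTransition k i j) (i.chartY.source ∩ j.chartY.source) := by
  have h : ContDiff ℝ ∞ (fun A : B × F →L[ℝ] B × F =>
      ((exists_projection B F k).choose.comp
        (ContinuousAlternatingMap.compContinuousLinearMapCLM A)).comp
          (PhaseFibre.form B F k)) :=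
    (contDiff_const.clm_comp (contDiff_pullback (B × F) k)).clm_comp contDiff_const
  exact h.contMDiff.comp_contMDiffOn (AdaptedChart.contMDiffOn_jacobian i j)

/-- The bundle over `Y` of `k`-forms that vanish on two vertical vectors, given by its transition
functions between adapted charts. -/
def phaseCore (hπ : Manifold.IsSubmersionOfComplement F 𝓘(ℝ, EY) 𝓘(ℝ, B) ∞ π) :
    VectorBundleCore ℝ Y (PhaseFibre B F k) (AdaptedChart EY B F π) where
  baseSet e := e.chartY.source
  isOpen_baseSet e := e.chartY.open_source
  indexAt y := (exists_adaptedChart hπ y).choose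
  mem_baseSet_at y := (exists_adaptedChart hπ y).choose_spec
  coordChange i j y := formTransition k i j y
  coordChange_self i y hy a := by
    apply PhaseFibre.form_injective
    rw [form_formTransition k i i hy hy, AdaptedChart.jacobian_self i hy]
    ext v; simp
  continuousOn_coordChange i j := (contMDiffOn_formTransition k i j).continuousOn
  coordChange_comp i j l y hy a := by
    obtain ⟨⟨hi, hj⟩, hl⟩ := hy
    apply PhaseFibre.form_injective
    rw [form_formTransition k j l hj hl, form_formTransition k i j hi hj,
      form_formTransition k i l hi hl, ← AdaptedChart.jacobian_comp i j l hi hj hl]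
    ext v; simp [Function.comp_def]

instance (hπ : Manifold.IsSubmersionOfComplement F 𝓘(ℝ, EY) 𝓘(ℝ, B) ∞ π) :
    (phaseCore k hπ).IsContMDiff 𝓘(ℝ, EY) ∞ :=
  ⟨fun i j => contMDiffOn_formTransition k i j⟩

/-- The multimomentum phase space: the pairs of a point `y` of `Y` and a `k`-form on `T_y Y` that
vanishes on two vertical vectors.  It is a smooth vector bundle over `Y`. -/
abbrev PhaseSpace (hπ : Manifold.IsSubmersionOfComplement F 𝓘(ℝ, EY) 𝓘(ℝ, B) ∞ π) : Type _ :=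
  Bundle.TotalSpace (PhaseFibre B F k) (phaseCore k hπ).Fiber

variable (hπ : Manifold.IsSubmersionOfComplement F 𝓘(ℝ, EY) 𝓘(ℝ, B) ∞ π)

/-- The isomorphism of `T_y Y` with `B × F` given by the preferred adapted chart around `y`. -/
def frame (y : Y) : EY →L[ℝ] B × F :=
  (((phaseCore k hπ).indexAt y).split : EY →L[ℝ] B × F).comp
    (mfderiv 𝓘(ℝ, EY) 𝓘(ℝ, EY) ((phaseCore k hπ).indexAt y).chartY y)

/-- The form on `T_y Y` that the point `z` of the phase space over `y` is. -/
def tautForm (z : PhaseSpace k hπ) : EY [⋀^Fin k]→L[ℝ] ℝ :=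
  (PhaseFibre.form B F k z.2).compContinuousLinearMap (frame k hπ z.1)

theorem frame_spec [IsManifold 𝓘(ℝ, EY) ∞ Y] [IsManifold 𝓘(ℝ, B) ∞ X] (y : Y) :
    ∃ A : EY ≃L[ℝ] B × F, frame k hπ y = A ∧
      ∀ v : EY, (A v).1 = 0 ↔ mfderiv 𝓘(ℝ, EY) 𝓘(ℝ, B) π y v = 0 := by
  set e := (phaseCore k hπ).indexAt y with he
  have hy : y ∈ e.chartY.source := (phaseCore k hπ).mem_baseSet_at y
  have hπy : MDifferentiableAt 𝓘(ℝ, EY) 𝓘(ℝ, B) π y :=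
    (hπ y).contMDiffAt.mdifferentiableAt (by simp)
  have hY : e.chartY.MDifferentiable 𝓘(ℝ, EY) 𝓘(ℝ, EY) :=
    ⟨(contMDiffOn_of_mem_maximalAtlas e.chartY_mem).mdifferentiableOn (by simp),
      (contMDiffOn_symm_of_mem_maximalAtlas e.chartY_mem).mdifferentiableOn (by simp)⟩
  have hX : e.chartX.MDifferentiable 𝓘(ℝ, B) 𝓘(ℝ, B) :=
    ⟨(contMDiffOn_of_mem_maximalAtlas e.chartX_mem).mdifferentiableOn (by simp),
      (contMDiffOn_symm_of_mem_maximalAtlas e.chartX_mem).mdifferentiableOn (by simp)⟩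
  let D : EY ≃L[ℝ] EY := hY.mfderiv hy
  refine ⟨D.trans e.split, rfl, fun v => ?_⟩
  have hx : π y ∈ e.chartX.source := e.source_subset hy
  have h1 : HasMFDerivAt 𝓘(ℝ, EY) 𝓘(ℝ, B) (e.chartX ∘ π) y
      ((mfderiv 𝓘(ℝ, B) 𝓘(ℝ, B) e.chartX (π y)).comp (mfderiv 𝓘(ℝ, EY) 𝓘(ℝ, B) π y)) :=
    (hX.mdifferentiableAt hx).hasMFDerivAt.comp y hπy.hasMFDerivAt
  have h2 : HasMFDerivAt 𝓘(ℝ, EY) 𝓘(ℝ, B)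
      (((ContinuousLinearMap.fst ℝ B F).comp (e.split : EY →L[ℝ] B × F)) ∘ e.chartY) y
      (((ContinuousLinearMap.fst ℝ B F).comp (e.split : EY →L[ℝ] B × F)).comp
        (mfderiv 𝓘(ℝ, EY) 𝓘(ℝ, EY) e.chartY y)) :=
    (((ContinuousLinearMap.fst ℝ B F).comp (e.split : EY →L[ℝ] B × F)).hasMFDerivAt).comp y
      (hY.mdifferentiableAt hy).hasMFDerivAt
  have h3 := h1.congr_of_eventuallyEq
    (f₁ := ((ContinuousLinearMap.fst ℝ B F).comp (e.split : EY →L[ℝ] B × F)) ∘ e.chartY)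
    (Filter.mem_of_superset (e.chartY.open_source.mem_nhds hy) fun z hz => e.adapted z hz)
  have h4 := congrArg (fun L => L v) (hasMFDerivAt_unique h2 h3)
  have h5 : ((D.trans e.split) v).1 =
      mfderiv 𝓘(ℝ, B) 𝓘(ℝ, B) e.chartX (π y) (mfderiv 𝓘(ℝ, EY) 𝓘(ℝ, B) π y v) := h4
  rw [h5]
  exact map_eq_zero_iff (hX.mfderiv hx) (hX.mfderiv hx).injective

/-- The points of the phase space over `y` are, through `tautForm`, exactly the `k`-forms on `T_y Y`
that vanish as soon as two of their arguments are vertical. -/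
theorem existsUnique_tautForm_eq [IsManifold 𝓘(ℝ, EY) ∞ Y] [IsManifold 𝓘(ℝ, B) ∞ X] (y : Y)
    (a : EY [⋀^Fin k]→L[ℝ] ℝ) :
    (∃! ζ : PhaseFibre B F k, tautForm k hπ ⟨y, ζ⟩ = a) ↔
      ∀ (v : Fin k → EY) (i j : Fin k), i ≠ j → mfderiv 𝓘(ℝ, EY) 𝓘(ℝ, B) π y (v i) = 0 →
        mfderiv 𝓘(ℝ, EY) 𝓘(ℝ, B) π y (v j) = 0 → a v = 0 := by
  obtain ⟨A, hA, hv⟩ := frame_spec k hπ y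
  have hA' : ∀ ζ : PhaseFibre B F k, tautForm k hπ ⟨y, ζ⟩ =
      (PhaseFibre.form B F k ζ).compContinuousLinearMap (A : EY →L[ℝ] B × F) := fun ζ => by
    simp only [tautForm, hA]
  constructor
  · rintro ⟨ζ, rfl, -⟩ v i j hij hi hj
    rw [hA']
    exact ζ.2 (fun l => A (v l)) i j hij ((hv _).2 hi) ((hv _).2 hj)
  · intro h
    refine ⟨⟨a.compContinuousLinearMap (A.symm : B × F →L[ℝ] EY), ?_⟩, ?_, ?_⟩
    · intro v i j hij hi hj
      refine h (fun l => A.symm (v l)) i j hij ((hv _).1 ?_) ((hv _).1 ?_) <;> simpa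
    · refine (hA' _).trans ?_
      ext v
      change a (fun l => A.symm (A (v l))) = a v
      simp
    · intro ζ hζ
      apply PhaseFibre.form_injective
      ext v
      change _ = a (fun l => A.symm (v l))
      rw [← hζ]
      simp only [hA']
      change _ = PhaseFibre.form B F k ζ (fun l => A (A.symm (v l)))
      simp
end Core
end Charts

/-! ### Differential forms on manifolds -/

section Forms
variable {E H : Type*} [NormedAddCommGroup E] [NormedSpace ℝ E] [TopologicalSpace H]
  {E' H' : Type*} [NormedAddCommGroup E'] [NormedSpace ℝ E'] [TopologicalSpace H']

/-- The derivative of a map between manifolds, as a linear map between the model spaces (of which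
the tangent spaces are copies). -/
def derivAt (I : ModelWithCorners ℝ E H) (I' : ModelWithCorners ℝ E' H')
    {M : Type*} [TopologicalSpace M] [ChartedSpace H M]
    {M' : Type*} [TopologicalSpace M'] [ChartedSpace H' M'] (f : M → M') (x : M) : E →L[ℝ] E' :=
  mfderiv I I' f x

/-- The velocity at `t` of a curve in a manifold. -/
def velocityAt (I : ModelWithCorners ℝ E H) {M : Type*} [TopologicalSpace M] [ChartedSpace H M]
    (γ : ℝ → M) (t : ℝ) : E :=
  mfderiv 𝓘(ℝ, ℝ) I γ t (1 : ℝ)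

/-- A (not necessarily smooth) differential `k`-form on a manifold `M` with model space `E`: an
alternating `k`-linear form on each tangent space, the tangent spaces being copies of `E`. -/
abbrev DiffForm (_I : ModelWithCorners ℝ E H) (M : Type*) (k : ℕ) : Type _ :=
  M → E [⋀^Fin k]→L[ℝ] ℝ

namespace DiffForm
variable {I : ModelWithCorners ℝ E H} {I' : ModelWithCorners ℝ E' H'}
  {M : Type*} [TopologicalSpace M] [ChartedSpace H M]
  {M' : Type*} [TopologicalSpace M'] [ChartedSpace H' M'] {k : ℕ}

/-- The pullback `f^* α`. -/
def pullback (f : M → M') (α : DiffForm I' M' k) : DiffForm I M k := fun x =>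
  (α (f x)).compContinuousLinearMap (derivAt I I' f x)

/-- The coordinate expression of `α` in the preferred chart around `x₀`. -/
def inChart (α : DiffForm I M k) (x₀ : M) (u : E) : E [⋀^Fin k]→L[ℝ] ℝ :=
  (α ((extChartAt I x₀).symm u)).compContinuousLinearMap
    (derivAt 𝓘(ℝ, E) I (extChartAt I x₀).symm u)

/-- Smooth differential forms (on a manifold without boundary). -/
def IsSmooth (α : DiffForm I M k) : Prop :=
  ∀ x₀ : M, ContDiffOn ℝ ∞ (α.inChart x₀) (extChartAt I x₀).target

/-- The exterior derivative (on a manifold without boundary): at `x` it is computed in the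
preferred chart around `x`. -/
def extDerivative (α : DiffForm I M k) : DiffForm I M (k + 1) := fun x =>
  (extDeriv (α.inChart x) (extChartAt I x x)).compContinuousLinearMap
    (derivAt I 𝓘(ℝ, E) (extChartAt I x) x)

end DiffForm
end Forms

/-! ### Integration over a compact oriented manifold -/

section Integration
variable {n : ℕ} {S : Type*} [TopologicalSpace S] [ChartedSpace (EuclideanSpace ℝ (Fin n)) S]

/-- A volume form: smooth, of top degree and nowhere zero.  It serves as an orientation of `S`
(for `n = 0` it assigns a sign to each point). -/
structure IsVolumeForm (ν : DiffForm (𝓡 n) S n) : Prop where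
  smooth : ν.IsSmooth
  ne_zero : ∀ p, ν p ≠ 0

/-- `f` preserves the orientation given by the volume form `ν`. -/
def PreservesOrientation (ν : DiffForm (𝓡 n) S n) (f : S → S) : Prop :=
  ∀ p, ∃ a : ℝ, 0 < a ∧ DiffForm.pullback (I := 𝓡 n) (I' := 𝓡 n) f ν p = a • ν p

variable [IsManifold (𝓡 n) ∞ S] [CompactSpace S] [T2Space S]

variable (n S) in
/-- A chosen smooth partition of unity subordinate to the preferred charts. -/
def chartPartition : SmoothPartitionOfUnity S (𝓡 n) S Set.univ :=
  (SmoothPartitionOfUnity.exists_isSubordinate_chartAt_source (𝓡 n) S).choose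

/-- The integral of an `n`-form over the compact `n`-manifold `S`, oriented by `ν`: the sum over
the charts of a partition of unity of the integrals of the coordinate expressions.  The sign is
`1` or `-1` according to whether the chart is positively or negatively oriented. -/
def integral (ν α : DiffForm (𝓡 n) S n) : ℝ :=
  ∑ᶠ i : S, ∫ u in (extChartAt (𝓡 n) i).target,
    chartPartition n S i ((extChartAt (𝓡 n) i).symm u) *
      (Real.sign (ν.inChart i u fun j => EuclideanSpace.single j 1) *
        α.inChart i u fun j => EuclideanSpace.single j 1)

end Integration

/-! ### Groups with a Lie algebra, and their smooth actions -/

/-- The structure of a possibly infinite-dimensional Lie group that is used to speak of Lie algebra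
elements, infinitesimal generators and the adjoint representation: `G` has a notion of smooth
curve, `𝔤` is its tangent space at `1` (each element is the velocity at time `0` of a smooth curve
through `1`), group operations and reparametrizations act on smooth curves and their velocities as
usual, and `Ad` is the derivative of conjugation.  The Lie groups of Mathlib are an instance, see
`LieAlgebraOf.ofLieGroup`; groups of diffeomorphisms or bundle automorphisms are others. -/
class LieAlgebraOf (G 𝔤 : Type*) [Group G] [AddCommGroup 𝔤] [Module ℝ 𝔤] where
  /-- smooth curves in the group -/
  IsSmoothCurve : (ℝ → G) → Prop
  /-- the velocity at time `0` of a smooth curve through `1` -/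
  velocity : (ℝ → G) → 𝔤
  /-- the adjoint representation -/
  Ad : G →* (𝔤 →ₗ[ℝ] 𝔤)
  isSmoothCurve_const : ∀ η : G, IsSmoothCurve fun _ => η
  isSmoothCurve_mul : ∀ c d : ℝ → G, IsSmoothCurve c → IsSmoothCurve d →
    IsSmoothCurve fun t => c t * d t
  isSmoothCurve_inv : ∀ c : ℝ → G, IsSmoothCurve c → IsSmoothCurve fun t => (c t)⁻¹
  isSmoothCurve_comp : ∀ (c : ℝ → G) (f : ℝ → ℝ), IsSmoothCurve c → ContDiff ℝ ∞ f →
    IsSmoothCurve fun t => c (f t)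
  velocity_mul : ∀ c d : ℝ → G, IsSmoothCurve c → IsSmoothCurve d → c 0 = 1 → d 0 = 1 →
    velocity (fun t => c t * d t) = velocity c + velocity d
  velocity_comp : ∀ (c : ℝ → G) (f : ℝ → ℝ), IsSmoothCurve c → ContDiff ℝ ∞ f → c 0 = 1 →
    f 0 = 0 → velocity (fun t => c (f t)) = deriv f 0 • velocity c
  velocity_conj : ∀ (η : G) (c : ℝ → G), IsSmoothCurve c → c 0 = 1 →
    velocity (fun t => η * c t * η⁻¹) = Ad η (velocity c)
  exists_curve : ∀ ξ : 𝔤, ∃ c : ℝ → G, IsSmoothCurve c ∧ c 0 = 1 ∧ velocity c = ξ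

open LieAlgebraOf in
/-- `c` is a smooth curve in `G` with `c 0 = 1` and velocity `ξ` at time `0`. -/
def IsCurveWithVelocity {G 𝔤 : Type*} [Group G] [AddCommGroup 𝔤] [Module ℝ 𝔤] [LieAlgebraOf G 𝔤]
    (c : ℝ → G) (ξ : 𝔤) : Prop :=
  IsSmoothCurve 𝔤 c ∧ c 0 = 1 ∧ velocity c = ξ

section LieGroup
variable {E H : Type*} [NormedAddCommGroup E] [NormedSpace ℝ E] [TopologicalSpace H]
  (I : ModelWithCorners ℝ E H) [I.Boundaryless] (G : Type*) [TopologicalSpace G]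
  [ChartedSpace H G] [Group G] [LieGroup I ∞ G]

theorem velocityAt_comp {E' H' : Type*} [NormedAddCommGroup E'] [NormedSpace ℝ E']
    [TopologicalSpace H'] {I : ModelWithCorners ℝ E H} {I' : ModelWithCorners ℝ E' H'}
    {M M' : Type*} [TopologicalSpace M] [ChartedSpace H M] [TopologicalSpace M']
    [ChartedSpace H' M'] {f : M → M'} {c : ℝ → M} {t : ℝ} {x : M} (hx : c t = x)
    (hf : MDifferentiableAt I I' f x) (hc : MDifferentiableAt 𝓘(ℝ, ℝ) I c t) :
    velocityAt I' (fun s => f (c s)) t = derivAt I I' f x (velocityAt I c t) := by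
  subst hx
  exact mfderiv_comp_apply (I := 𝓘(ℝ, ℝ)) (I' := I) (I'' := I') t hf hc (1 : ℝ)

theorem mfderiv_eq_id {I : ModelWithCorners ℝ E H} {M : Type*} [TopologicalSpace M]
    [ChartedSpace H M] {f : M → M} (hf : f = id) (x : M) :
    derivAt I I f x = ContinuousLinearMap.id ℝ E := by
  subst hf; exact mfderiv_id

theorem contMDiff_conj (η : G) : ContMDiff I I ∞ fun g : G => η * g * η⁻¹ :=
  (contMDiff_const.mul contMDiff_id).mul contMDiff_const

/-- The derivative of conjugation by `η` at the identity. -/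
def adjointMap (η : G) : E →L[ℝ] E := derivAt I I (fun g : G => η * g * η⁻¹) 1

theorem adjointMap_one : adjointMap I G 1 = ContinuousLinearMap.id ℝ E :=
  mfderiv_eq_id (by ext; simp) 1

theorem adjointMap_mul (η θ : G) :
    adjointMap I G (η * θ) = (adjointMap I G η).comp (adjointMap I G θ) := by
  have e : (fun g : G => (η * θ) * g * (η * θ)⁻¹) =
      (fun g : G => η * g * η⁻¹) ∘ (fun g : G => θ * g * θ⁻¹) := by ext; simp [mul_assoc]
  have hθ := (contMDiff_conj I G θ).mdifferentiableAt (x := 1) (by simp)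
  have hη : MDifferentiableAt I I (fun g : G => η * g * η⁻¹) (θ * 1 * θ⁻¹) :=
    (contMDiff_conj I G η).mdifferentiableAt (by simp)
  have h : adjointMap I G (η * θ) =
      (derivAt I I (fun g : G => η * g * η⁻¹) (θ * 1 * θ⁻¹)).comp
        (adjointMap I G θ) := by
    unfold adjointMap
    rw [e]; exact mfderiv_comp (1 : G) hη hθ
  have key : ∀ g : G, g = 1 →
      derivAt I I (fun g : G => η * g * η⁻¹) g = adjointMap I G η := by
    rintro _ rfl; rfl
  rw [h, key _ (by simp)]

theorem velocityAt_conj (η : G) {c : ℝ → G} (hc : ContMDiff 𝓘(ℝ, ℝ) I ∞ c) (h0 : c 0 = 1) :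
    velocityAt I (fun t => η * c t * η⁻¹) 0 = adjointMap I G η (velocityAt I c 0) :=
  velocityAt_comp h0 ((contMDiff_conj I G η).mdifferentiableAt (by simp))
    (hc.mdifferentiableAt (by simp))

theorem velocityAt_mul {c d : ℝ → G} (hc : ContMDiff 𝓘(ℝ, ℝ) I ∞ c)
    (hd : ContMDiff 𝓘(ℝ, ℝ) I ∞ d) (hc0 : c 0 = 1) (hd0 : d 0 = 1) :
    velocityAt I (fun t => c t * d t) 0 = velocityAt I c 0 + velocityAt I d 0 := by
  have hm : MDifferentiableAt (I.prod I) I (fun p : G × G => p.1 * p.2) ((1 : G), (1 : G)) :=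
    (contMDiff_mul I ∞).mdifferentiableAt (by simp)
  have hc' : MDifferentiableAt 𝓘(ℝ, ℝ) I c 0 := hc.mdifferentiableAt (by simp)
  have hd' : MDifferentiableAt 𝓘(ℝ, ℝ) I d 0 := hd.mdifferentiableAt (by simp)
  have hp : velocityAt (I.prod I) (fun t => (c t, d t)) 0 =
      ((velocityAt I c 0, velocityAt I d 0) : E × E) := by
    unfold velocityAt
    rw [mfderiv_prodMk hc' hd']; rfl
  have h2 := mfderiv_prod_eq_add_apply hm (v := ((velocityAt I c 0, velocityAt I d 0) : E × E))
  refine (velocityAt_comp (x := ((1 : G), (1 : G))) (Prod.ext hc0 hd0) hm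
    (hc'.prodMk hd')).trans ?_
  rw [hp]
  refine Eq.trans h2 ?_
  refine congrArg₂ (fun a b : E => a + b) ?_ ?_
  · exact congrArg (fun L : E →L[ℝ] E => L (velocityAt I c 0))
      (mfderiv_eq_id (I := I) (f := fun z : G => z * 1) (by ext; simp) 1)
  · exact congrArg (fun L : E →L[ℝ] E => L (velocityAt I d 0))
      (mfderiv_eq_id (I := I) (f := fun z : G => 1 * z) (by ext; simp) 1)

theorem velocityAt_reparam {c : ℝ → G} (hc : ContMDiff 𝓘(ℝ, ℝ) I ∞ c) {f : ℝ → ℝ}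
    (hf : ContDiff ℝ ∞ f) (f0 : f 0 = 0) :
    velocityAt I (fun t => c (f t)) 0 = deriv f 0 • velocityAt I c 0 := by
  have hf' : DifferentiableAt ℝ f 0 := hf.contDiffAt.differentiableAt (by simp)
  have hv : velocityAt 𝓘(ℝ, ℝ) f 0 = deriv f 0 • (1 : ℝ) := by
    unfold velocityAt; rw [mfderiv_eq_fderiv, smul_eq_mul, mul_one]; rfl
  rw [velocityAt_comp (f := c) (c := f) f0 (hc.mdifferentiableAt (by simp))
    hf'.mdifferentiableAt, hv, map_smul]
  rfl

theorem exists_curve_velocity (v : E) :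
    ∃ c : ℝ → G, ContMDiff 𝓘(ℝ, ℝ) I ∞ c ∧ c 0 = 1 ∧ velocityAt I c 0 = v := by
  have : IsManifold I ∞ G := LieGroup.toContMDiffMul.toIsManifold
  set φ := extChartAt I (1 : G) with hφ
  have h1 : φ 1 ∈ φ.target := mem_extChartAt_target (I := I) 1
  obtain ⟨r, hr, hball⟩ := Metric.isOpen_iff.1 (isOpen_extChartAt_target (I := I) (1 : G)) _ h1
  obtain ⟨ε, hε, hεr⟩ : ∃ ε : ℝ, 0 < ε ∧ ε * ‖v‖ < r := by
    refine ⟨r / (‖v‖ + 1), by positivity, ?_⟩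
    rw [div_mul_eq_mul_div, div_lt_iff₀ (by positivity)]
    nlinarith [norm_nonneg v]
  let γ : ℝ → E := fun t => φ 1 + (ε * Real.sin (t / ε)) • v
  have hγ : ContDiff ℝ ∞ γ := by
    refine contDiff_const.add (ContDiff.smul (contDiff_const.mul ?_) contDiff_const)
    exact Real.contDiff_sin.comp (contDiff_id.div_const ε)
  have hγt : ∀ t, γ t ∈ φ.target := fun t => hball <| by
    have : |ε * Real.sin (t / ε)| ≤ ε := by
      rw [abs_mul, abs_of_pos hε]
      exact mul_le_of_le_one_right hε.le (Real.abs_sin_le_one _)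
    have h := mul_le_mul_of_nonneg_right this (norm_nonneg v)
    simp only [γ, Metric.mem_ball, dist_eq_norm, add_sub_cancel_left, norm_smul,
      Real.norm_eq_abs]
    linarith
  have hγ0 : γ 0 = φ 1 := by simp [γ]
  have hγv : velocityAt 𝓘(ℝ, E) γ 0 = v := by
    have hs : HasDerivAt (fun t : ℝ => ε * Real.sin (t / ε)) 1 0 := by
      have := (((hasDerivAt_id (0 : ℝ)).div_const ε).sin).const_mul ε
      refine this.congr_deriv ?_
      simp; field_simp
    have hd : HasDerivAt γ ((1 : ℝ) • v) 0 := (hs.smul_const v).const_add _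
    unfold velocityAt
    rw [mfderiv_eq_fderiv]
    simpa using hd.hasFDerivAt.fderiv ▸ (by simp : (ContinuousLinearMap.toSpanSingleton ℝ ((1 : ℝ) • v)) 1 = v)
  have hsymm : ContMDiffOn 𝓘(ℝ, E) I ∞ φ.symm φ.target := contMDiffOn_extChartAt_symm 1
  refine ⟨fun t => φ.symm (γ t), hsymm.comp_contMDiff hγ.contMDiff hγt, ?_, ?_⟩
  · simp [hγ0, hφ]
  · rw [velocityAt_comp hγ0 (((hsymm _ h1).mdifferentiableWithinAt (by simp)).mdifferentiableAt
      ((isOpen_extChartAt_target (I := I) (1 : G)).mem_nhds h1))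
      (hγ.contDiffAt.differentiableAt (by simp)).mdifferentiableAt, hγv]
    have h := mfderivWithin_range_extChartAt_symm (I := I) (x := (1 : G))
    rw [I.range_eq_univ, mfderivWithin_univ] at h
    exact congrArg (fun L : E →L[ℝ] E => L v) h

/-- A Lie group (without boundary, possibly modelled on an infinite-dimensional normed space) with
its Lie algebra, its smooth curves and its adjoint representation. -/
abbrev LieAlgebraOf.ofLieGroup : LieAlgebraOf G (GroupLieAlgebra I G) where
  IsSmoothCurve c := ContMDiff 𝓘(ℝ, ℝ) I ∞ c
  velocity c := (velocityAt I c 0 : E)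
  Ad :=
    { toFun := fun η => (adjointMap I G η).toLinearMap
      map_one' := by rw [adjointMap_one]; rfl
      map_mul' := fun η θ => by rw [adjointMap_mul]; rfl }
  isSmoothCurve_const η := contMDiff_const
  isSmoothCurve_mul c d hc hd := hc.mul hd
  isSmoothCurve_inv c hc := hc.inv
  isSmoothCurve_comp c f hc hf := hc.comp hf.contMDiff
  velocity_mul c d hc hd hc0 hd0 := velocityAt_mul I G hc hd hc0 hd0
  velocity_comp c f hc hf _ f0 := velocityAt_reparam I G hc hf f0
  velocity_conj η c hc h0 := velocityAt_conj I G η hc h0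
  exists_curve v := exists_curve_velocity I G v

end LieGroup

section Action
variable {E H : Type*} [NormedAddCommGroup E] [NormedSpace ℝ E] [TopologicalSpace H]
  (I : ModelWithCorners ℝ E H) {M : Type*} [TopologicalSpace M] [ChartedSpace H M]
  {G 𝔤 : Type*} [Group G] [AddCommGroup 𝔤] [Module ℝ 𝔤] [LieAlgebraOf G 𝔤]

variable (G 𝔤 M) in
/-- A smooth action of `G` on `M`: smooth curves in the group act smoothly, and the derivative of
the action in the direction of the group depends only on the velocity. -/
structure IsSmoothAction [MulAction G M] : Prop where
  contMDiff : ∀ c : ℝ → G, LieAlgebraOf.IsSmoothCurve 𝔤 c →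
    ContMDiff (𝓘(ℝ, ℝ).prod I) I ∞ fun q : ℝ × M => c q.1 • q.2
  velocity_eq : ∀ (ξ : 𝔤) (c d : ℝ → G), IsCurveWithVelocity c ξ → IsCurveWithVelocity d ξ →
    ∀ m : M, velocityAt I (fun t => c t • m) 0 = velocityAt I (fun t => d t • m) 0

variable (G) in
/-- The infinitesimal generator `ξ_M`: the velocity at time `0` of `c t • m`, for any smooth curve
`c` in `G` through `1` with velocity `ξ`. -/
def infinitesimalGenerator [MulAction G M] (ξ : 𝔤) (m : M) : E :=
  velocityAt I (fun t => (LieAlgebraOf.exists_curve (G := G) ξ).choose t • m) 0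

end Action

/-! ### The multimomentum phase space with its canonical forms -/

section Canonical
variable (n : ℕ) (EY F : Type*) [NormedAddCommGroup EY] [NormedSpace ℝ EY]
  [NormedAddCommGroup F] [NormedSpace ℝ F] [FiniteDimensional ℝ F]

/-- The vector space on which the phase space of `(n+1)`-forms is modelled. -/
abbrev PhaseModelSpace : Type _ := EY × PhaseFibre (EuclideanSpace ℝ (Fin (n + 1))) F (n + 1)

/-- The model with corners of the phase space (there are no corners). -/
abbrev phaseModel :=
  𝓘(ℝ, EY).prod 𝓘(ℝ, PhaseFibre (EuclideanSpace ℝ (Fin (n + 1))) F (n + 1))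

variable {n EY F}
  {X Y : Type*} [TopologicalSpace X] [ChartedSpace (EuclideanSpace ℝ (Fin (n + 1))) X]
  [TopologicalSpace Y] [ChartedSpace EY Y] {π : Y → X}
  (hπ : Manifold.IsSubmersionOfComplement F 𝓘(ℝ, EY) (𝓡 (n + 1)) ∞ π)

/-- The projection of the phase space to `X`. -/
def phaseProj (z : PhaseSpace (n + 1) hπ) : X := π z.proj

/-- The canonical form `Θ`: at `z` it is the pullback of the form `z` on `Y`. -/
def canonicalTheta : DiffForm (phaseModel n EY F) (PhaseSpace (n + 1) hπ) (n + 1) := fun z =>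
  (tautForm (n + 1) hπ z).compContinuousLinearMap
    (derivAt (phaseModel n EY F) 𝓘(ℝ, EY) (fun w : PhaseSpace (n + 1) hπ => w.proj) z)

/-- The canonical multisymplectic form `Ω = -dΘ`. -/
def canonicalOmega : DiffForm (phaseModel n EY F) (PhaseSpace (n + 1) hπ) (n + 1 + 1) := fun z =>
  -(canonicalTheta hπ).extDerivative z

end Canonical

/-! ### Covariant momentum maps -/

section Momentum
variable {E H : Type*} [NormedAddCommGroup E] [NormedSpace ℝ E] [TopologicalSpace H]
  {I : ModelWithCorners ℝ E H} {M : Type*} [TopologicalSpace M] [ChartedSpace H M]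
  {G 𝔤 : Type*} [Group G] [AddCommGroup 𝔤] [Module ℝ 𝔤] [LieAlgebraOf G 𝔤] [MulAction G M] {k : ℕ}

variable (G) in
/-- `J` (with `J ξ = ⟨J, ξ⟩`) is a covariant momentum map with respect to the form `Ω`:
`d⟨J, ξ⟩ = i_{ξ_M} Ω` for all `ξ`. -/
structure IsCovariantMomentumMap (Ω : DiffForm I M (k + 1 + 1)) (J : 𝔤 →ₗ[ℝ] DiffForm I M k) :
    Prop where
  smooth : ∀ ξ, DiffForm.IsSmooth (I := I) (J ξ)
  extDerivative_eq : ∀ ξ m, DiffForm.extDerivative (I := I) (J ξ) m =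
    (Ω m).curryLeft (infinitesimalGenerator I G ξ m)

variable (G) in
/-- `J` is `Ad*`-equivariant: `⟨J, Ad_{η⁻¹} ξ⟩ = η^* ⟨J, ξ⟩`. -/
def IsAdEquivariant (J : 𝔤 →ₗ[ℝ] DiffForm I M k) : Prop :=
  ∀ (η : G) (ξ : 𝔤), J (LieAlgebraOf.Ad η⁻¹ ξ) =
    DiffForm.pullback (I := I) (I' := I) (fun m => η • m) (J ξ)

end Momentum

/-! ### The stabilizer of a hypersurface -/

section Stabilizer
open scoped Pointwise
variable (G : Type*) {X S : Type*} [Group G] [MulAction G X] (τ : S → X)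

/-- The subgroup of the elements that map the image of `τ` onto itself. -/
def surfaceStabilizer : Subgroup G := MulAction.stabilizer G (Set.range τ)

theorem exists_of_mem_surfaceStabilizer (η : surfaceStabilizer G τ) (p : S) :
    ∃ p' : S, τ p' = (η : G) • τ p := by
  have h : (η : G) • Set.range τ = Set.range τ := η.2
  exact h.subset (Set.smul_mem_smul_set (Set.mem_range_self p))

variable {G τ} in
/-- The map of `S` to itself that an element of the stabilizer induces through the injective
map `τ`. -/
def inducedMap (η : surfaceStabilizer G τ) (p : S) : S :=
  (exists_of_mem_surfaceStabilizer G τ η p).choose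

variable {G τ} in
/-- The action of the stabilizer on maps `σ` from `S` to a `G`-space: `η ∘ σ ∘ (η_S)⁻¹`, where
`η_S` is the induced map of `S` and `(η_S)⁻¹ = (η⁻¹)_S`. -/
def fieldAction {M : Type*} [MulAction G M] (η : surfaceStabilizer G τ) (σ : S → M) : S → M :=
  fun p => (η : G) • σ (inducedMap η⁻¹ p)

variable (𝔤 : Type*) [AddCommGroup 𝔤] [Module ℝ 𝔤] [LieAlgebraOf G 𝔤]

/-- The Lie algebra of the stabilizer: the velocities at `1` of the smooth curves in `G` that stay
in the stabilizer. -/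
def surfaceLieAlgebra : Submodule ℝ 𝔤 where
  carrier := {ξ | ∃ c : ℝ → G, IsCurveWithVelocity c ξ ∧ ∀ t, c t ∈ surfaceStabilizer G τ}
  add_mem' := by
    rintro ξ ζ ⟨c, ⟨hc, hc0, rfl⟩, hcm⟩ ⟨d, ⟨hd, hd0, rfl⟩, hdm⟩
    exact ⟨fun t => c t * d t, ⟨LieAlgebraOf.isSmoothCurve_mul c d hc hd, by simp [hc0, hd0],
      LieAlgebraOf.velocity_mul c d hc hd hc0 hd0⟩, fun t => mul_mem (hcm t) (hdm t)⟩
  zero_mem' := by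
    obtain ⟨c, hc, hc0, hcv⟩ := LieAlgebraOf.exists_curve (G := G) (0 : 𝔤)
    have hf : ContDiff ℝ ∞ (fun _ : ℝ => (0 : ℝ)) := contDiff_const
    refine ⟨fun _ => c 0, ⟨LieAlgebraOf.isSmoothCurve_const _, hc0, ?_⟩, fun _ => ?_⟩
    · rw [LieAlgebraOf.velocity_comp c (fun _ => 0) hc hf hc0 rfl, hcv, smul_zero]
    · rw [hc0]; exact one_mem _
  smul_mem' := by
    rintro a ξ ⟨c, ⟨hc, hc0, rfl⟩, hcm⟩
    have hf : ContDiff ℝ ∞ (fun t : ℝ => a * t) := contDiff_const.mul contDiff_id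
    refine ⟨fun t => c (a * t), ⟨LieAlgebraOf.isSmoothCurve_comp c _ hc hf, by simp [hc0], ?_⟩,
      fun t => hcm _⟩
    rw [LieAlgebraOf.velocity_comp c _ hc hf hc0 (by simp)]
    congr 1
    simp

theorem Ad_mem_surfaceLieAlgebra (η : surfaceStabilizer G τ) (ξ : 𝔤)
    (hξ : ξ ∈ surfaceLieAlgebra G τ 𝔤) :
    LieAlgebraOf.Ad (η : G) ξ ∈ surfaceLieAlgebra G τ 𝔤 := by
  obtain ⟨c, ⟨hc, hc0, rfl⟩, hcm⟩ := hξ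
  refine ⟨fun t => (η : G) * c t * (η : G)⁻¹, ⟨?_, by simp [hc0],
    LieAlgebraOf.velocity_conj _ c hc hc0⟩,
    fun t => mul_mem (mul_mem η.2 (hcm t)) (inv_mem η.2)⟩
  exact LieAlgebraOf.isSmoothCurve_mul _ _ (LieAlgebraOf.isSmoothCurve_mul _ _
    (LieAlgebraOf.isSmoothCurve_const _) hc) (LieAlgebraOf.isSmoothCurve_const _)

variable {G τ 𝔤} in
/-- The adjoint action of the stabilizer on its Lie algebra. -/
def surfaceAd (η : surfaceStabilizer G τ) (ξ : surfaceLieAlgebra G τ 𝔤) :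
    surfaceLieAlgebra G τ 𝔤 :=
  ⟨LieAlgebraOf.Ad (η : G) ξ, Ad_mem_surfaceLieAlgebra G τ 𝔤 η ξ ξ.2⟩

end Stabilizer

/-! ### Fields over a hypersurface -/

section Instantaneous
variable {E H : Type*} [NormedAddCommGroup E] [NormedSpace ℝ E] [TopologicalSpace H]
  (I : ModelWithCorners ℝ E H) {M : Type*} [TopologicalSpace M] [ChartedSpace H M]
  (n : ℕ) {S : Type*} [TopologicalSpace S] [ChartedSpace (EuclideanSpace ℝ (Fin n)) S]
  {X : Type*} [TopologicalSpace X] [ChartedSpace (EuclideanSpace ℝ (Fin (n + 1))) X]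
  (q : M → X) (τ : S → X)

/-- The smooth sections over `τ` of the projection `q : M → X`. -/
def fieldSpace : Set (S → M) :=
  {σ | ContMDiff (𝓡 n) I ∞ σ ∧ ∀ p, q (σ p) = τ p}

/-- A family of sections that is smooth in the parameter and the point together: a smooth
curve (`P = ℝ`) or a smooth surface (`P = ℝ × ℝ`) in the space of sections. -/
structure IsSmoothFamily {P : Type*} [NormedAddCommGroup P] [NormedSpace ℝ P]
    (Γ : P → S → M) : Prop where
  contMDiff : ContMDiff (𝓘(ℝ, P).prod (𝓡 n)) I ∞ fun r : P × S => Γ r.1 r.2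
  mem : ∀ t, Γ t ∈ fieldSpace I n q τ

/-- Tangent vectors to the space of sections at `σ`: smooth vector fields along `σ` that are
vertical over `X`. -/
structure IsTangentField [IsManifold I 1 M] (σ : S → M) (V : S → E) : Prop where
  contMDiff : ContMDiff (𝓡 n) I.tangent ∞ fun p => (⟨σ p, V p⟩ : TangentBundle I M)
  vertical : ∀ p, derivAt I (𝓡 (n + 1)) q (σ p) (V p) = 0

/-- The velocity at time `t` of a curve of maps from `S` to `M`. -/
def fieldVelocity (Γ : ℝ → S → M) (t : ℝ) : S → E := fun p => velocityAt I (fun s => Γ s p) t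

/-- The function `f` on the space of sections has the derivative `l` at `σ` in the direction `V`:
the derivative of `f` along every smooth curve of sections through `σ` with velocity `V` is `l`. -/
def HasDifferential (f : (S → M) → ℝ) (σ : S → M) (V : S → E) (l : ℝ) : Prop :=
  ∀ Γ : ℝ → S → M, IsSmoothFamily I n q τ Γ → Γ 0 = σ → fieldVelocity I Γ 0 = V →
    HasDerivAt (fun t => f (Γ t)) l 0

variable {I n}
variable [IsManifold (𝓡 n) ∞ S] [CompactSpace S] [T2Space S] (ν : DiffForm (𝓡 n) S n)

/-- The one-form `Θ_τ(σ)(V) = ∫ σ^*(i_V Θ)` on the space of sections. -/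
def instantTheta (Θ : DiffForm I M (n + 1)) (σ : S → M) (V : S → E) : ℝ :=
  integral ν fun p => ((Θ (σ p)).curryLeft (V p)).compContinuousLinearMap (derivAt (𝓡 n) I σ p)

/-- The two-form `Ω_τ(σ)(V, W) = ∫ σ^*(i_W i_V Ω)` on the space of sections. -/
def instantOmega (Ω : DiffForm I M (n + 1 + 1)) (σ : S → M) (V W : S → E) : ℝ :=
  integral ν fun p => (((Ω (σ p)).curryLeft (V p)).curryLeft (W p)).compContinuousLinearMap
    (derivAt (𝓡 n) I σ p)

/-- `Ω_τ = -dΘ_τ`: on every smooth surface `Γ` of sections, with parameters `s` and `t`,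
`Ω_τ(∂_s Γ, ∂_t Γ) = -(∂_s (Θ_τ(∂_t Γ)) - ∂_t (Θ_τ(∂_s Γ)))`. -/
def IsMinusDifferential (Θ : DiffForm I M (n + 1)) (Ω : DiffForm I M (n + 1 + 1)) : Prop :=
  ∀ Γ : ℝ × ℝ → S → M, IsSmoothFamily I n q τ Γ → ∃ a b : ℝ,
    HasDerivAt (fun s => instantTheta ν Θ (Γ (s, 0)) (fieldVelocity I (fun t => Γ (s, t)) 0)) a 0 ∧
    HasDerivAt (fun t => instantTheta ν Θ (Γ (0, t)) (fieldVelocity I (fun s => Γ (s, t)) 0)) b 0 ∧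
    instantOmega ν Ω (Γ (0, 0)) (fieldVelocity I (fun s => Γ (s, 0)) 0)
      (fieldVelocity I (fun t => Γ (0, t)) 0) = -(a - b)

variable {G 𝔤 : Type*} [Group G] [MulAction G X] [MulAction G M]
  [AddCommGroup 𝔤] [Module ℝ 𝔤] [LieAlgebraOf G 𝔤]

/-- The map `⟨J_τ(σ), ξ⟩ = ∫ σ^*⟨J, ξ⟩`, for `ξ` in the Lie algebra of the stabilizer. -/
def instantMomentum (J : 𝔤 →ₗ[ℝ] DiffForm I M n) (σ : S → M) (ξ : surfaceLieAlgebra G τ 𝔤) : ℝ :=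
  integral ν (DiffForm.pullback (I := 𝓡 n) (I' := I) σ (J ξ))

/-- `j` is a momentum map for the action of the stabilizer on the space of sections with the form
`Ω_τ`: each `j σ` is a linear functional on the Lie algebra of the stabilizer, and
`d⟨j, ξ⟩(V) = Ω_τ(ξ_𝒵, V)` for every tangent vector `V`.  Here `ξ_𝒵` is the infinitesimal generator,
the velocity at time `0` of the smooth curve `c t • σ` of sections, for any smooth curve `c` in the
stabilizer through `1` with velocity `ξ`. -/
def IsInstantMomentumMap [IsManifold I 1 M] (Ω : DiffForm I M (n + 1 + 1))
    (j : (S → M) → surfaceLieAlgebra G τ 𝔤 → ℝ) : Prop :=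
  ∀ σ ∈ fieldSpace I n q τ, IsLinearMap ℝ (j σ) ∧
    ∀ (ξ : surfaceLieAlgebra G τ 𝔤) (c : ℝ → surfaceStabilizer G τ),
      IsCurveWithVelocity (fun t => (c t : G)) (ξ : 𝔤) →
        IsSmoothFamily I n q τ (fun t => fieldAction (c t) σ) ∧
        ∀ V, IsTangentField I n q σ V → HasDifferential I n q τ (fun σ' => j σ' ξ) σ V
          (instantOmega ν Ω σ (fieldVelocity I (fun t => fieldAction (c t) σ) 0) V)

end Instantaneous
end Multisymplectic

end

/-!
The forms on the space of sections and the momentum map are integrals over the compact manifold `S`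
of pullbacks of differential forms, so that all that is needed is the calculus of such integrals
along smooth families of maps `Γ : P → S → M`.

* A derivative with respect to the parameter may be taken under the integral sign
  (`hasDerivAt_integral`).
* On `P × S`, Cartan's formula for the constant vector fields along `P` expresses the derivative of
  the forms `Γ_t^* α`, respectively `Γ_t^*(i_w α)`, through `dα` and an exact form on `S`
  (`exists_formVelocity_pullback_eq`, `exists_formVelocity_sliceContract_eq`).
* The exact form has integral zero by Stokes' theorem (`integral_extDerivative`).

With `α = Θ` on two-parameter families this is `Ω_τ = -dΘ_τ`; it requires that `Θ` be smooth
(`isSmooth_canonicalTheta`). With `α = ⟨J, ξ⟩` on curves it shows that the derivative of `⟨J_τ, ξ⟩`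
in the direction `V` is the integral of `σ^*(i_V i_{ξ_Z} Ω)`. The generator of the action on
sections at `σ` is not `ξ_Z ∘ σ` but differs from it by a vector field tangent to the section, which
comes from the motion of the surface in itself (`exists_fieldVelocity_fieldAction`). The tangent
term contributes the contraction of an `(n + 1)`-form on the `n`-dimensional manifold `S`, hence
nothing (`curryLeft_curryLeft_comp_eq_zero`), and `J_τ` is a momentum map.

Equivariance is the invariance of the integral under diffeomorphisms that preserve the orientation
(`integral_pullback`), for the diffeomorphism of `S` that an element of the stabilizer induces; it
is smooth since `τ` is an embedding (`contMDiff_inducedMap`).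

The integral is defined by a partition of unity subordinate to the preferred charts. Both Stokes'
theorem and the invariance are reduced to forms supported in one chart, for which the integral can
be computed in any smooth chart that contains the support (`integral_eq_of_support`).
-/

noncomputable section

namespace Multisymplectic

/-! ### Pullback of forms and the exterior derivative -/

section Pullback
variable {E H : Type*} [NormedAddCommGroup E] [NormedSpace ℝ E] [TopologicalSpace H]
  {I : ModelWithCorners ℝ E H} {M : Type*} [TopologicalSpace M] [ChartedSpace H M]
  {E' H' : Type*} [NormedAddCommGroup E'] [NormedSpace ℝ E'] [TopologicalSpace H']
  {I' : ModelWithCorners ℝ E' H'} {M' : Type*} [TopologicalSpace M'] [ChartedSpace H' M']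
  {E'' H'' : Type*} [NormedAddCommGroup E''] [NormedSpace ℝ E''] [TopologicalSpace H'']
  {I'' : ModelWithCorners ℝ E'' H''} {M'' : Type*} [TopologicalSpace M''] [ChartedSpace H'' M'']
  {V : Type*} [NormedAddCommGroup V] [NormedSpace ℝ V] {k : ℕ}

/-- The domain of the linear maps is finite-dimensional, but that of the forms is arbitrary.
Smoothness is known for multilinear maps, and alternating maps on a finite-dimensional space are a
complemented subspace of these. -/
theorem contDiffAt_compContinuousLinearMap {W : Type*} [NormedAddCommGroup W] [NormedSpace ℝ W]
    [FiniteDimensional ℝ W] {β : V → E [⋀^Fin k]→L[ℝ] ℝ} {A : V → W →L[ℝ] E} {u : V}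
    (hβ : ContDiffAt ℝ ∞ β u) (hA : ContDiffAt ℝ ∞ A u) :
    ContDiffAt ℝ ∞ (fun v => (β v).compContinuousLinearMap (A v)) u := by
  have := finiteDimensional_forms W k
  have := finiteDimensional_multilinear W k
  let inc : (W [⋀^Fin k]→L[ℝ] ℝ) →L[ℝ] ContinuousMultilinearMap ℝ (fun _ : Fin k => W) ℝ :=
    ContinuousAlternatingMap.toContinuousMultilinearMapCLM ℝ
  let incE : (E [⋀^Fin k]→L[ℝ] ℝ) →L[ℝ] ContinuousMultilinearMap ℝ (fun _ : Fin k => E) ℝ :=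
    ContinuousAlternatingMap.toContinuousMultilinearMapCLM ℝ
  obtain ⟨L, hL⟩ := inc.toLinearMap.exists_leftInverse_of_injective
    (LinearMap.ker_eq_bot.2 ContinuousAlternatingMap.toContinuousMultilinearMap_injective)
  have h1 : ContDiff ℝ ∞ (fun p : (Fin k → W →L[ℝ] E) ×
      ContinuousMultilinearMap ℝ (fun _ : Fin k => E) ℝ => p.2.compContinuousLinearMap p.1) :=
    contDiff_iff_contDiffAt.2 fun q =>
      (ContinuousMultilinearMap.analyticAt_uncurry_compContinuousLinearMap (𝕜 := ℝ)
        (Fm := fun _ : Fin k => W) (Em := fun _ : Fin k => E) (G := ℝ) (q := q)).contDiffAt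
  have h2 : ContDiffAt ℝ ∞ (fun v => ((fun _ : Fin k => A v), incE (β v))) u :=
    (contDiffAt_pi.2 fun _ => hA).prodMk (incE.contDiff.contDiffAt.comp u hβ)
  have h3 := (LinearMap.toContinuousLinearMap L).contDiff (n := ∞) |>.contDiffAt.comp u
    (h1.contDiffAt.comp u h2)
  have h4 : (fun v => (β v).compContinuousLinearMap (A v)) = fun v =>
      LinearMap.toContinuousLinearMap L
        ((incE (β v)).compContinuousLinearMap (fun _ : Fin k => A v)) :=
    funext fun v => (LinearMap.congr_fun hL ((β v).compContinuousLinearMap (A v))).symm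
  rw [h4]
  exact h3

theorem derivAt_comp {f : M' → M''} {g : M → M'} {x : M}
    (hf : MDifferentiableAt I' I'' f (g x)) (hg : MDifferentiableAt I I' g x) :
    derivAt I I'' (fun y => f (g y)) x = (derivAt I' I'' f (g x)).comp (derivAt I I' g x) :=
  mfderiv_comp x hf hg

theorem derivAt_congr {f g : M → M'} {x : M} (h : f =ᶠ[𝓝 x] g) :
    derivAt I I' f x = derivAt I I' g x :=
  h.mfderiv_eq

theorem derivAt_eq_fderiv {f : V → E} {u : V} :
    derivAt 𝓘(ℝ, V) 𝓘(ℝ, E) f u = fderiv ℝ f u :=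
  mfderiv_eq_fderiv

theorem DiffForm.pullback_comp {f : M' → M''} {g : M → M'} {x : M} (α : DiffForm I'' M'' k)
    (hf : MDifferentiableAt I' I'' f (g x)) (hg : MDifferentiableAt I I' g x) :
    DiffForm.pullback (I := I) (I' := I'') (fun y => f (g y)) α x =
      DiffForm.pullback (I := I) (I' := I') g (DiffForm.pullback (I := I') (I' := I'') f α) x := by
  unfold DiffForm.pullback
  rw [derivAt_comp hf hg]
  rfl

theorem DiffForm.pullback_congr {f g : M → M'} {x : M} (α : DiffForm I' M' k)
    (h : f =ᶠ[𝓝 x] g) :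
    DiffForm.pullback (I := I) (I' := I') f α x = DiffForm.pullback (I := I) (I' := I') g α x := by
  unfold DiffForm.pullback
  rw [derivAt_congr h, h.eq_of_nhds]

theorem DiffForm.pullback_eq_self {f : M → M} {x : M} (α : DiffForm I M k)
    (h : f =ᶠ[𝓝 x] id) : DiffForm.pullback (I := I) (I' := I) f α x = α x := by
  rw [DiffForm.pullback_congr α h]
  unfold DiffForm.pullback
  rw [mfderiv_eq_id rfl]
  rfl

section Chart
variable [IsManifold I ∞ M]

theorem mdifferentiableAt_extChartAt' {x₀ x : M} (hx : x ∈ (extChartAt I x₀).source) :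
    MDifferentiableAt I 𝓘(ℝ, E) (extChartAt I x₀) x :=
  ((contMDiffAt_extChartAt' (I := I) (n := ∞) (by simpa using hx)).mdifferentiableAt (by simp))

variable [I.Boundaryless]

theorem mdifferentiableAt_extChartAt_symm {x₀ : M} {u : E} (hu : u ∈ (extChartAt I x₀).target) :
    MDifferentiableAt 𝓘(ℝ, E) I (extChartAt I x₀).symm u :=
  ((contMDiffOn_extChartAt_symm (n := ∞) x₀).contMDiffAt
    ((isOpen_extChartAt_target x₀).mem_nhds hu)).mdifferentiableAt (by simp)

theorem extChartAt_symm_eventuallyEq {x₀ : M} {x : M} (hx : x ∈ (extChartAt I x₀).source) :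
    (fun y => (extChartAt I x₀).symm (extChartAt I x₀ y)) =ᶠ[𝓝 x] id :=
  Filter.mem_of_superset ((isOpen_extChartAt_source x₀).mem_nhds hx)
    fun _ hy => (extChartAt I x₀).left_inv hy

/-- A form is recovered from its coordinate expression. -/
theorem DiffForm.eq_pullback_inChart (α : DiffForm I M k) {x₀ x : M}
    (hx : x ∈ (extChartAt I x₀).source) :
    α x = (α.inChart x₀ (extChartAt I x₀ x)).compContinuousLinearMap
      (derivAt I 𝓘(ℝ, E) (extChartAt I x₀) x) := by
  have h := DiffForm.pullback_comp (I := I) (I' := 𝓘(ℝ, E)) α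
    (mdifferentiableAt_extChartAt_symm ((extChartAt I x₀).map_source hx))
    (mdifferentiableAt_extChartAt' hx)
  rw [DiffForm.pullback_eq_self α (extChartAt_symm_eventuallyEq hx)] at h
  exact h

/-- The pullback along `g`, computed near `u` in a single chart at the target. -/
theorem DiffForm.pullback_eventuallyEq (α : DiffForm I M k) {g : V → M} {U : Set V}
    (hU : IsOpen U) (hg : ContMDiffOn 𝓘(ℝ, V) I ∞ g U) {u : V} (hu : u ∈ U) {x₀ : M}
    (hx : g u ∈ (extChartAt I x₀).source) :
    DiffForm.pullback (I := 𝓘(ℝ, V)) (I' := I) g α =ᶠ[𝓝 u] fun v =>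
      (α.inChart x₀ (extChartAt I x₀ (g v))).compContinuousLinearMap
        (fderiv ℝ (fun w => extChartAt I x₀ (g w)) v) := by
  have hc : ContinuousAt g u := (hg.continuousOn.continuousAt (hU.mem_nhds hu))
  filter_upwards [hU.mem_nhds hu, hc.preimage_mem_nhds ((isOpen_extChartAt_source x₀).mem_nhds hx)]
    with v hv hvx
  have hgv : MDifferentiableAt 𝓘(ℝ, V) I g v :=
    (hg.contMDiffAt (hU.mem_nhds hv)).mdifferentiableAt (by simp)
  unfold DiffForm.pullback
  rw [α.eq_pullback_inChart hvx, ← derivAt_eq_fderiv,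
    derivAt_comp (mdifferentiableAt_extChartAt' hvx) hgv]
  rfl

theorem contDiffAt_extChartAt_comp {g : V → M} {U : Set V}
    (hU : IsOpen U) (hg : ContMDiffOn 𝓘(ℝ, V) I ∞ g U) {u : V} (hu : u ∈ U) {x₀ : M}
    (hx : g u ∈ (extChartAt I x₀).source) :
    ContDiffAt ℝ ∞ (fun w => extChartAt I x₀ (g w)) u := by
  rw [← contMDiffAt_iff_contDiffAt]
  exact (contMDiffAt_extChartAt' (by simpa using hx)).comp u (hg.contMDiffAt (hU.mem_nhds hu))

/-- The pullback of a smooth form to an open subset of a vector space is smooth. -/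
theorem DiffForm.IsSmooth.contDiffAt_pullback [FiniteDimensional ℝ V] {α : DiffForm I M k}
    (hα : α.IsSmooth) {g : V → M} {U : Set V}
    (hU : IsOpen U) (hg : ContMDiffOn 𝓘(ℝ, V) I ∞ g U) {u : V} (hu : u ∈ U) :
    ContDiffAt ℝ ∞ (DiffForm.pullback (I := 𝓘(ℝ, V)) (I' := I) g α) u := by
  have hx := mem_extChartAt_source (I := I) (g u)
  have h := contDiffAt_extChartAt_comp hU hg hu hx
  refine ContDiffAt.congr_of_eventuallyEq ?_ (α.pullback_eventuallyEq hU hg hu hx)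
  refine contDiffAt_compContinuousLinearMap ?_ (h.fderiv_right (m := ∞) (by simp))
  exact ((hα (g u)).contDiffAt ((isOpen_extChartAt_target (g u)).mem_nhds
    ((extChartAt I (g u)).map_source hx))).comp u h

/-- The exterior derivative, which is defined with the preferred chart at each point, commutes with
the pullback to a vector space. -/
theorem DiffForm.IsSmooth.extDeriv_pullback {α : DiffForm I M k}
    (hα : α.IsSmooth) {g : V → M} {U : Set V}
    (hU : IsOpen U) (hg : ContMDiffOn 𝓘(ℝ, V) I ∞ g U) {u : V} (hu : u ∈ U) :
    extDeriv (DiffForm.pullback (I := 𝓘(ℝ, V)) (I' := I) g α) u =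
      DiffForm.pullback (I := 𝓘(ℝ, V)) (I' := I) g α.extDerivative u := by
  have hx := mem_extChartAt_source (I := I) (g u)
  have h := contDiffAt_extChartAt_comp hU hg hu hx
  have hgu : MDifferentiableAt 𝓘(ℝ, V) I g u :=
    (hg.contMDiffAt (hU.mem_nhds hu)).mdifferentiableAt (by simp)
  rw [(α.pullback_eventuallyEq hU hg hu hx).extDeriv_eq,
    _root_.extDeriv_pullback (f := fun w => extChartAt I (g u) (g w)) (r := ∞)
      (((hα (g u)).contDiffAt
      ((isOpen_extChartAt_target (g u)).mem_nhds
        ((extChartAt I (g u)).map_source hx))).differentiableAt (by simp)) h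
      (by rw [minSmoothness_of_isRCLikeNormedField]
          exact WithTop.coe_le_coe.2 (le_top : (2 : ℕ∞) ≤ ⊤))]
  unfold DiffForm.pullback DiffForm.extDerivative
  rw [← derivAt_eq_fderiv, derivAt_comp (mdifferentiableAt_extChartAt' hx) hgu]
  rfl

theorem DiffForm.inChart_extDerivative {α : DiffForm I M k}
    (hα : α.IsSmooth) {x₀ : M} {u : E} (hu : u ∈ (extChartAt I x₀).target) :
    α.extDerivative.inChart x₀ u = extDeriv (α.inChart x₀) u :=
  (hα.extDeriv_pullback (isOpen_extChartAt_target x₀) (contMDiffOn_extChartAt_symm x₀) hu).symm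

theorem DiffForm.IsSmooth.extDerivative {α : DiffForm I M k} (hα : α.IsSmooth) :
    α.extDerivative.IsSmooth := by
  intro x₀
  have h1 : ContDiffOn ℝ ∞ (extDeriv (α.inChart x₀)) (extChartAt I x₀).target :=
    (ContinuousAlternatingMap.alternatizeUncurryFinCLM ℝ E ℝ).contDiff.comp_contDiffOn
      ((hα x₀).fderiv_of_isOpen (isOpen_extChartAt_target x₀) (by simp))
  exact h1.congr fun u hu => DiffForm.inChart_extDerivative hα hu

end Chart

section Manifolds
variable [IsManifold I ∞ M] [I.Boundaryless] [IsManifold I' ∞ M'] [I'.Boundaryless]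

theorem DiffForm.inChart_pullback {f : M' → M} (hf : ContMDiff I' I ∞ f) (α : DiffForm I M k)
    {x₀ : M'} {u : E'} (hu : u ∈ (extChartAt I' x₀).target) :
    (DiffForm.pullback (I := I') (I' := I) f α).inChart x₀ u =
      DiffForm.pullback (I := 𝓘(ℝ, E')) (I' := I) (fun v => f ((extChartAt I' x₀).symm v)) α u :=
  (DiffForm.pullback_comp α (hf.mdifferentiableAt (by simp))
    (mdifferentiableAt_extChartAt_symm hu)).symm

theorem DiffForm.IsSmooth.pullback [FiniteDimensional ℝ E'] {f : M' → M}
    (hf : ContMDiff I' I ∞ f) {α : DiffForm I M k} (hα : α.IsSmooth) :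
    (DiffForm.pullback (I := I') (I' := I) f α).IsSmooth := by
  intro x₀
  refine ContDiffOn.congr (f := DiffForm.pullback (I := 𝓘(ℝ, E')) (I' := I)
    (fun v => f ((extChartAt I' x₀).symm v)) α) ?_ fun u hu => DiffForm.inChart_pullback hf α hu
  intro u hu
  exact (hα.contDiffAt_pullback (isOpen_extChartAt_target x₀)
    (hf.comp_contMDiffOn (contMDiffOn_extChartAt_symm x₀)) hu).contDiffWithinAt

end Manifolds
end Pullback

/-! ### The integral over a compact oriented manifold -/

section Integral
open MeasureTheory

/-- The standard frame of Euclidean space, on which forms of top degree are evaluated. -/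
abbrev stdFrame (n : ℕ) : Fin n → EuclideanSpace ℝ (Fin n) := fun j => EuclideanSpace.single j 1

theorem stdFrame_eq (n : ℕ) :
    stdFrame n = (EuclideanSpace.basisFun (Fin n) ℝ).toBasis := by
  ext j; simp

theorem topForm_comp_apply {n : ℕ} (a : EuclideanSpace ℝ (Fin n) [⋀^Fin n]→L[ℝ] ℝ)
    (T : EuclideanSpace ℝ (Fin n) →L[ℝ] EuclideanSpace ℝ (Fin n)) :
    a.compContinuousLinearMap T (stdFrame n) = T.det * a (stdFrame n) := by
  set b := (EuclideanSpace.basisFun (Fin n) ℝ).toBasis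
  have h := AlternatingMap.eq_smul_basis_det b a.toAlternatingMap
  have h1 : a (fun j => T (b j)) = a b * b.det (T ∘ b) :=
    congrArg (fun f => f (T ∘ b)) h
  rw [stdFrame_eq]
  change a (fun j => T (b j)) = _
  rw [h1]
  have h2 := b.det_comp (T : EuclideanSpace ℝ (Fin n) →ₗ[ℝ] EuclideanSpace ℝ (Fin n)) b
  rw [b.det_self, mul_one] at h2
  rw [show b.det (T ∘ b) = T.det from h2]
  ring

theorem topForm_ne_zero {n : ℕ} {a : EuclideanSpace ℝ (Fin n) [⋀^Fin n]→L[ℝ] ℝ} (ha : a ≠ 0) :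
    a (stdFrame n) ≠ 0 := by
  rw [stdFrame_eq]
  refine (AlternatingMap.map_basis_ne_zero_iff _ a.toAlternatingMap).2 fun h => ha ?_
  ext v
  exact congrArg (fun f => f v) h

variable {n : ℕ} {S : Type*} [TopologicalSpace S] [ChartedSpace (EuclideanSpace ℝ (Fin n)) S]

/-- A smooth chart of `S`, not necessarily one of the preferred ones. -/
structure IsSmoothChart (ψ : PartialEquiv S (EuclideanSpace ℝ (Fin n))) : Prop where
  isOpen_source : IsOpen ψ.source
  isOpen_target : IsOpen ψ.target
  contMDiffOn : ContMDiffOn (𝓡 n) (𝓡 n) ∞ ψ ψ.source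
  contMDiffOn_symm : ContMDiffOn (𝓡 n) (𝓡 n) ∞ ψ.symm ψ.target

/-- The coefficient of a form of top degree in a chart, with respect to the standard frame. -/
def coeff (ψ : PartialEquiv S (EuclideanSpace ℝ (Fin n))) (α : DiffForm (𝓡 n) S n)
    (u : EuclideanSpace ℝ (Fin n)) : ℝ :=
  DiffForm.pullback (I := 𝓡 n) (I' := 𝓡 n) ψ.symm α u (stdFrame n)

/-- The sign of a form `ν` of top degree in a chart: `1` where the chart is positive for the
orientation that `ν` defines, `-1` where it is negative. -/
def coeffSign (ψ : PartialEquiv S (EuclideanSpace ℝ (Fin n))) (ν : DiffForm (𝓡 n) S n)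
    (u : EuclideanSpace ℝ (Fin n)) : ℝ :=
  Real.sign (coeff ψ ν u)

variable [IsManifold (𝓡 n) ∞ S]

theorem isSmoothChart_extChartAt (i : S) : IsSmoothChart (extChartAt (𝓡 n) i) where
  isOpen_source := isOpen_extChartAt_source i
  isOpen_target := isOpen_extChartAt_target i
  contMDiffOn := by
    have := contMDiffOn_extChartAt (I := 𝓡 n) (n := ∞) (x := i)
    rwa [← extChartAt_source (𝓡 n)] at this
  contMDiffOn_symm := contMDiffOn_extChartAt_symm i

namespace IsSmoothChart
variable {ψ : PartialEquiv S (EuclideanSpace ℝ (Fin n))} (hψ : IsSmoothChart ψ)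
include hψ

theorem mdifferentiableAt {p : S} (hp : p ∈ ψ.source) : MDifferentiableAt (𝓡 n) (𝓡 n) ψ p :=
  (hψ.contMDiffOn.contMDiffAt (hψ.isOpen_source.mem_nhds hp)).mdifferentiableAt (by simp)

theorem mdifferentiableAt_symm {u : EuclideanSpace ℝ (Fin n)} (hu : u ∈ ψ.target) :
    MDifferentiableAt (𝓡 n) (𝓡 n) ψ.symm u :=
  (hψ.contMDiffOn_symm.contMDiffAt (hψ.isOpen_target.mem_nhds hu)).mdifferentiableAt (by simp)

theorem coeff_ne_zero {ν : DiffForm (𝓡 n) S n} (hν : IsVolumeForm ν)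
    {u : EuclideanSpace ℝ (Fin n)} (hu : u ∈ ψ.target) : coeff ψ ν u ≠ 0 := by
  refine topForm_ne_zero fun h => hν.ne_zero (ψ.symm u) ?_
  have hp := ψ.map_target hu
  have e : (fun q => ψ.symm (ψ q)) =ᶠ[𝓝 (ψ.symm u)] id :=
    Filter.mem_of_superset (hψ.isOpen_source.mem_nhds hp) fun q hq => ψ.left_inv hq
  have h1 := DiffForm.pullback_comp (I := 𝓡 n) (I' := 𝓡 n) (g := ψ) (x := ψ.symm u) ν
    (hψ.mdifferentiableAt_symm (by rwa [ψ.right_inv hu])) (hψ.mdifferentiableAt hp)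
  rw [DiffForm.pullback_eq_self ν e] at h1
  rw [h1]
  unfold DiffForm.pullback at h ⊢
  rw [ψ.right_inv hu, h]
  rfl

theorem contDiffOn_coeff {α : DiffForm (𝓡 n) S n} (hα : α.IsSmooth) :
    ContDiffOn ℝ ∞ (coeff ψ α) ψ.target := fun u hu =>
  ((ContinuousAlternatingMap.apply ℝ (EuclideanSpace ℝ (Fin n)) ℝ
    (stdFrame n)).contDiff.contDiffAt.comp u
    (hα.contDiffAt_pullback hψ.isOpen_target hψ.contMDiffOn_symm hu)).contDiffWithinAt

theorem coeffSign_eventuallyEq {ν : DiffForm (𝓡 n) S n} (hν : IsVolumeForm ν)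
    {u : EuclideanSpace ℝ (Fin n)} (hu : u ∈ ψ.target) :
    coeffSign ψ ν =ᶠ[𝓝 u] fun _ => coeffSign ψ ν u := by
  have hc : ContinuousAt (coeff ψ ν) u :=
    (hψ.contDiffOn_coeff hν.smooth).continuousOn.continuousAt (hψ.isOpen_target.mem_nhds hu)
  rcases (hψ.coeff_ne_zero hν hu).lt_or_gt with h | h
  · filter_upwards [hc.eventually_lt_const h] with v hv
    rw [coeffSign, coeffSign, Real.sign_of_neg hv, Real.sign_of_neg h]
  · filter_upwards [hc.eventually_const_lt h] with v hv
    rw [coeffSign, coeffSign, Real.sign_of_pos hv, Real.sign_of_pos h]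

theorem contDiffOn_coeffSign {ν : DiffForm (𝓡 n) S n} (hν : IsVolumeForm ν) :
    ContDiffOn ℝ ∞ (coeffSign ψ ν) ψ.target := fun _ hu =>
  (contDiffAt_const.congr_of_eventuallyEq (hψ.coeffSign_eventuallyEq hν hu)).contDiffWithinAt

theorem isCompact_image {K : Set S} (hK : IsCompact K) (hKψ : K ⊆ ψ.source) :
    IsCompact (ψ '' K) :=
  hK.image_of_continuousOn (hψ.contMDiffOn.continuousOn.mono hKψ)

/-- A function on the target of a chart is integrable if it is continuous there and vanishes outside
the image of a compact subset of the source; the target itself may have infinite measure. -/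
theorem integrableOn {f : EuclideanSpace ℝ (Fin n) → ℝ} (hf : ContinuousOn f ψ.target)
    {K : Set S} (hK : IsCompact K) (hKψ : K ⊆ ψ.source)
    (h0 : ∀ u ∈ ψ.target, ψ.symm u ∉ K → f u = 0) : IntegrableOn f ψ.target := by
  have hsub : ψ '' K ⊆ ψ.target := by
    rintro _ ⟨p, hp, rfl⟩; exact ψ.map_source (hKψ hp)
  have h1 : IntegrableOn f (ψ '' K) :=
    (hf.mono hsub).integrableOn_compact (hψ.isCompact_image hK hKψ)
  refine h1.of_forall_sdiff_eq_zero hψ.isOpen_target.measurableSet fun u hu => ?_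
  exact h0 u hu.1 fun h => hu.2 ⟨_, h, ψ.right_inv hu.1⟩

end IsSmoothChart

theorem hasFDerivAt_chart_transition {φ ψ : PartialEquiv S (EuclideanSpace ℝ (Fin n))}
    (hφ : IsSmoothChart φ) (hψ : IsSmoothChart ψ) {u : EuclideanSpace ℝ (Fin n)}
    (hu : u ∈ φ.target) (huψ : φ.symm u ∈ ψ.source) :
    HasFDerivAt (fun v => ψ (φ.symm v)) (fderiv ℝ (fun v => ψ (φ.symm v)) u) u := by
  have : MDifferentiableAt (𝓡 n) (𝓡 n) (fun v => ψ (φ.symm v)) u :=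
    (hψ.mdifferentiableAt huψ).comp u (hφ.mdifferentiableAt_symm hu)
  exact this.differentiableAt.hasFDerivAt

theorem coeff_transition {φ ψ : PartialEquiv S (EuclideanSpace ℝ (Fin n))}
    (hφ : IsSmoothChart φ) (hψ : IsSmoothChart ψ) {u : EuclideanSpace ℝ (Fin n)}
    (hu : u ∈ φ.target) (huψ : φ.symm u ∈ ψ.source) (α : DiffForm (𝓡 n) S n) :
    coeff φ α u = (fderiv ℝ (fun v => ψ (φ.symm v)) u).det * coeff ψ α (ψ (φ.symm u)) := by
  have e : φ.symm =ᶠ[𝓝 u] fun v => ψ.symm (ψ (φ.symm v)) := by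
    have hc : ContinuousAt φ.symm u := (hφ.mdifferentiableAt_symm hu).continuousAt
    filter_upwards [hc.preimage_mem_nhds (hψ.isOpen_source.mem_nhds huψ)] with v hv
    exact (ψ.left_inv hv).symm
  unfold coeff
  rw [DiffForm.pullback_congr α e, DiffForm.pullback_comp (I' := 𝓡 n)
    (g := fun v => ψ (φ.symm v)) α (hψ.mdifferentiableAt_symm (ψ.map_source huψ))
    ((hψ.mdifferentiableAt huψ).comp u (hφ.mdifferentiableAt_symm hu)),
    ← topForm_comp_apply, ← derivAt_eq_fderiv]
  rfl

/-- The signed coefficient is a density: it transforms with the absolute value of the Jacobian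
determinant, as in the change of variables formula for the Lebesgue integral. -/
theorem coeffSign_mul_coeff_transition {φ ψ : PartialEquiv S (EuclideanSpace ℝ (Fin n))}
    (hφ : IsSmoothChart φ) (hψ : IsSmoothChart ψ) {u : EuclideanSpace ℝ (Fin n)}
    (hu : u ∈ φ.target) (huψ : φ.symm u ∈ ψ.source) (ν α : DiffForm (𝓡 n) S n) :
    coeffSign φ ν u * coeff φ α u = |(fderiv ℝ (fun v => ψ (φ.symm v)) u).det| *
      (coeffSign ψ ν (ψ (φ.symm u)) * coeff ψ α (ψ (φ.symm u))) := by
  unfold coeffSign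
  rw [coeff_transition hφ hψ hu huψ ν, coeff_transition hφ hψ hu huψ α]
  generalize (fderiv ℝ (fun v => ψ (φ.symm v)) u).det = d
  generalize coeff ψ ν (ψ (φ.symm u)) = a
  generalize coeff ψ α (ψ (φ.symm u)) = b
  suffices h : Real.sign (d * a) * d = |d| * Real.sign a by
    rw [← mul_assoc, h, mul_assoc]
  rcases lt_trichotomy d 0 with h | rfl | h <;> rcases lt_trichotomy a 0 with h' | rfl | h'
  · rw [Real.sign_of_pos (mul_pos_of_neg_of_neg h h'), Real.sign_of_neg h', abs_of_neg h]; ring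
  · simp
  · rw [Real.sign_of_neg (mul_neg_of_neg_of_pos h h'), Real.sign_of_pos h', abs_of_neg h]; ring
  · simp
  · simp
  · simp
  · rw [Real.sign_of_neg (mul_neg_of_pos_of_neg h h'), Real.sign_of_neg h', abs_of_pos h]; ring
  · simp
  · rw [Real.sign_of_pos (mul_pos h h'), Real.sign_of_pos h', abs_of_pos h]; ring

variable [CompactSpace S] [T2Space S]

theorem tsupport_chartPartition_subset (i : S) :
    tsupport (chartPartition n S i) ⊆ (extChartAt (𝓡 n) i).source := by
  rw [extChartAt_source]
  exact (SmoothPartitionOfUnity.exists_isSubordinate_chartAt_source (𝓡 n) S).choose_spec i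

variable (n S) in
theorem finite_chartPartition : {i : S | ∃ p, chartPartition n S i p ≠ 0}.Finite :=
  (chartPartition n S).locallyFinite.finite_nonempty_of_compact

variable (n S) in
/-- The finitely many charts that meet the partition of unity. -/
def activeCharts : Finset S := (finite_chartPartition n S).toFinset

theorem chartPartition_eq_zero {i : S} (hi : i ∉ activeCharts n S) (p : S) :
    chartPartition n S i p = 0 := by
  by_contra h
  exact hi ((finite_chartPartition n S).mem_toFinset.2 ⟨p, h⟩)

theorem sum_chartPartition (p : S) : ∑ i ∈ activeCharts n S, chartPartition n S i p = 1 := by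
  rw [← (chartPartition n S).sum_eq_one (Set.mem_univ p), finsum_eq_sum_of_support_subset]
  intro i hi
  by_contra h
  exact hi (chartPartition_eq_zero h p)

theorem integral_eq_sum (ν α : DiffForm (𝓡 n) S n) :
    integral ν α = ∑ i ∈ activeCharts n S, ∫ u in (extChartAt (𝓡 n) i).target,
      chartPartition n S i ((extChartAt (𝓡 n) i).symm u) *
        (coeffSign (extChartAt (𝓡 n) i) ν u * coeff (extChartAt (𝓡 n) i) α u) := by
  unfold integral
  refine finsum_eq_sum_of_support_subset _ fun i hi => ?_
  by_contra h
  refine hi ?_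
  simp [chartPartition_eq_zero h]

theorem continuousOn_chartPartition_symm {ψ : PartialEquiv S (EuclideanSpace ℝ (Fin n))}
    (hψ : IsSmoothChart ψ) (i : S) :
    ContinuousOn (fun u => chartPartition n S i (ψ.symm u)) ψ.target :=
  (chartPartition n S i).contMDiff.continuous.comp_continuousOn hψ.contMDiffOn_symm.continuousOn

theorem integrableOn_chartPartition_mul (i : S) {f : EuclideanSpace ℝ (Fin n) → ℝ}
    (hf : ContinuousOn f (extChartAt (𝓡 n) i).target) :
    IntegrableOn (fun u => chartPartition n S i ((extChartAt (𝓡 n) i).symm u) * f u)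
      (extChartAt (𝓡 n) i).target :=
  (isSmoothChart_extChartAt i).integrableOn
    ((continuousOn_chartPartition_symm (isSmoothChart_extChartAt i) i).mul hf)
    (isClosed_tsupport _).isCompact (tsupport_chartPartition_subset i) fun u _ h => by
      rw [image_eq_zero_of_notMem_tsupport h, zero_mul]

theorem integrableOn_integrand {ν α : DiffForm (𝓡 n) S n} (hν : IsVolumeForm ν)
    (hα : α.IsSmooth) (i : S) :
    IntegrableOn (fun u => chartPartition n S i ((extChartAt (𝓡 n) i).symm u) *
        (coeffSign (extChartAt (𝓡 n) i) ν u * coeff (extChartAt (𝓡 n) i) α u))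
      (extChartAt (𝓡 n) i).target :=
  have hi := isSmoothChart_extChartAt (n := n) i
  integrableOn_chartPartition_mul i ((hi.contDiffOn_coeffSign hν).continuousOn.mul
    (hi.contDiffOn_coeff hα).continuousOn)

theorem coeff_add (ψ : PartialEquiv S (EuclideanSpace ℝ (Fin n))) (α β : DiffForm (𝓡 n) S n)
    (u : EuclideanSpace ℝ (Fin n)) : coeff ψ (α + β) u = coeff ψ α u + coeff ψ β u := rfl

theorem coeff_smul (ψ : PartialEquiv S (EuclideanSpace ℝ (Fin n))) (f : S → ℝ)
    (α : DiffForm (𝓡 n) S n) (u : EuclideanSpace ℝ (Fin n)) :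
    coeff ψ (fun p => f p • α p) u = f (ψ.symm u) * coeff ψ α u := rfl

theorem integral_add {ν α β : DiffForm (𝓡 n) S n} (hν : IsVolumeForm ν)
    (hα : α.IsSmooth) (hβ : β.IsSmooth) : integral ν (α + β) = integral ν α + integral ν β := by
  simp only [integral_eq_sum, ← Finset.sum_add_distrib]
  refine Finset.sum_congr rfl fun i _ => ?_
  rw [← MeasureTheory.integral_add (integrableOn_integrand hν hα i)
    (integrableOn_integrand hν hβ i)]
  refine integral_congr_ae (Filter.Eventually.of_forall fun u => ?_)
  simp only [coeff_add]
  ring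

theorem integral_const_smul (ν : DiffForm (𝓡 n) S n) (c : ℝ) (α : DiffForm (𝓡 n) S n) :
    integral ν (c • α) = c * integral ν α := by
  simp only [integral_eq_sum, Finset.mul_sum]
  refine Finset.sum_congr rfl fun i _ => ?_
  rw [← MeasureTheory.integral_const_mul]
  refine integral_congr_ae (Filter.Eventually.of_forall fun u => ?_)
  change _ * (_ * coeff _ (fun p => c • α p) u) = _
  simp only [coeff_smul]
  ring

theorem integral_zero (ν : DiffForm (𝓡 n) S n) : integral ν 0 = 0 := by
  simpa using integral_const_smul ν 0 0

theorem integral_neg (ν α : DiffForm (𝓡 n) S n) : integral ν (-α) = -integral ν α := by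
  rw [← neg_one_smul ℝ α, integral_const_smul, neg_one_mul]

theorem DiffForm.IsSmooth.add {E H : Type*} [NormedAddCommGroup E] [NormedSpace ℝ E]
    [TopologicalSpace H] {I : ModelWithCorners ℝ E H} {M : Type*} [TopologicalSpace M]
    [ChartedSpace H M] {k : ℕ} {α β : DiffForm I M k} (hα : α.IsSmooth) (hβ : β.IsSmooth) :
    DiffForm.IsSmooth (I := I) (α + β) := fun i => (hα i).add (hβ i)

theorem DiffForm.isSmooth_zero {E H : Type*} [NormedAddCommGroup E] [NormedSpace ℝ E]
    [TopologicalSpace H] {I : ModelWithCorners ℝ E H} {M : Type*} [TopologicalSpace M]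
    [ChartedSpace H M] {k : ℕ} : DiffForm.IsSmooth (0 : DiffForm I M k) :=
  fun _ => contDiffOn_const (c := 0)

theorem DiffForm.isSmooth_sum {E H : Type*} [NormedAddCommGroup E] [NormedSpace ℝ E]
    [TopologicalSpace H] {I : ModelWithCorners ℝ E H} {M : Type*} [TopologicalSpace M]
    [ChartedSpace H M] {k : ℕ} {ι : Type*} (s : Finset ι) {α : ι → DiffForm I M k}
    (hα : ∀ i ∈ s, (α i).IsSmooth) : DiffForm.IsSmooth (∑ i ∈ s, α i) := by
  classical
  induction s using Finset.induction_on with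
  | empty => simpa using DiffForm.isSmooth_zero
  | insert j s hj ih =>
    rw [Finset.sum_insert hj]
    exact (hα j (by simp)).add (ih fun i hi => hα i (by simp [hi]))

theorem integral_sum {ι : Type*} (s : Finset ι) {ν : DiffForm (𝓡 n) S n} (hν : IsVolumeForm ν)
    {α : ι → DiffForm (𝓡 n) S n} (hα : ∀ i ∈ s, (α i).IsSmooth) :
    integral ν (∑ i ∈ s, α i) = ∑ i ∈ s, integral ν (α i) := by
  classical
  induction s using Finset.induction_on with
  | empty => simpa using integral_zero ν
  | insert j s hj ih =>
    have hs : ∀ i ∈ s, (α i).IsSmooth := fun i hi => hα i (by simp [hi])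
    rw [Finset.sum_insert hj, Finset.sum_insert hj, ← ih hs]
    exact integral_add hν (hα j (by simp)) (DiffForm.isSmooth_sum s hs)

/-- The integral of a form whose support lies in the domain of a chart can be computed in
this chart. -/
theorem integral_eq_of_support {ν α : DiffForm (𝓡 n) S n} (hν : IsVolumeForm ν)
    (hα : α.IsSmooth) {ψ : PartialEquiv S (EuclideanSpace ℝ (Fin n))} (hψ : IsSmoothChart ψ)
    {K : Set S} (hK : IsClosed K) (hKψ : K ⊆ ψ.source) (h0 : ∀ p ∉ K, α p = 0) :
    integral ν α = ∫ u in ψ.target, coeffSign ψ ν u * coeff ψ α u := by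
  have hcoeff0 : ∀ (φ : PartialEquiv S (EuclideanSpace ℝ (Fin n))) (u),
      φ.symm u ∉ K → coeff φ α u = 0 := fun φ u hu => by
    unfold coeff DiffForm.pullback; rw [h0 _ hu]; rfl
  have hint : ∀ i : S, IntegrableOn (fun u => chartPartition n S i (ψ.symm u) *
      (coeffSign ψ ν u * coeff ψ α u)) ψ.target := fun i => by
    refine hψ.integrableOn ((continuousOn_chartPartition_symm hψ i).mul
      ((hψ.contDiffOn_coeffSign hν).continuousOn.mul (hψ.contDiffOn_coeff hα).continuousOn))
      hK.isCompact hKψ fun u _ hu => ?_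
    rw [hcoeff0 ψ u hu]; ring
  have hmain : ∀ i : S, ∫ u in (extChartAt (𝓡 n) i).target,
      chartPartition n S i ((extChartAt (𝓡 n) i).symm u) *
        (coeffSign (extChartAt (𝓡 n) i) ν u * coeff (extChartAt (𝓡 n) i) α u) =
      ∫ u in ψ.target, chartPartition n S i (ψ.symm u) * (coeffSign ψ ν u * coeff ψ α u) := by
    intro i
    set φ := extChartAt (𝓡 n) i with hφdef
    have hφ : IsSmoothChart φ := isSmoothChart_extChartAt i
    set s := φ.target ∩ φ.symm ⁻¹' ψ.source with hs
    have hsopen : IsOpen s :=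
      hφ.contMDiffOn_symm.continuousOn.isOpen_inter_preimage hφ.isOpen_target hψ.isOpen_source
    set T : EuclideanSpace ℝ (Fin n) → EuclideanSpace ℝ (Fin n) := fun v => ψ (φ.symm v) with hT
    have himage : T '' s ⊆ ψ.target := by
      rintro _ ⟨u, hu, rfl⟩; exact ψ.map_source hu.2
    have hTinj : Set.InjOn T s := fun u hu v hv h =>
      φ.symm.injOn hu.1 hv.1 (ψ.injOn hu.2 hv.2 h)
    -- Both integrands vanish outside the overlap of the charts, in which `T` changes variables.
    rw [setIntegral_eq_of_subset_of_forall_sdiff_eq_zero hφ.isOpen_target.measurableSet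
        (Set.inter_subset_left : s ⊆ φ.target),
      setIntegral_eq_of_subset_of_forall_sdiff_eq_zero hψ.isOpen_target.measurableSet himage,
      integral_image_eq_integral_abs_det_fderiv_smul volume hsopen.measurableSet
        (fun u hu => (hasFDerivAt_chart_transition hφ hψ hu.1 hu.2).hasFDerivWithinAt) hTinj]
    · refine setIntegral_congr_fun hsopen.measurableSet fun u hu => ?_
      simp only [smul_eq_mul]
      rw [coeffSign_mul_coeff_transition hφ hψ hu.1 hu.2, ψ.left_inv hu.2]
      ring
    · rintro u ⟨hu, hu'⟩
      have : ψ.symm u ∉ φ.source := fun h => hu' ⟨φ (ψ.symm u),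
        ⟨φ.map_source h, by simpa [φ.left_inv h] using ψ.map_target hu⟩, by
          simp [hT, φ.left_inv h, ψ.right_inv hu]⟩
      rw [image_eq_zero_of_notMem_tsupport
        (fun h => this (tsupport_chartPartition_subset i h)), zero_mul]
    · rintro u ⟨hu, hu'⟩
      rw [hcoeff0 φ u fun h => hu' ⟨hu, hKψ h⟩]
      ring
  rw [integral_eq_sum, Finset.sum_congr rfl fun i _ => hmain i,
    ← integral_finsetSum _ fun i _ => hint i]
  refine integral_congr_ae (Filter.Eventually.of_forall fun u => ?_)
  simp only [← Finset.sum_mul, sum_chartPartition, one_mul]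

end Integral

/-! ### Stokes' theorem -/

section Stokes
open MeasureTheory

section FormAlgebra
variable {E H : Type*} [NormedAddCommGroup E] [NormedSpace ℝ E] [TopologicalSpace H]
  {I : ModelWithCorners ℝ E H} [I.Boundaryless] {M : Type*} [TopologicalSpace M] [ChartedSpace H M]
  [IsManifold I ∞ M] {k : ℕ}

theorem DiffForm.IsSmooth.differentiableAt_inChart {α : DiffForm I M k} (hα : α.IsSmooth) (x : M) :
    DifferentiableAt ℝ (α.inChart x) (extChartAt I x x) :=
  ((hα x).contDiffAt ((isOpen_extChartAt_target x).mem_nhds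
    (mem_extChartAt_target x))).differentiableAt (by simp)

theorem DiffForm.inChart_add (α β : DiffForm I M k) (x : M) (u : E) :
    DiffForm.inChart (I := I) (α + β) x u = α.inChart x u + β.inChart x u := rfl

theorem DiffForm.extDerivative_add {α β : DiffForm I M k} (hα : α.IsSmooth) (hβ : β.IsSmooth) :
    DiffForm.extDerivative (I := I) (α + β) = α.extDerivative + β.extDerivative := by
  funext x
  have h : DiffForm.inChart (I := I) (α + β) x = α.inChart x + β.inChart x := rfl
  unfold DiffForm.extDerivative
  rw [h, extDeriv_add (hα.differentiableAt_inChart x) (hβ.differentiableAt_inChart x)]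
  rfl

theorem DiffForm.extDerivative_zero :
    DiffForm.extDerivative (I := I) (0 : DiffForm I M k) = 0 := by
  funext x
  have h : DiffForm.inChart (I := I) (0 : DiffForm I M k) x = (0 : ℝ) • 0 := by
    rw [zero_smul]; rfl
  unfold DiffForm.extDerivative
  rw [h, extDeriv_smul, zero_smul]
  rfl

theorem DiffForm.extDerivative_sum {ι : Type*} (s : Finset ι) {α : ι → DiffForm I M k}
    (hα : ∀ i ∈ s, (α i).IsSmooth) :
    DiffForm.extDerivative (I := I) (∑ i ∈ s, α i) = ∑ i ∈ s, (α i).extDerivative := by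
  classical
  induction s using Finset.induction_on with
  | empty => simpa using DiffForm.extDerivative_zero
  | insert j s hj ih =>
    have hs : ∀ i ∈ s, (α i).IsSmooth := fun i hi => hα i (by simp [hi])
    rw [Finset.sum_insert hj, Finset.sum_insert hj, ← ih hs]
    exact DiffForm.extDerivative_add (hα j (by simp)) (DiffForm.isSmooth_sum s hs)

theorem DiffForm.IsSmooth.smul {f : M → ℝ} (hf : ContMDiff I 𝓘(ℝ, ℝ) ∞ f)
    {α : DiffForm I M k} (hα : α.IsSmooth) :
    DiffForm.IsSmooth (I := I) (fun x => f x • α x) := by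
  intro x₀
  have h1 : ContDiffOn ℝ ∞ (fun u => f ((extChartAt I x₀).symm u)) (extChartAt I x₀).target := by
    rw [← contMDiffOn_iff_contDiffOn]
    exact hf.comp_contMDiffOn (contMDiffOn_extChartAt_symm x₀)
  exact h1.smul (hα x₀)

/-- The exterior derivative does not enlarge the support. -/
theorem DiffForm.extDerivative_eq_zero {α : DiffForm I M k} {K : Set M} (hK : IsClosed K)
    (h0 : ∀ x ∉ K, α x = 0) {x : M} (hx : x ∉ K) : α.extDerivative x = 0 := by
  have h : α.inChart x =ᶠ[𝓝 (extChartAt I x x)] (0 : ℝ) • 0 := by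
    have hc : ContinuousAt (extChartAt I x).symm (extChartAt I x x) :=
      continuousAt_extChartAt_symm x
    have : Kᶜ ∈ 𝓝 ((extChartAt I x).symm (extChartAt I x x)) := by
      rw [extChartAt_to_inv]; exact hK.isOpen_compl.mem_nhds hx
    filter_upwards [hc.preimage_mem_nhds this] with u hu
    rw [zero_smul]
    unfold DiffForm.inChart
    rw [h0 _ hu]
    rfl
  unfold DiffForm.extDerivative
  rw [h.extDeriv_eq, extDeriv_smul, zero_smul]
  rfl

end FormAlgebra

/-- The integral of a partial derivative of a compactly supported function vanishes. -/
theorem setIntegral_fderiv_eq_zero {V : Type*} [NormedAddCommGroup V] [NormedSpace ℝ V]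
    [FiniteDimensional ℝ V] [MeasurableSpace V] [BorelSpace V] {μ : Measure V}
    [μ.IsAddHaarMeasure] {U C : Set V} (hU : IsOpen U) (hC : IsCompact C) (hCU : C ⊆ U)
    {f : V → ℝ} (hf : ContDiffOn ℝ ∞ f U) (h0 : ∀ u ∈ U, u ∉ C → f u = 0) (v : V) :
    ∫ u in U, fderiv ℝ f u v ∂μ = 0 := by
  set g := U.indicator f with hg
  have hgU : ∀ u ∈ U, g =ᶠ[𝓝 u] f := fun u hu =>
    Filter.mem_of_superset (hU.mem_nhds hu) fun w hw => Set.indicator_of_mem hw f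
  have hg0 : ∀ u ∉ C, g u = 0 := fun u hu => by
    by_cases h : u ∈ U
    · rw [hg, Set.indicator_of_mem h, h0 u h hu]
    · exact Set.indicator_of_notMem h f
  have hgs : ContDiff ℝ ∞ g := contDiff_iff_contDiffAt.2 fun u => by
    by_cases h : u ∈ U
    · exact (hf.contDiffAt (hU.mem_nhds h)).congr_of_eventuallyEq (hgU u h)
    · refine (contDiffAt_const (c := (0 : ℝ))).congr_of_eventuallyEq ?_
      exact Filter.mem_of_superset (hC.isClosed.isOpen_compl.mem_nhds fun h' => h (hCU h')) hg0
  have hgc : HasCompactSupport g := HasCompactSupport.intro hC hg0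
  have hdc : HasCompactSupport fun u => fderiv ℝ g u v := hgc.fderiv_apply ℝ v
  have hd : Continuous fun u => fderiv ℝ g u v :=
    (hgs.continuous_fderiv (by simp)).clm_apply continuous_const
  have h1 : ∫ u in U, fderiv ℝ f u v ∂μ = ∫ u in U, fderiv ℝ g u v ∂μ :=
    setIntegral_congr_fun hU.measurableSet fun u hu => by
      simp only [(hgU u hu).fderiv_eq]
  have h2 : ∫ u in U, fderiv ℝ g u v ∂μ = ∫ u, fderiv ℝ g u v ∂μ := by
    refine setIntegral_eq_integral_of_forall_compl_eq_zero fun u hu => ?_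
    have : g =ᶠ[𝓝 u] fun _ => 0 :=
      Filter.mem_of_superset (hC.isClosed.isOpen_compl.mem_nhds fun h' => hu (hCU h')) hg0
    simp [this.fderiv_eq]
  have h3 := integral_mul_fderiv_eq_neg_fderiv_mul_of_integrable (μ := μ)
    (f := fun _ : V => (1 : ℝ)) (g := g) (v := v) (by simp)
    (by simpa using hd.integrable_of_hasCompactSupport hdc)
    (by simpa using hgs.continuous.integrable_of_hasCompactSupport hgc)
    (fun u _ => by fun_prop) (fun u _ => (hgs.differentiable (by simp)) u)
  rw [h1, h2]
  simpa using h3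

/-- Stokes' theorem for a form supported in the domain of a preferred chart. There `dβ` is a sum of
partial derivatives of compactly supported functions. -/
theorem integral_extDerivative_of_support {m : ℕ} {S : Type*} [TopologicalSpace S]
    [ChartedSpace (EuclideanSpace ℝ (Fin (m + 1))) S] [IsManifold (𝓡 (m + 1)) ∞ S]
    [CompactSpace S] [T2Space S] {ν : DiffForm (𝓡 (m + 1)) S (m + 1)} (hν : IsVolumeForm ν)
    {β : DiffForm (𝓡 (m + 1)) S m} (hβ : β.IsSmooth) (i : S) {K : Set S} (hK : IsClosed K)
    (hKi : K ⊆ (extChartAt (𝓡 (m + 1)) i).source) (h0 : ∀ p ∉ K, β p = 0) :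
    integral ν β.extDerivative = 0 := by
  have hi := isSmoothChart_extChartAt (n := m + 1) i
  rw [integral_eq_of_support hν hβ.extDerivative hi hK hKi
    fun p hp => DiffForm.extDerivative_eq_zero hK h0 hp]
  set φ := extChartAt (𝓡 (m + 1)) i
  set f : Fin (m + 1) → EuclideanSpace ℝ (Fin (m + 1)) → ℝ := fun j u =>
    coeffSign φ ν u * β.inChart i u (j.removeNth (stdFrame (m + 1))) with hfdef
  have hf : ∀ j, ContDiffOn ℝ ∞ (f j) φ.target := fun j =>
    (hi.contDiffOn_coeffSign hν).mul
      ((ContinuousAlternatingMap.apply ℝ (EuclideanSpace ℝ (Fin (m + 1))) ℝ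
        (j.removeNth (stdFrame (m + 1)))).contDiff.comp_contDiffOn (hβ i))
  have hC := hi.isCompact_image hK.isCompact hKi
  have hCt : φ '' K ⊆ φ.target := by rintro _ ⟨p, hp, rfl⟩; exact φ.map_source (hKi hp)
  have hf0 : ∀ j, ∀ u ∈ φ.target, u ∉ φ '' K → f j u = 0 := fun j u hu huK => by
    have : β (φ.symm u) = 0 := h0 _ fun h => huK ⟨_, h, φ.right_inv hu⟩
    simp only [hfdef, DiffForm.inChart]
    rw [show β ((extChartAt (𝓡 (m + 1)) i).symm u) = 0 from this]
    simp
  have hd : ∀ u ∈ φ.target, coeffSign φ ν u * coeff φ β.extDerivative u =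
      ∑ j : Fin (m + 1), (-1) ^ (j : ℕ) * fderiv ℝ (f j) u (stdFrame (m + 1) j) := by
    intro u hu
    have hβu : DifferentiableAt ℝ (β.inChart i) u :=
      ((hβ i).contDiffAt (hi.isOpen_target.mem_nhds hu)).differentiableAt (by simp)
    have h1 : coeff φ β.extDerivative u = extDeriv (β.inChart i) u (stdFrame (m + 1)) :=
      congrArg (fun a => a (stdFrame (m + 1))) (DiffForm.inChart_extDerivative hβ hu)
    rw [h1, extDeriv_apply hβu, Finset.mul_sum]
    refine Finset.sum_congr rfl fun j _ => ?_
    -- The sign is locally constant, so it can be moved inside the derivative.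
    have h2 : f j =ᶠ[𝓝 u] fun w =>
        coeffSign φ ν u * β.inChart i w (j.removeNth (stdFrame (m + 1))) := by
      filter_upwards [hi.coeffSign_eventuallyEq hν hu] with w hw
      simp only [hfdef, hw]
    have h3 : DifferentiableAt ℝ
        (fun w => β.inChart i w (j.removeNth (stdFrame (m + 1)))) u :=
      (ContinuousAlternatingMap.apply ℝ (EuclideanSpace ℝ (Fin (m + 1))) ℝ
        (j.removeNth (stdFrame (m + 1)))).differentiableAt.comp u hβu
    rw [h2.fderiv_eq, fderiv_const_mul h3]
    simp only [_root_.smul_apply, smul_eq_mul]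
    ring
  have hint : ∀ j : Fin (m + 1), IntegrableOn (fun u => (-1) ^ (j : ℕ) *
      fderiv ℝ (f j) u (stdFrame (m + 1) j)) φ.target := fun j => by
    refine hi.integrableOn (continuousOn_const.mul
      (((hf j).continuousOn_fderiv_of_isOpen hi.isOpen_target (by simp)).clm_apply
        continuousOn_const)) hK.isCompact hKi fun u hu huK => ?_
    have : f j =ᶠ[𝓝 u] fun _ => 0 := by
      filter_upwards [hi.isOpen_target.mem_nhds hu, hC.isClosed.isOpen_compl.mem_nhds
        (fun ⟨p, hp, e⟩ => huK (by rw [← e, φ.left_inv (hKi hp)]; exact hp))] with w hw hw'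
      exact hf0 j w hw hw'
    simp [this.fderiv_eq]
  rw [setIntegral_congr_fun hi.isOpen_target.measurableSet hd,
    MeasureTheory.integral_finsetSum _ fun j _ => hint j]
  refine Finset.sum_eq_zero fun j _ => ?_
  rw [MeasureTheory.integral_const_mul,
    setIntegral_fderiv_eq_zero hi.isOpen_target hC hCt (hf j) (hf0 j), mul_zero]

section Compact
variable {n : ℕ} {S : Type*} [TopologicalSpace S] [ChartedSpace (EuclideanSpace ℝ (Fin n)) S]
  [IsManifold (𝓡 n) ∞ S] [CompactSpace S] [T2Space S]

theorem sum_chartPartition_smul {k : ℕ} (α : DiffForm (𝓡 n) S k) :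
    ∑ i ∈ activeCharts n S, (fun p => chartPartition n S i p • α p) = α := by
  funext p
  rw [Finset.sum_apply, ← Finset.sum_smul, sum_chartPartition, one_smul]

theorem isSmooth_chartPartition_smul {k : ℕ} {α : DiffForm (𝓡 n) S k} (hα : α.IsSmooth) (i : S) :
    DiffForm.IsSmooth (I := 𝓡 n) (fun p => chartPartition n S i p • α p) :=
  hα.smul (chartPartition n S i).contMDiff

theorem chartPartition_smul_eq_zero {k : ℕ} (α : DiffForm (𝓡 n) S k) (i : S) {p : S}
    (hp : p ∉ tsupport (chartPartition n S i)) : chartPartition n S i p • α p = 0 := by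
  rw [image_eq_zero_of_notMem_tsupport hp, zero_smul]

end Compact

/-- Stokes' theorem on a compact manifold without boundary. -/
theorem integral_extDerivative {m : ℕ} {S : Type*} [TopologicalSpace S]
    [ChartedSpace (EuclideanSpace ℝ (Fin (m + 1))) S] [IsManifold (𝓡 (m + 1)) ∞ S]
    [CompactSpace S] [T2Space S] {ν : DiffForm (𝓡 (m + 1)) S (m + 1)} (hν : IsVolumeForm ν)
    {β : DiffForm (𝓡 (m + 1)) S m} (hβ : β.IsSmooth) : integral ν β.extDerivative = 0 := by
  have hs := fun i => isSmooth_chartPartition_smul hβ i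
  conv_lhs => rw [← sum_chartPartition_smul β]
  rw [DiffForm.extDerivative_sum _ fun i _ => hs i,
    integral_sum _ hν fun i _ => (hs i).extDerivative]
  exact Finset.sum_eq_zero fun i _ => integral_extDerivative_of_support hν (hs i) i
    (isClosed_tsupport _) (tsupport_chartPartition_subset i)
    fun p hp => chartPartition_smul_eq_zero β i hp

/-- Exact forms: exterior derivatives of smooth forms of one degree less. In degree `0` there are
none such, and the zero form alone counts as exact, so that an exact form of top degree has integral
zero also on a manifold of dimension `0`. -/
def DiffForm.IsExact {E H : Type*} [NormedAddCommGroup E] [NormedSpace ℝ E] [TopologicalSpace H]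
    {I : ModelWithCorners ℝ E H} {M : Type*} [TopologicalSpace M] [ChartedSpace H M] :
    {k : ℕ} → DiffForm I M k → Prop
  | 0, α => α = 0
  | _ + 1, α => ∃ β, DiffForm.IsSmooth β ∧ α = β.extDerivative

theorem DiffForm.IsExact.isSmooth {E H : Type*} [NormedAddCommGroup E] [NormedSpace ℝ E]
    [TopologicalSpace H] {I : ModelWithCorners ℝ E H} [I.Boundaryless] {M : Type*}
    [TopologicalSpace M] [ChartedSpace H M] [IsManifold I ∞ M] {k : ℕ} {α : DiffForm I M k}
    (hα : α.IsExact) : α.IsSmooth := by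
  cases k with
  | zero => rw [show α = 0 from hα]; exact DiffForm.isSmooth_zero
  | succ m => obtain ⟨β, hβ, rfl⟩ := hα; exact hβ.extDerivative

section Compact
variable {n : ℕ} {S : Type*} [TopologicalSpace S] [ChartedSpace (EuclideanSpace ℝ (Fin n)) S]
  [IsManifold (𝓡 n) ∞ S] [CompactSpace S] [T2Space S]

theorem DiffForm.IsExact.integral_eq_zero {ν α : DiffForm (𝓡 n) S n} (hν : IsVolumeForm ν)
    (hα : α.IsExact) : integral ν α = 0 := by
  cases n with
  | zero => rw [show α = 0 from hα]; exact integral_zero ν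
  | succ m => obtain ⟨β, hβ, rfl⟩ := hα; exact integral_extDerivative hν hβ

/-! ### Invariance of the integral under diffeomorphisms -/

/-- A preferred chart, transported by the diffeomorphism `f` with inverse `g`. -/
def transportedChart (f g : S → S) (hfg : ∀ p, f (g p) = p) (hgf : ∀ p, g (f p) = p) (i : S) :
    PartialEquiv S (EuclideanSpace ℝ (Fin n)) where
  toFun p := extChartAt (𝓡 n) i (f p)
  invFun u := g ((extChartAt (𝓡 n) i).symm u)
  source := f ⁻¹' (extChartAt (𝓡 n) i).source
  target := (extChartAt (𝓡 n) i).target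
  map_source' _ hp := (extChartAt (𝓡 n) i).map_source hp
  map_target' u hu := by
    rw [Set.mem_preimage, hfg]; exact (extChartAt (𝓡 n) i).map_target hu
  left_inv' p hp := by rw [(extChartAt (𝓡 n) i).left_inv hp, hgf]
  right_inv' u hu := by rw [hfg, (extChartAt (𝓡 n) i).right_inv hu]

theorem isSmoothChart_transportedChart {f g : S → S} (hf : ContMDiff (𝓡 n) (𝓡 n) ∞ f)
    (hg : ContMDiff (𝓡 n) (𝓡 n) ∞ g) (hfg : ∀ p, f (g p) = p) (hgf : ∀ p, g (f p) = p) (i : S) :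
    IsSmoothChart (transportedChart (n := n) f g hfg hgf i) where
  isOpen_source := (isOpen_extChartAt_source i).preimage hf.continuous
  isOpen_target := isOpen_extChartAt_target i
  contMDiffOn := (isSmoothChart_extChartAt i).contMDiffOn.comp hf.contMDiffOn fun _ hp => hp
  contMDiffOn_symm := hg.comp_contMDiffOn (contMDiffOn_extChartAt_symm i)

/-- The integral is invariant under diffeomorphisms that preserve the orientation. -/
theorem integral_pullback {ν α : DiffForm (𝓡 n) S n} (hν : IsVolumeForm ν) (hα : α.IsSmooth)
    {f g : S → S} (hf : ContMDiff (𝓡 n) (𝓡 n) ∞ f)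
    (hg : ContMDiff (𝓡 n) (𝓡 n) ∞ g) (hfg : ∀ p, f (g p) = p) (hgf : ∀ p, g (f p) = p)
    (hor : PreservesOrientation ν f) :
    integral ν (DiffForm.pullback (I := 𝓡 n) (I' := 𝓡 n) f α) = integral ν α := by
  have hs := fun i => isSmooth_chartPartition_smul hα i
  have hsum : DiffForm.pullback (I := 𝓡 n) (I' := 𝓡 n) f α = ∑ i ∈ activeCharts n S,
      DiffForm.pullback (I := 𝓡 n) (I' := 𝓡 n) f (fun p => chartPartition n S i p • α p) := by
    conv_lhs => rw [← sum_chartPartition_smul α]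
    funext p
    ext v
    simp [DiffForm.pullback]
  conv_rhs => rw [← sum_chartPartition_smul α]
  rw [hsum, integral_sum _ hν fun i _ => hs i, integral_sum _ hν fun i _ => (hs i).pullback hf]
  refine Finset.sum_congr rfl fun i _ => ?_
  have hi := isSmoothChart_extChartAt (n := n) i
  have hψ := isSmoothChart_transportedChart hf hg hfg hgf i
  set K := tsupport (chartPartition n S i)
  rw [integral_eq_of_support hν (hs i) hi (isClosed_tsupport _)
      (tsupport_chartPartition_subset i) fun p hp => chartPartition_smul_eq_zero α i hp,
    integral_eq_of_support (K := f ⁻¹' K) hν ((hs i).pullback hf) hψ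
      ((isClosed_tsupport _).preimage hf.continuous)
      (fun p hp => tsupport_chartPartition_subset i hp) fun p hp => by
        have := chartPartition_smul_eq_zero α i (p := f p) hp
        ext v
        simp [DiffForm.pullback, this]]
  refine setIntegral_congr_fun hi.isOpen_target.measurableSet fun u hu => ?_
  set ψ := transportedChart (n := n) f g hfg hgf i
  -- `f`, read from the transported chart to the preferred one, is the identity.
  have key : ∀ γ : DiffForm (𝓡 n) S n,
      coeff ψ (DiffForm.pullback (I := 𝓡 n) (I' := 𝓡 n) f γ) u =
        coeff (extChartAt (𝓡 n) i) γ u := fun γ => by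
    unfold coeff
    rw [← DiffForm.pullback_comp γ (hf.mdifferentiableAt (by simp)) (hψ.mdifferentiableAt_symm hu)]
    have : (fun y => f (ψ.symm y)) = (extChartAt (𝓡 n) i).symm := funext fun y => hfg _
    rw [this]
  obtain ⟨a, ha, hor'⟩ := hor (ψ.symm u)
  have hsign : coeffSign ψ ν u = coeffSign (extChartAt (𝓡 n) i) ν u := by
    have h1 : coeff (extChartAt (𝓡 n) i) ν u = a * coeff ψ ν u := by
      rw [← key ν]
      exact congrArg (fun b : EuclideanSpace ℝ (Fin n) [⋀^Fin n]→L[ℝ] ℝ =>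
        b.compContinuousLinearMap (derivAt (𝓡 n) (𝓡 n) ψ.symm u) (stdFrame n)) hor'
    unfold coeffSign
    rw [h1]
    rcases (hψ.coeff_ne_zero hν hu).lt_or_gt with h | h
    · rw [Real.sign_of_neg h, Real.sign_of_neg (mul_neg_of_pos_of_neg ha h)]
    · rw [Real.sign_of_pos h, Real.sign_of_pos (mul_pos ha h)]
  simp only [key, hsign]

end Compact

/-! ### Differentiation under the integral sign -/

section Curve
variable {n : ℕ} {S : Type*} [TopologicalSpace S] [ChartedSpace (EuclideanSpace ℝ (Fin n)) S]
  [IsManifold (𝓡 n) ∞ S]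

/-- A curve of differential forms that depends smoothly on the parameter and the point. -/
def IsSmoothFormCurve {k : ℕ} (A : ℝ → DiffForm (𝓡 n) S k) : Prop :=
  ∀ i : S, ContDiffOn ℝ ∞ (fun r : ℝ × EuclideanSpace ℝ (Fin n) => (A r.1).inChart i r.2)
    (Set.univ ×ˢ (extChartAt (𝓡 n) i).target)

/-- The velocity at time `0` of a curve of forms, computed at each point separately. -/
def formVelocity {k : ℕ} (A : ℝ → DiffForm (𝓡 n) S k) : DiffForm (𝓡 n) S k :=
  fun p => deriv (fun r => A r p) 0

namespace IsSmoothFormCurve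
variable {k : ℕ} {A : ℝ → DiffForm (𝓡 n) S k} (hA : IsSmoothFormCurve A)
include hA

theorem isSmooth (t : ℝ) : (A t).IsSmooth := fun i =>
  (hA i).comp (contDiff_const.prodMk contDiff_id).contDiffOn fun _ hu => ⟨Set.mem_univ _, hu⟩

theorem contDiffOn_deriv (i : S) : ContDiffOn ℝ ∞
    (fun r : ℝ × EuclideanSpace ℝ (Fin n) =>
      fderiv ℝ (fun r : ℝ × EuclideanSpace ℝ (Fin n) => (A r.1).inChart i r.2) r (1, 0))
    (Set.univ ×ˢ (extChartAt (𝓡 n) i).target) :=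
  ((hA i).fderiv_of_isOpen (isOpen_univ.prod (isOpen_extChartAt_target i)) (by simp)).clm_apply
    contDiffOn_const

theorem hasDerivAt_inChart (i : S) {u : EuclideanSpace ℝ (Fin n)}
    (hu : u ∈ (extChartAt (𝓡 n) i).target) (t : ℝ) :
    HasDerivAt (fun r => (A r).inChart i u)
      (fderiv ℝ (fun r : ℝ × EuclideanSpace ℝ (Fin n) => (A r.1).inChart i r.2) (t, u) (1, 0))
      t := by
  have h1 : HasFDerivAt (fun r : ℝ × EuclideanSpace ℝ (Fin n) => (A r.1).inChart i r.2) _ (t, u) :=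
    (((hA i).contDiffAt ((isOpen_univ.prod (isOpen_extChartAt_target i)).mem_nhds
      ⟨Set.mem_univ t, hu⟩)).differentiableAt (by simp)).hasFDerivAt
  exact h1.comp_hasDerivAt t ((hasDerivAt_id t).prodMk (hasDerivAt_const t u))

theorem hasDerivAt (p : S) : HasDerivAt (fun r => A r p) (formVelocity A p) 0 := by
  have h := hA.hasDerivAt_inChart p (mem_extChartAt_target p) 0
  have h1 := (ContinuousAlternatingMap.compContinuousLinearMapCLM (F := ℝ) (ι := Fin k) (𝕜 := ℝ)
    (derivAt (𝓡 n) (𝓡 n) (extChartAt (𝓡 n) p) p)).hasFDerivAt.comp_hasDerivAt (0 : ℝ) h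
  have h2 : (fun r => A r p) = fun r =>
      ((A r).inChart p (extChartAt (𝓡 n) p p)).compContinuousLinearMap
        (derivAt (𝓡 n) (𝓡 n) (extChartAt (𝓡 n) p) p) :=
    funext fun r => (A r).eq_pullback_inChart (mem_extChartAt_source p)
  have h3 : DifferentiableAt ℝ (fun r => A r p) 0 := by
    rw [h2]; exact h1.differentiableAt
  exact h3.hasDerivAt

theorem inChart_formVelocity (i : S) {u : EuclideanSpace ℝ (Fin n)}
    (hu : u ∈ (extChartAt (𝓡 n) i).target) :
    (formVelocity A).inChart i u =
      fderiv ℝ (fun r : ℝ × EuclideanSpace ℝ (Fin n) => (A r.1).inChart i r.2) (0, u) (1, 0) := by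
  have h1 := (ContinuousAlternatingMap.compContinuousLinearMapCLM (F := ℝ) (ι := Fin k) (𝕜 := ℝ)
    (derivAt (𝓡 n) (𝓡 n) (extChartAt (𝓡 n) i).symm u)).hasFDerivAt.comp_hasDerivAt (0 : ℝ)
      (hA.hasDerivAt ((extChartAt (𝓡 n) i).symm u))
  exact h1.unique (hA.hasDerivAt_inChart i hu 0)

theorem isSmooth_formVelocity : (formVelocity A).IsSmooth := fun i =>
  ((hA.contDiffOn_deriv i).comp (contDiff_const (c := (0 : ℝ)).prodMk contDiff_id).contDiffOn
    fun _ hu => ⟨Set.mem_univ _, hu⟩).congr fun _ hu => hA.inChart_formVelocity i hu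

end IsSmoothFormCurve

variable [CompactSpace S] [T2Space S]

theorem hasDerivAt_integral {ν : DiffForm (𝓡 n) S n} (hν : IsVolumeForm ν)
    {A : ℝ → DiffForm (𝓡 n) S n} (hA : IsSmoothFormCurve A) :
    HasDerivAt (fun r => integral ν (A r)) (integral ν (formVelocity A)) 0 := by
  simp only [integral_eq_sum]
  refine HasDerivAt.fun_sum fun i _ => ?_
  have hi := isSmoothChart_extChartAt (n := n) i
  set φ := extChartAt (𝓡 n) i with hφ
  set K := tsupport (chartPartition n S i) with hK
  have hKc : IsCompact K := (isClosed_tsupport _).isCompact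
  set D : ℝ × EuclideanSpace ℝ (Fin n) → ℝ := fun r =>
    fderiv ℝ (fun r : ℝ × EuclideanSpace ℝ (Fin n) => (A r.1).inChart i r.2) r (1, 0)
      (stdFrame n) with hD
  have hDc : ContinuousOn D (Set.univ ×ˢ φ.target) :=
    (ContinuousAlternatingMap.apply ℝ (EuclideanSpace ℝ (Fin n)) ℝ
      (stdFrame n)).continuous.comp_continuousOn (hA.contDiffOn_deriv i).continuousOn
  set F' : ℝ → EuclideanSpace ℝ (Fin n) → ℝ := fun r u =>
    chartPartition n S i (φ.symm u) * (coeffSign φ ν u * D (r, u)) with hF'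
  have hF'c : ContinuousOn (fun r : ℝ × EuclideanSpace ℝ (Fin n) => F' r.1 r.2)
      (Set.univ ×ˢ φ.target) :=
    ((continuousOn_chartPartition_symm hi i).comp continuousOn_snd fun _ h => h.2).mul
      (((hi.contDiffOn_coeffSign hν).continuousOn.comp continuousOn_snd fun _ h => h.2).mul hDc)
  have hC : IsCompact (φ '' K) := hi.isCompact_image hKc (tsupport_chartPartition_subset i)
  have hCt : φ '' K ⊆ φ.target := by
    rintro _ ⟨p, hp, rfl⟩; exact φ.map_source (tsupport_chartPartition_subset i hp)
  obtain ⟨b, hb⟩ := ((isCompact_Icc (a := (-1 : ℝ)) (b := 1)).prod hC).exists_bound_of_continuousOn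
    (hF'c.mono (Set.prod_mono (Set.subset_univ _) hCt))
  have hF'0 : ∀ r, ∀ u ∈ φ.target, u ∉ φ '' K → F' r u = 0 := fun r u hu huK => by
    have : φ.symm u ∉ K := fun h => huK ⟨_, h, φ.right_inv hu⟩
    simp only [hF', image_eq_zero_of_notMem_tsupport this, zero_mul]
  have hmem := ae_restrict_mem (μ := volume) hi.isOpen_target.measurableSet
  have hmain := hasDerivAt_integral_of_dominated_loc_of_deriv_le (𝕜 := ℝ)
    (μ := volume.restrict φ.target) (s := Set.Icc (-1 : ℝ) 1) (x₀ := (0 : ℝ))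
    (F := fun r u => chartPartition n S i (φ.symm u) * (coeffSign φ ν u * coeff φ (A r) u))
    (F' := F') (bound := (φ '' K).indicator fun _ => b)
    (Icc_mem_nhds (by norm_num) (by norm_num))
    (Filter.Eventually.of_forall fun r =>
      (integrableOn_integrand hν (hA.isSmooth r) i).aestronglyMeasurable)
    (integrableOn_integrand hν (hA.isSmooth 0) i)
    ((hF'c.comp (continuousOn_const.prodMk continuousOn_id)
      fun _ hu => ⟨Set.mem_univ _, hu⟩).aestronglyMeasurable hi.isOpen_target.measurableSet)
    (by
      filter_upwards [hmem] with u hu r hr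
      by_cases h : u ∈ φ '' K
      · rw [Set.indicator_of_mem h]; exact hb (r, u) ⟨hr, h⟩
      · rw [Set.indicator_of_notMem h, hF'0 r u hu h, norm_zero])
    (((integrableOn_const hC.measure_lt_top.ne).integrable_indicator
      hC.isClosed.measurableSet).restrict)
    (by
      filter_upwards [hmem] with u hu r _
      have h1 := hA.hasDerivAt_inChart i hu r
      have h2 := (ContinuousAlternatingMap.apply ℝ (EuclideanSpace ℝ (Fin n)) ℝ
        (stdFrame n)).hasFDerivAt.comp_hasDerivAt r h1
      exact (h2.const_mul (coeffSign φ ν u)).const_mul _)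
  refine hmain.2.congr_deriv ?_
  refine setIntegral_congr_fun hi.isOpen_target.measurableSet fun u hu => ?_
  have : coeff φ (formVelocity A) u = D (0, u) :=
    congrArg (fun a => a (stdFrame n)) (hA.inChart_formVelocity i hu)
  simp only [hF', this]

end Curve
end Stokes

/-! ### Cartan's formula for families of maps -/

section CartanVectorSpace
variable {V W : Type*} [NormedAddCommGroup V] [NormedSpace ℝ V]
  [NormedAddCommGroup W] [NormedSpace ℝ W] {k : ℕ}

/-- The contraction of a form with a vector, as a continuous linear map of forms. -/
def contraction (k : ℕ) (v : V) : (V [⋀^Fin (k + 1)]→L[ℝ] ℝ) →L[ℝ] V [⋀^Fin k]→L[ℝ] ℝ :=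
  (ContinuousLinearMap.apply ℝ (V [⋀^Fin k]→L[ℝ] ℝ) v).comp
    (ContinuousAlternatingMap.curryLeftLI (𝕜 := ℝ) (E := V) (F := ℝ) (n := k)).toContinuousLinearMap

theorem contraction_apply (v : V) (a : V [⋀^Fin (k + 1)]→L[ℝ] ℝ) :
    contraction k v a = a.curryLeft v := rfl

/-- The restriction of forms along a linear map, as a continuous linear map of forms. -/
def restrictCLM (k : ℕ) (L : W →L[ℝ] V) : (V [⋀^Fin k]→L[ℝ] ℝ) →L[ℝ] W [⋀^Fin k]→L[ℝ] ℝ :=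
  ContinuousAlternatingMap.compContinuousLinearMapCLM L

theorem curryLeft_extDeriv_zero {κ : V → V [⋀^Fin 0]→L[ℝ] ℝ} {x : V} (v : V) :
    (extDeriv κ x).curryLeft v = fderiv ℝ κ x v := by
  ext w
  change extDeriv κ x (Matrix.vecCons v w) = _
  rw [extDeriv, ContinuousAlternatingMap.alternatizeUncurryFin_apply]
  simp

/-- Cartan's formula for a constant vector field. -/
theorem curryLeft_extDeriv {κ : V → V [⋀^Fin (k + 1)]→L[ℝ] ℝ} {x : V}
    (hκ : DifferentiableAt ℝ κ x) (v : V) :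
    (extDeriv κ x).curryLeft v =
      fderiv ℝ κ x v - extDeriv (fun y => contraction k v (κ y)) x := by
  have h : fderiv ℝ (fun y => contraction k v (κ y)) x = (contraction k v).comp (fderiv ℝ κ x) :=
    ((contraction k v).hasFDerivAt.comp x hκ.hasFDerivAt).fderiv
  ext w
  change extDeriv κ x (Matrix.vecCons v w) = _
  rw [extDeriv, extDeriv, ContinuousAlternatingMap.alternatizeUncurryFin_apply, h,
    ContinuousAlternatingMap.sub_apply,
    ContinuousAlternatingMap.alternatizeUncurryFin_apply, Fin.sum_univ_succ, sub_eq_add_neg,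
    ← Finset.sum_neg_distrib]
  congr 1
  · simp
  · refine Finset.sum_congr rfl fun i _ => ?_
    have : i.succ.removeNth (Matrix.vecCons v w) = Matrix.vecCons v (i.removeNth w) := by
      funext j
      refine Fin.cases ?_ (fun j => ?_) j <;> simp [Fin.removeNth]
    rw [this]
    simp [pow_succ, contraction_apply]

end CartanVectorSpace

section Family
variable {n : ℕ} {S : Type*} [TopologicalSpace S] [ChartedSpace (EuclideanSpace ℝ (Fin n)) S]
  [IsManifold (𝓡 n) ∞ S]
  {P : Type*} [NormedAddCommGroup P] [NormedSpace ℝ P] {k l : ℕ}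

/-- The inclusion of the directions along `S` in the directions along `P × S`. -/
abbrev inS (n : ℕ) (P : Type*) [NormedAddCommGroup P] [NormedSpace ℝ P] :
    EuclideanSpace ℝ (Fin n) →L[ℝ] P × EuclideanSpace ℝ (Fin n) :=
  ContinuousLinearMap.inr ℝ P (EuclideanSpace ℝ (Fin n))

/-- Forms on `P × S`, given by their expressions in the preferred charts of `S`. Forms on `S` are
obtained from them by contraction with constant vectors of `P` and restriction to a slice. The
expressions in different charts need not be compatible. -/
abbrev LocalForms (S : Type*) (n : ℕ) (P : Type*) [NormedAddCommGroup P] [NormedSpace ℝ P]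
    (k : ℕ) : Type _ :=
  S → P × EuclideanSpace ℝ (Fin n) → (P × EuclideanSpace ℝ (Fin n)) [⋀^Fin k]→L[ℝ] ℝ

/-- Smoothness of local expressions of forms on `P × S`. -/
def LocalForms.IsSmooth (κ : LocalForms S n P k) : Prop :=
  ∀ i : S, ContDiffOn ℝ ∞ (κ i) (Set.univ ×ˢ (extChartAt (𝓡 n) i).target)

theorem LocalForms.IsSmooth.differentiableAt {κ : LocalForms S n P k}
    (hκ : LocalForms.IsSmooth κ) (i : S) (t : P) {u : EuclideanSpace ℝ (Fin n)}
    (hu : u ∈ (extChartAt (𝓡 n) i).target) :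
    DifferentiableAt ℝ (κ i) (t, u) :=
  ((hκ i).contDiffAt ((isOpen_univ.prod (isOpen_extChartAt_target i)).mem_nhds
    ⟨Set.mem_univ t, hu⟩)).differentiableAt (by simp)

theorem hasFDerivAt_slice (t : P) (u : EuclideanSpace ℝ (Fin n)) :
    HasFDerivAt (fun u : EuclideanSpace ℝ (Fin n) => (t, u)) (inS n P) u :=
  hasFDerivAt_prodMk_right t u

/-! A form on `S` that, in all preferred charts, is the image of a local form on `P × S` at a fixed
parameter under a fixed linear map inherits the smoothness, the derivative with respect to the
parameter and (for the restriction to a slice) the exterior derivative of the local form. -/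

section
variable {κ : LocalForms S n P k} (hκ : LocalForms.IsSmooth κ)
  (Φ : ((P × EuclideanSpace ℝ (Fin n)) [⋀^Fin k]→L[ℝ] ℝ) →L[ℝ]
    (EuclideanSpace ℝ (Fin n) [⋀^Fin l]→L[ℝ] ℝ))
include hκ

theorem isSmooth_of_inChart_eq {β : DiffForm (𝓡 n) S l} (t : P)
    (h : ∀ i, ∀ u ∈ (extChartAt (𝓡 n) i).target, β.inChart i u = Φ (κ i (t, u))) :
    β.IsSmooth := fun i =>
  (Φ.contDiff.comp_contDiffOn ((hκ i).comp (contDiff_const (c := t).prodMk contDiff_id).contDiffOn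
    fun _ hu => ⟨Set.mem_univ _, hu⟩)).congr (h i)

theorem isSmoothFormCurve_of_inChart_eq {A : ℝ → DiffForm (𝓡 n) S l} (t a : P)
    (h : ∀ r i, ∀ u ∈ (extChartAt (𝓡 n) i).target,
      (A r).inChart i u = Φ (κ i (t + r • a, u))) : IsSmoothFormCurve A := fun i => by
  have h1 : ContDiff ℝ ∞ fun r : ℝ × EuclideanSpace ℝ (Fin n) => (t + r.1 • a, r.2) := by
    fun_prop
  exact (Φ.contDiff.comp_contDiffOn ((hκ i).comp h1.contDiffOn
    fun r hr => ⟨Set.mem_univ _, hr.2⟩)).congr fun r hr => h r.1 i r.2 hr.2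

theorem inChart_formVelocity_of_inChart_eq {A : ℝ → DiffForm (𝓡 n) S l} (t a : P)
    (h : ∀ r i, ∀ u ∈ (extChartAt (𝓡 n) i).target,
      (A r).inChart i u = Φ (κ i (t + r • a, u))) (i : S) {u : EuclideanSpace ℝ (Fin n)}
    (hu : u ∈ (extChartAt (𝓡 n) i).target) :
    (formVelocity A).inChart i u = Φ (fderiv ℝ (κ i) (t, u) (a, 0)) := by
  have hA := isSmoothFormCurve_of_inChart_eq hκ Φ t a h
  have h1 : HasFDerivAt (κ i) (fderiv ℝ (κ i) (t, u)) (t + (0 : ℝ) • a, u) := by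
    simpa using (hκ.differentiableAt i t hu).hasFDerivAt
  have h2 : HasDerivAt (fun r : ℝ => (t + r • a, u)) (a, 0) 0 := by
    simpa using (((hasDerivAt_id (0 : ℝ)).smul_const a).const_add t).prodMk
      (hasDerivAt_const (0 : ℝ) u)
  have h3 := Φ.hasFDerivAt.comp_hasDerivAt (0 : ℝ) (h1.comp_hasDerivAt (0 : ℝ) h2)
  have h4 := hA.hasDerivAt_inChart i hu 0
  rw [hA.inChart_formVelocity i hu]
  refine h4.unique ?_
  have : (fun r => (A r).inChart i u) = fun r => Φ (κ i (t + r • a, u)) :=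
    funext fun r => h r i u hu
  rw [this]
  exact h3

theorem inChart_extDerivative_of_inChart_eq {β : DiffForm (𝓡 n) S k} (t : P)
    (h : ∀ i, ∀ u ∈ (extChartAt (𝓡 n) i).target,
      β.inChart i u = restrictCLM k (inS n P) (κ i (t, u)))
    (i : S) {u : EuclideanSpace ℝ (Fin n)} (hu : u ∈ (extChartAt (𝓡 n) i).target) :
    β.extDerivative.inChart i u = restrictCLM (k + 1) (inS n P) (extDeriv (κ i) (t, u)) := by
  have hβ := isSmooth_of_inChart_eq hκ _ t h
  rw [DiffForm.inChart_extDerivative hβ hu]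
  have h1 : β.inChart i =ᶠ[𝓝 u] fun w => (κ i (t, w)).compContinuousLinearMap
      (fderiv ℝ (fun u : EuclideanSpace ℝ (Fin n) => (t, u)) w) := by
    filter_upwards [(isOpen_extChartAt_target i).mem_nhds hu] with w hw
    rw [h i w hw, (hasFDerivAt_slice t w).fderiv]
    rfl
  have h2 : ContDiff ℝ ∞ fun u : EuclideanSpace ℝ (Fin n) => (t, u) := by fun_prop
  rw [h1.extDeriv_eq, extDeriv_pullback (f := fun u : EuclideanSpace ℝ (Fin n) => (t, u))
    (hκ.differentiableAt i t hu) h2.contDiffAt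
    (by rw [minSmoothness_of_isRCLikeNormedField]
        exact WithTop.coe_le_coe.2 (le_top : (2 : ℕ∞) ≤ ⊤)), (hasFDerivAt_slice t u).fderiv]
  rfl

end

variable {E H : Type*} [NormedAddCommGroup E] [NormedSpace ℝ E] [TopologicalSpace H]
  {I : ModelWithCorners ℝ E H} {M : Type*} [TopologicalSpace M]
  [ChartedSpace H M]

variable (I) in
/-- The derivative of a family of maps in the direction `v` of the parameter. -/
def paramDeriv (Γ : P → S → M) (t v : P) (p : S) : E := derivAt 𝓘(ℝ, P) I (fun s => Γ s p) t v

/-- The form `Γ_t^*(i_v α)` on `S`, where `v` stands for the derivative of the family `Γ` in the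
direction `v`. -/
def sliceContract (Γ : P → S → M) (α : DiffForm I M (k + 1)) (t v : P) : DiffForm (𝓡 n) S k :=
  fun p => ((α (Γ t p)).curryLeft (paramDeriv I Γ t v p)).compContinuousLinearMap
    (derivAt (𝓡 n) I (Γ t) p)

/-- The form `Γ_t^*(i_w i_v α)` on `S`. -/
def sliceContract₂ (Γ : P → S → M) (α : DiffForm I M (k + 1 + 1)) (t v w : P) :
    DiffForm (𝓡 n) S k :=
  fun p => (((α (Γ t p)).curryLeft (paramDeriv I Γ t v p)).curryLeft
    (paramDeriv I Γ t w p)).compContinuousLinearMap (derivAt (𝓡 n) I (Γ t) p)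

/-- A family of maps, in the preferred chart of `S` at `i`. -/
def localFamily (Γ : P → S → M) (i : S) (r : P × EuclideanSpace ℝ (Fin n)) : M :=
  Γ r.1 ((extChartAt (𝓡 n) i).symm r.2)

/-- The pullback of a form to `P × S`, in the preferred charts of `S`. -/
def localPullback (Γ : P → S → M) (α : DiffForm I M k) : LocalForms S n P k := fun i =>
  DiffForm.pullback (I := 𝓘(ℝ, P × EuclideanSpace ℝ (Fin n))) (I' := I) (localFamily Γ i) α

theorem isOpen_univ_prod_target (i : S) :
    IsOpen ((Set.univ : Set P) ×ˢ (extChartAt (𝓡 n) i).target) :=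
  isOpen_univ.prod (isOpen_extChartAt_target i)

section
variable [I.Boundaryless] [IsManifold I ∞ M]
  {Γ : P → S → M} (hΓ : ContMDiff (𝓘(ℝ, P).prod (𝓡 n)) I ∞ fun r : P × S => Γ r.1 r.2)
include hΓ

theorem contMDiffOn_localFamily (i : S) :
    ContMDiffOn 𝓘(ℝ, P × EuclideanSpace ℝ (Fin n)) I ∞ (localFamily Γ i)
      (Set.univ ×ˢ (extChartAt (𝓡 n) i).target) := by
  refine hΓ.comp_contMDiffOn (ContMDiffOn.prodMk contDiff_fst.contMDiff.contMDiffOn ?_)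
  exact (contMDiffOn_extChartAt_symm i).comp contDiff_snd.contMDiff.contMDiffOn fun r hr => hr.2

theorem mdifferentiableAt_localFamily (i : S) (t : P) {u : EuclideanSpace ℝ (Fin n)}
    (hu : u ∈ (extChartAt (𝓡 n) i).target) :
    MDifferentiableAt 𝓘(ℝ, P × EuclideanSpace ℝ (Fin n)) I (localFamily Γ i) (t, u) :=
  ((contMDiffOn_localFamily hΓ i).contMDiffAt ((isOpen_univ_prod_target i).mem_nhds
    ⟨Set.mem_univ t, hu⟩)).mdifferentiableAt (by simp)

theorem contMDiff_slice (t : P) : ContMDiff (𝓡 n) I ∞ (Γ t) :=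
  hΓ.comp (contMDiff_const.prodMk contMDiff_id)

theorem contMDiff_param (p : S) : ContMDiff 𝓘(ℝ, P) I ∞ (fun t => Γ t p) :=
  hΓ.comp (contMDiff_id.prodMk contMDiff_const)

theorem derivAt_localFamily_inS (i : S) (t : P) {u : EuclideanSpace ℝ (Fin n)}
    (hu : u ∈ (extChartAt (𝓡 n) i).target) :
    (derivAt 𝓘(ℝ, P × EuclideanSpace ℝ (Fin n)) I (localFamily Γ i) (t, u)).comp (inS n P) =
      (derivAt (𝓡 n) I (Γ t) ((extChartAt (𝓡 n) i).symm u)).comp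
        (derivAt (𝓡 n) (𝓡 n) (extChartAt (𝓡 n) i).symm u) := by
  have hs := hasFDerivAt_slice (P := P) t u
  have h1 := derivAt_comp (g := fun u : EuclideanSpace ℝ (Fin n) => (t, u))
    (mdifferentiableAt_localFamily hΓ i t hu) hs.differentiableAt.mdifferentiableAt
  rw [derivAt_eq_fderiv, hs.fderiv] at h1
  rw [← h1]
  exact derivAt_comp (f := Γ t) ((contMDiff_slice hΓ t).mdifferentiableAt (by simp))
    (mdifferentiableAt_extChartAt_symm hu)

theorem derivAt_localFamily_param (i : S) (t v : P) {u : EuclideanSpace ℝ (Fin n)}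
    (hu : u ∈ (extChartAt (𝓡 n) i).target) :
    derivAt 𝓘(ℝ, P × EuclideanSpace ℝ (Fin n)) I (localFamily Γ i) (t, u) (v, 0) =
      paramDeriv I Γ t v ((extChartAt (𝓡 n) i).symm u) := by
  have hs : HasFDerivAt (fun s : P => (s, u))
    (ContinuousLinearMap.inl ℝ P (EuclideanSpace ℝ (Fin n))) t := hasFDerivAt_prodMk_left t u
  have h1 := derivAt_comp (g := fun s : P => (s, u))
    (mdifferentiableAt_localFamily hΓ i t hu) hs.differentiableAt.mdifferentiableAt
  rw [derivAt_eq_fderiv, hs.fderiv] at h1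
  exact (congrArg (fun L => L v) h1).symm

theorem isSmooth_localPullback [FiniteDimensional ℝ P] {α : DiffForm I M k} (hα : α.IsSmooth) :
    LocalForms.IsSmooth (localPullback (n := n) Γ α) := fun i _ hr =>
  (hα.contDiffAt_pullback (isOpen_univ_prod_target i) (contMDiffOn_localFamily hΓ i)
    hr).contDiffWithinAt

theorem extDeriv_localPullback {α : DiffForm I M k} (hα : α.IsSmooth) (i : S) (t : P)
    {u : EuclideanSpace ℝ (Fin n)} (hu : u ∈ (extChartAt (𝓡 n) i).target) :
    extDeriv (localPullback Γ α i) (t, u) = localPullback Γ α.extDerivative i (t, u) :=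
  hα.extDeriv_pullback (isOpen_univ_prod_target i) (contMDiffOn_localFamily hΓ i)
    ⟨Set.mem_univ t, hu⟩

theorem inChart_pullback_slice (α : DiffForm I M k) (t : P) (i : S)
    {u : EuclideanSpace ℝ (Fin n)} (hu : u ∈ (extChartAt (𝓡 n) i).target) :
    (DiffForm.pullback (I := 𝓡 n) (I' := I) (Γ t) α).inChart i u =
      restrictCLM k (inS n P) (localPullback Γ α i (t, u)) := by
  have h : restrictCLM k (inS n P) (localPullback Γ α i (t, u)) =
      (α (localFamily Γ i (t, u))).compContinuousLinearMap
        ((derivAt 𝓘(ℝ, P × EuclideanSpace ℝ (Fin n)) I (localFamily Γ i) (t, u)).comp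
          (inS n P)) := rfl
  rw [h, derivAt_localFamily_inS hΓ i t hu]
  rfl

theorem inChart_sliceContract (α : DiffForm I M (k + 1)) (t v : P) (i : S)
    {u : EuclideanSpace ℝ (Fin n)} (hu : u ∈ (extChartAt (𝓡 n) i).target) :
    (sliceContract Γ α t v : DiffForm (𝓡 n) S k).inChart i u =
      restrictCLM k (inS n P) (contraction k (v, 0) (localPullback Γ α i (t, u))) := by
  rw [contraction_apply, localPullback, DiffForm.pullback,
    ContinuousAlternatingMap.curryLeft_compContinuousLinearMap,
    derivAt_localFamily_param hΓ i t v hu]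
  have h : ∀ a : E [⋀^Fin k]→L[ℝ] ℝ, restrictCLM k (inS n P) (a.compContinuousLinearMap
      (derivAt 𝓘(ℝ, P × EuclideanSpace ℝ (Fin n)) I (localFamily Γ i) (t, u))) =
      a.compContinuousLinearMap
        ((derivAt 𝓘(ℝ, P × EuclideanSpace ℝ (Fin n)) I (localFamily Γ i) (t, u)).comp
          (inS n P)) := fun a => rfl
  rw [h, derivAt_localFamily_inS hΓ i t hu]
  rfl

theorem inChart_sliceContract₂ (α : DiffForm I M (k + 1 + 1)) (t v w : P) (i : S)
    {u : EuclideanSpace ℝ (Fin n)} (hu : u ∈ (extChartAt (𝓡 n) i).target) :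
    (sliceContract₂ Γ α t v w : DiffForm (𝓡 n) S k).inChart i u =
      restrictCLM k (inS n P) (contraction k (w, 0) (contraction (k + 1) (v, 0)
        (localPullback Γ α i (t, u)))) := by
  rw [contraction_apply, contraction_apply, localPullback, DiffForm.pullback,
    ContinuousAlternatingMap.curryLeft_compContinuousLinearMap,
    ContinuousAlternatingMap.curryLeft_compContinuousLinearMap,
    derivAt_localFamily_param hΓ i t v hu, derivAt_localFamily_param hΓ i t w hu]
  have h : ∀ a : E [⋀^Fin k]→L[ℝ] ℝ, restrictCLM k (inS n P) (a.compContinuousLinearMap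
      (derivAt 𝓘(ℝ, P × EuclideanSpace ℝ (Fin n)) I (localFamily Γ i) (t, u))) =
      a.compContinuousLinearMap
        ((derivAt 𝓘(ℝ, P × EuclideanSpace ℝ (Fin n)) I (localFamily Γ i) (t, u)).comp
          (inS n P)) := fun a => rfl
  rw [h, derivAt_localFamily_inS hΓ i t hu]
  rfl

end

theorem DiffForm.ext_inChart {α β : DiffForm (𝓡 n) S k}
    (h : ∀ i, ∀ u ∈ (extChartAt (𝓡 n) i).target, α.inChart i u = β.inChart i u) : α = β := by
  funext p
  rw [α.eq_pullback_inChart (mem_extChartAt_source p),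
    β.eq_pullback_inChart (mem_extChartAt_source p), h p _ (mem_extChartAt_target p)]

section
variable [FiniteDimensional ℝ P] [I.Boundaryless] [IsManifold I ∞ M]
  {Γ : P → S → M} (hΓ : ContMDiff (𝓘(ℝ, P).prod (𝓡 n)) I ∞ fun r : P × S => Γ r.1 r.2)
include hΓ

theorem isSmooth_sliceContract {α : DiffForm I M (k + 1)} (hα : α.IsSmooth) (t v : P) :
    (sliceContract Γ α t v : DiffForm (𝓡 n) S k).IsSmooth :=
  isSmooth_of_inChart_eq (isSmooth_localPullback hΓ hα)
    ((restrictCLM k (inS n P)).comp (contraction k (v, 0))) t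
    fun i _ hu => inChart_sliceContract hΓ α t v i hu

theorem isSmooth_sliceContract₂ {α : DiffForm I M (k + 1 + 1)} (hα : α.IsSmooth) (t v w : P) :
    (sliceContract₂ Γ α t v w : DiffForm (𝓡 n) S k).IsSmooth :=
  isSmooth_of_inChart_eq (isSmooth_localPullback hΓ hα)
    ((restrictCLM k (inS n P)).comp ((contraction k (w, 0)).comp (contraction (k + 1) (v, 0)))) t
    fun i _ hu => inChart_sliceContract₂ hΓ α t v w i hu

theorem isSmoothFormCurve_pullback {α : DiffForm I M k} (hα : α.IsSmooth) (t v : P) :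
    IsSmoothFormCurve fun r : ℝ =>
      DiffForm.pullback (I := 𝓡 n) (I' := I) (Γ (t + r • v)) α :=
  isSmoothFormCurve_of_inChart_eq (isSmooth_localPullback hΓ hα) _ t v
    fun r i _ hu => inChart_pullback_slice hΓ α (t + r • v) i hu

theorem isSmoothFormCurve_sliceContract {α : DiffForm I M (k + 1)} (hα : α.IsSmooth) (t v w : P) :
    IsSmoothFormCurve fun r : ℝ => (sliceContract Γ α (t + r • v) w : DiffForm (𝓡 n) S k) :=
  isSmoothFormCurve_of_inChart_eq (isSmooth_localPullback hΓ hα)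
    ((restrictCLM k (inS n P)).comp (contraction k (w, 0))) t v
    fun r i _ hu => inChart_sliceContract hΓ α (t + r • v) w i hu

/-- Cartan's formula: up to an exact form, the derivative of `Γ_t^* α` in the direction `v` of the
parameter is `Γ_t^*(i_v dα)`. -/
theorem exists_formVelocity_pullback_eq {α : DiffForm I M k} (hα : α.IsSmooth) (t v : P) :
    ∃ ζ : DiffForm (𝓡 n) S k, ζ.IsExact ∧
      formVelocity (fun r : ℝ =>
        DiffForm.pullback (I := 𝓡 n) (I' := I) (Γ (t + r • v)) α) =
        sliceContract Γ α.extDerivative t v + ζ := by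
  have hκ := isSmooth_localPullback (n := n) hΓ hα
  have hvel : ∀ i, ∀ u ∈ (extChartAt (𝓡 n) i).target, (formVelocity (fun r : ℝ =>
      DiffForm.pullback (I := 𝓡 n) (I' := I) (Γ (t + r • v)) α)).inChart i u = _ :=
    fun i u hu => inChart_formVelocity_of_inChart_eq hκ _ t v
      (fun r i _ hu => inChart_pullback_slice hΓ α (t + r • v) i hu) i hu
  cases k with
  | zero =>
    refine ⟨0, rfl, DiffForm.ext_inChart fun i u hu => ?_⟩
    rw [hvel i u hu, add_zero, inChart_sliceContract hΓ _ t v i hu,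
      ← extDeriv_localPullback hΓ hα i t hu, contraction_apply, curryLeft_extDeriv_zero]
  | succ k =>
    refine ⟨_, ⟨sliceContract Γ α t v, isSmooth_sliceContract hΓ hα t v, rfl⟩,
      DiffForm.ext_inChart fun i u hu => ?_⟩
    have hη : LocalForms.IsSmooth (n := n) (fun (i : S) r =>
        contraction k (v, 0) (localPullback Γ α i r)) := fun i =>
      (contraction k ((v, 0) : P × EuclideanSpace ℝ (Fin n))).contDiff.comp_contDiffOn (hκ i)
    rw [DiffForm.inChart_add, hvel i u hu, inChart_sliceContract hΓ _ t v i hu,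
      inChart_extDerivative_of_inChart_eq hη t
        (fun i u hu => inChart_sliceContract hΓ α t v i hu) i hu, ← map_add,
      ← extDeriv_localPullback hΓ hα i t hu, contraction_apply,
      curryLeft_extDeriv (hκ.differentiableAt i t hu)]
    congr 1
    abel

/-- The exterior derivative of the form `Γ^* α` on `P × S`, contracted with the two directions `v`
and `w` of the parameter: up to an exact form, `Γ_t^*(i_w i_v dα)` is `∂_v Γ_t^*(i_w α) - ∂_w
Γ_t^*(i_v α)`. It follows from two applications of Cartan's formula for constant vector fields. -/
theorem exists_formVelocity_sliceContract_eq {α : DiffForm I M (k + 1)} (hα : α.IsSmooth)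
    (t v w : P) :
    ∃ ζ : DiffForm (𝓡 n) S k, ζ.IsExact ∧
      formVelocity (fun r : ℝ => (sliceContract Γ α (t + r • v) w : DiffForm (𝓡 n) S k)) + ζ =
        formVelocity (fun r : ℝ => (sliceContract Γ α (t + r • w) v : DiffForm (𝓡 n) S k)) +
          sliceContract₂ Γ α.extDerivative t v w := by
  have hκ := isSmooth_localPullback (n := n) hΓ hα
  have hvel : ∀ (v w : P) (i : S), ∀ u ∈ (extChartAt (𝓡 n) i).target, (formVelocity (fun r : ℝ =>
      (sliceContract Γ α (t + r • v) w : DiffForm (𝓡 n) S k))).inChart i u = _ :=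
    fun v w i u hu => inChart_formVelocity_of_inChart_eq hκ
      ((restrictCLM k (inS n P)).comp (contraction k (w, 0))) t v
      (fun r i _ hu => inChart_sliceContract hΓ α (t + r • v) w i hu) i hu
  have hη : LocalForms.IsSmooth (n := n) (fun (i : S) r =>
      contraction k (v, 0) (localPullback Γ α i r)) := fun i =>
    (contraction k ((v, 0) : P × EuclideanSpace ℝ (Fin n))).contDiff.comp_contDiffOn (hκ i)
  have hηd : ∀ i, ∀ u ∈ (extChartAt (𝓡 n) i).target, fderiv ℝ (fun r =>
      contraction k ((v, 0) : P × EuclideanSpace ℝ (Fin n)) (localPullback Γ α i r)) (t, u) (w, 0) =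
      contraction k (v, 0) (fderiv ℝ (localPullback Γ α i) (t, u) (w, 0)) := fun i u hu => by
    have := ((contraction k ((v, 0) : P × EuclideanSpace ℝ (Fin n))).hasFDerivAt.comp (t, u)
      (hκ.differentiableAt i t hu).hasFDerivAt).fderiv
    exact congrArg (fun L => L (w, 0)) this
  have hC : ∀ i, ∀ u ∈ (extChartAt (𝓡 n) i).target,
      (sliceContract₂ Γ α.extDerivative t v w : DiffForm (𝓡 n) S k).inChart i u =
      restrictCLM k (inS n P) (contraction k (w, 0)
        (fderiv ℝ (localPullback Γ α i) (t, u) (v, 0)) - contraction k (w, 0)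
          (extDeriv (fun r => contraction k (v, 0) (localPullback Γ α i r)) (t, u))) :=
    fun i u hu => by
      rw [inChart_sliceContract₂ hΓ _ t v w i hu, ← extDeriv_localPullback hΓ hα i t hu,
        contraction_apply (k := k + 1), curryLeft_extDeriv (hκ.differentiableAt i t hu), map_sub]
  cases k with
  | zero =>
    refine ⟨0, rfl, DiffForm.ext_inChart fun i u hu => ?_⟩
    rw [add_zero, DiffForm.inChart_add, hvel v w i u hu, hvel w v i u hu, hC i u hu,
      contraction_apply (a := extDeriv _ _), curryLeft_extDeriv_zero, hηd i u hu]
    simp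
  | succ k =>
    refine ⟨_, ⟨sliceContract₂ Γ α t v w, isSmooth_sliceContract₂ hΓ hα t v w, rfl⟩,
      DiffForm.ext_inChart fun i u hu => ?_⟩
    have hη₂ : LocalForms.IsSmooth (n := n) (fun (i : S) r =>
        contraction k (w, 0) (contraction (k + 1) (v, 0) (localPullback Γ α i r))) := fun i =>
      (contraction k ((w, 0) : P × EuclideanSpace ℝ (Fin n))).contDiff.comp_contDiffOn (hη i)
    rw [DiffForm.inChart_add, DiffForm.inChart_add, hvel v w i u hu, hvel w v i u hu, hC i u hu,
      inChart_extDerivative_of_inChart_eq hη₂ t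
        (fun i u hu => inChart_sliceContract₂ hΓ α t v w i hu) i hu,
      contraction_apply (a := extDeriv _ _), curryLeft_extDeriv (hη.differentiableAt i t hu),
      hηd i u hu]
    simp only [ContinuousLinearMap.comp_apply, ← map_add]
    congr 1
    abel

end
end Family

/-! ### Smoothness of the canonical form -/

section CanonicalSmooth
variable {EY B F : Type*} [NormedAddCommGroup EY] [NormedSpace ℝ EY]
  [NormedAddCommGroup B] [NormedSpace ℝ B]
  [NormedAddCommGroup F] [NormedSpace ℝ F]
  {X Y : Type*} [TopologicalSpace X] [ChartedSpace B X] [TopologicalSpace Y] [ChartedSpace EY Y]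
  [FiniteDimensional ℝ B] [FiniteDimensional ℝ F] {π : Y → X} (k : ℕ)
  (hπ : Manifold.IsSubmersionOfComplement F 𝓘(ℝ, EY) 𝓘(ℝ, B) ∞ π)

theorem AdaptedChart.contMDiffAt_coord (i : AdaptedChart EY B F π) {y : Y}
    (hy : y ∈ i.chartY.source) : ContMDiffAt 𝓘(ℝ, EY) 𝓘(ℝ, B × F) ∞ i.coord y :=
  i.contMDiffOn_coord.contMDiffAt (i.chartY.open_source.mem_nhds hy)

theorem AdaptedChart.jacobian_comp_derivAt_coord (i j : AdaptedChart EY B F π) {y : Y}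
    (hi : y ∈ i.chartY.source) (hj : y ∈ j.chartY.source) :
    (i.jacobian j y).comp (derivAt 𝓘(ℝ, EY) 𝓘(ℝ, B × F) j.coord y) =
      derivAt 𝓘(ℝ, EY) 𝓘(ℝ, B × F) i.coord y := by
  have h1 := AdaptedChart.hasFDerivAt_transition i j hi hj
  have h2 := derivAt_comp (I := 𝓘(ℝ, EY)) (g := j.coord) (x := y)
    (f := fun w => i.coord (j.coordInv w))
    h1.differentiableAt.mdifferentiableAt ((j.contMDiffAt_coord hj).mdifferentiableAt (by simp))
  rw [derivAt_eq_fderiv, h1.fderiv] at h2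
  rw [← h2]
  refine derivAt_congr ?_
  filter_upwards [j.chartY.open_source.mem_nhds hj] with w hw
  simp only [j.coordInv_coord hw]

/-- The frame at `y` is the derivative of the adapted coordinates that the bundle prefers at `y`. -/
theorem frame_eq_derivAt (y : Y) :
    frame k hπ y = derivAt 𝓘(ℝ, EY) 𝓘(ℝ, B × F) ((phaseCore k hπ).indexAt y).coord y := by
  set e := (phaseCore k hπ).indexAt y
  have hy : y ∈ e.chartY.source := (phaseCore k hπ).mem_baseSet_at y
  have h1 : MDifferentiableAt 𝓘(ℝ, EY) 𝓘(ℝ, EY) e.chartY y :=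
    ((contMDiffOn_of_mem_maximalAtlas e.chartY_mem).contMDiffAt
      (e.chartY.open_source.mem_nhds hy)).mdifferentiableAt (by simp)
  have h2 := derivAt_comp (f := (e.split : EY → B × F)) (g := e.chartY) (x := y)
    (e.split : EY →L[ℝ] B × F).mdifferentiableAt h1
  rw [derivAt_eq_fderiv, e.split.fderiv] at h2
  exact h2.symm

/-- The form that a point of the phase space is, expressed in any trivialization. -/
theorem tautForm_eq_localTriv (i : AdaptedChart EY B F π) (z : PhaseSpace k hπ)
    (hz : z.1 ∈ i.chartY.source) :
    tautForm k hπ z =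
      (PhaseFibre.form B F k ((phaseCore k hπ).localTriv i z).2).compContinuousLinearMap
        (derivAt 𝓘(ℝ, EY) 𝓘(ℝ, B × F) i.coord z.1) := by
  have hy : z.1 ∈ ((phaseCore k hπ).indexAt z.1).chartY.source :=
    (phaseCore k hπ).mem_baseSet_at z.1
  rw [VectorBundleCore.localTriv_apply]
  have h := form_formTransition k ((phaseCore k hπ).indexAt z.1) i hy hz z.2
  rw [tautForm, frame_eq_derivAt, ← AdaptedChart.jacobian_comp_derivAt_coord _ i hy hz]
  exact congrArg (fun a => ContinuousAlternatingMap.compContinuousLinearMap a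
    (derivAt 𝓘(ℝ, EY) 𝓘(ℝ, B × F) i.coord z.1)) h.symm

end CanonicalSmooth

section Theta
variable {n : ℕ} {EY F : Type*} [NormedAddCommGroup EY] [NormedSpace ℝ EY]
  [FiniteDimensional ℝ EY] [NormedAddCommGroup F] [NormedSpace ℝ F] [FiniteDimensional ℝ F]
  {X Y : Type*} [TopologicalSpace X] [ChartedSpace (EuclideanSpace ℝ (Fin (n + 1))) X]
  [TopologicalSpace Y] [ChartedSpace EY Y] [IsManifold 𝓘(ℝ, EY) ∞ Y] {π : Y → X}
  (hπ : Manifold.IsSubmersionOfComplement F 𝓘(ℝ, EY) (𝓡 (n + 1)) ∞ π)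

/-- In a trivialization over an adapted chart, `Θ` at a point is the fibre coordinate of that point,
restricted along the derivative of the base coordinates; both factors are smooth. -/
theorem isSmooth_canonicalTheta : (canonicalTheta hπ).IsSmooth := by
  intro z₀ w hw
  set g := (extChartAt (phaseModel n EY F) z₀).symm with hg
  have hgs : ContMDiffOn 𝓘(ℝ, PhaseModelSpace n EY F) (phaseModel n EY F) ∞ g
      (extChartAt (phaseModel n EY F) z₀).target := contMDiffOn_extChartAt_symm z₀
  have ht : IsOpen (extChartAt (phaseModel n EY F) z₀).target := isOpen_extChartAt_target z₀
  have hproj : ContMDiff (phaseModel n EY F) 𝓘(ℝ, EY) ∞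
      (fun z : PhaseSpace (n + 1) hπ => z.proj) :=
    Bundle.contMDiff_proj _
  have hh : ContMDiffOn 𝓘(ℝ, PhaseModelSpace n EY F) 𝓘(ℝ, EY) ∞ (fun v => (g v).proj)
      (extChartAt (phaseModel n EY F) z₀).target := hproj.comp_contMDiffOn hgs
  set i := (phaseCore (n + 1) hπ).indexAt (g w).proj
  have hi : (g w).proj ∈ i.chartY.source := (phaseCore (n + 1) hπ).mem_baseSet_at _
  set U := (extChartAt (phaseModel n EY F) z₀).target ∩ (fun v => (g v).proj) ⁻¹' i.chartY.source
  have hU : IsOpen U := hh.continuousOn.isOpen_inter_preimage ht i.chartY.open_source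
  have hwU : w ∈ U := ⟨hw, hi⟩
  have hcoord : ContDiffOn ℝ ∞ (fun v => i.coord (g v).proj) U := by
    rw [← contMDiffOn_iff_contDiffOn]
    exact i.contMDiffOn_coord.comp (hh.mono Set.inter_subset_left) fun v hv => hv.2
  have htriv : ContDiffOn ℝ ∞ (fun v => ((phaseCore (n + 1) hπ).localTriv i (g v)).2) U := by
    rw [← contMDiffOn_iff_contDiffOn]
    intro v hv
    have : MemTrivializationAtlas ((phaseCore (n + 1) hπ).localTriv i) := ⟨i, rfl⟩
    have h1 := ((phaseCore (n + 1) hπ).localTriv i).contMDiffOn (IB := 𝓘(ℝ, EY)) (n := ∞)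
    have h2 : ContMDiffAt (phaseModel n EY F) (phaseModel n EY F) ∞
        ((phaseCore (n + 1) hπ).localTriv i) (g v) :=
      h1.contMDiffAt (((phaseCore (n + 1) hπ).localTriv i).open_source.mem_nhds
        (((phaseCore (n + 1) hπ).localTriv i).mem_source.2 hv.2))
    exact (contMDiffAt_snd.comp v
      (h2.comp v (hgs.contMDiffAt (ht.mem_nhds hv.1)))).contMDiffWithinAt
  have hform : ContDiffAt ℝ ∞ (fun v => (PhaseFibre.form _ F (n + 1)
      ((phaseCore (n + 1) hπ).localTriv i (g v)).2).compContinuousLinearMap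
        (fderiv ℝ (fun v => i.coord (g v).proj) v)) w :=
    contDiffAt_compContinuousLinearMap
      ((PhaseFibre.form (EuclideanSpace ℝ (Fin (n + 1))) F (n + 1)).contDiff.contDiffAt.comp w
        (htriv.contDiffAt (hU.mem_nhds hwU)))
      ((hcoord.contDiffAt (hU.mem_nhds hwU)).fderiv_right (m := ∞) (by simp))
  refine (hform.congr_of_eventuallyEq ?_).contDiffWithinAt
  filter_upwards [hU.mem_nhds hwU] with v hv
  have hgv : MDifferentiableAt 𝓘(ℝ, PhaseModelSpace n EY F) (phaseModel n EY F) g v :=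
    (hgs.contMDiffAt (ht.mem_nhds hv.1)).mdifferentiableAt (by simp)
  have hpv : MDifferentiableAt (phaseModel n EY F) 𝓘(ℝ, EY)
    (fun z : PhaseSpace (n + 1) hπ => z.proj) (g v) := hproj.mdifferentiableAt (by simp)
  have hc : MDifferentiableAt 𝓘(ℝ, EY) 𝓘(ℝ, EuclideanSpace ℝ (Fin (n + 1)) × F) i.coord
      (g v).proj := (i.contMDiffAt_coord hv.2).mdifferentiableAt (by simp)
  rw [← derivAt_eq_fderiv, derivAt_comp (g := fun v => (g v).proj) hc (hpv.comp v hgv),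
    derivAt_comp (g := g) hpv hgv]
  unfold DiffForm.inChart canonicalTheta
  rw [tautForm_eq_localTriv (n + 1) hπ i _ hv.2]
  rfl

end Theta

/-! ### The action of the stabilizer on sections -/

section StabilizerAction
variable {E H : Type*} [NormedAddCommGroup E] [NormedSpace ℝ E] [TopologicalSpace H]
  {I : ModelWithCorners ℝ E H} {M : Type*} [TopologicalSpace M] [ChartedSpace H M]
  {n : ℕ} {S : Type*} [TopologicalSpace S] [ChartedSpace (EuclideanSpace ℝ (Fin n)) S]
  {X : Type*} [TopologicalSpace X] [ChartedSpace (EuclideanSpace ℝ (Fin (n + 1))) X]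
  {q : M → X} {τ : S → X}
  {G 𝔤 : Type*} [Group G] [AddCommGroup 𝔤] [Module ℝ 𝔤] [LieAlgebraOf G 𝔤]
  [MulAction G X] [MulAction G M]

theorem apply_inducedMap (η : surfaceStabilizer G τ) (p : S) :
    τ (inducedMap η p) = (η : G) • τ p :=
  (exists_of_mem_surfaceStabilizer G τ η p).choose_spec

theorem inducedMap_one (hτ : Function.Injective τ) (p : S) :
    inducedMap (1 : surfaceStabilizer G τ) p = p :=
  hτ (by simp [apply_inducedMap])

theorem inducedMap_mul (hτ : Function.Injective τ) (η η' : surfaceStabilizer G τ) (p : S) :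
    inducedMap (η * η') p = inducedMap η (inducedMap η' p) :=
  hτ (by simp [apply_inducedMap, mul_smul])

theorem inducedMap_inv_inducedMap (hτ : Function.Injective τ) (η : surfaceStabilizer G τ) (p : S) :
    inducedMap η⁻¹ (inducedMap η p) = p := by
  rw [← inducedMap_mul hτ, inv_mul_cancel, inducedMap_one hτ]

theorem inducedMap_inducedMap_inv (hτ : Function.Injective τ) (η : surfaceStabilizer G τ) (p : S) :
    inducedMap η (inducedMap η⁻¹ p) = p := by
  rw [← inducedMap_mul hτ, mul_inv_cancel, inducedMap_one hτ]

theorem fieldAction_one (hτ : Function.Injective τ) (σ : S → M) :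
    fieldAction (1 : surfaceStabilizer G τ) σ = σ := by
  funext p
  simp [fieldAction, inducedMap_one hτ]

theorem fieldAction_mul (hτ : Function.Injective τ) (η η' : surfaceStabilizer G τ) (σ : S → M) :
    fieldAction (η * η') σ = fieldAction η (fieldAction η' σ) := by
  funext p
  simp [fieldAction, inducedMap_mul hτ, mul_smul]

theorem proj_fieldAction (hq : ∀ (η : G) (z : M), q (η • z) = η • q z) {σ : S → M}
    (hσ : ∀ p, q (σ p) = τ p) (η : surfaceStabilizer G τ) (p : S) :
    q (fieldAction η σ p) = τ p := by
  simp [fieldAction, hq, hσ, apply_inducedMap]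

/-- As `τ` is an embedding, the maps of `S` that a smooth curve of the stabilizer induces depend
smoothly on the parameter and the point. -/
theorem contMDiff_inducedMap (hτ : Manifold.IsSmoothEmbedding (𝓡 n) (𝓡 (n + 1)) ∞ τ)
    (hX : IsSmoothAction (𝓡 (n + 1)) X G 𝔤) {c : ℝ → surfaceStabilizer G τ}
    (hc : LieAlgebraOf.IsSmoothCurve 𝔤 fun t => (c t : G)) :
    ContMDiff (𝓘(ℝ, ℝ).prod (𝓡 n)) (𝓡 n) ∞ fun r : ℝ × S => inducedMap (c r.1) r.2 := by
  have h1 : ContMDiff (𝓘(ℝ, ℝ).prod (𝓡 n)) (𝓡 (n + 1)) ∞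
      (τ ∘ fun r : ℝ × S => inducedMap (c r.1) r.2) := by
    have h2 : (τ ∘ fun r : ℝ × S => inducedMap (c r.1) r.2) = fun r => (c r.1 : G) • τ r.2 :=
      funext fun r => apply_inducedMap _ _
    rw [h2]
    exact (hX.contMDiff _ hc).comp (contMDiff_fst.prodMk (hτ.contMDiff.comp contMDiff_snd))
  exact (ContMDiff.iff_comp_isImmersion hτ.isImmersion).2
    ⟨hτ.isEmbedding.continuous_iff.2 h1.continuous, h1⟩

theorem contMDiff_fieldAction (hτ : Manifold.IsSmoothEmbedding (𝓡 n) (𝓡 (n + 1)) ∞ τ)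
    (hX : IsSmoothAction (𝓡 (n + 1)) X G 𝔤) (hM : IsSmoothAction I M G 𝔤)
    {c : ℝ → surfaceStabilizer G τ} (hc : LieAlgebraOf.IsSmoothCurve 𝔤 fun t => (c t : G))
    {σ : S → M} (hσ : ContMDiff (𝓡 n) I ∞ σ) :
    ContMDiff (𝓘(ℝ, ℝ).prod (𝓡 n)) I ∞ fun r : ℝ × S => fieldAction (c r.1) σ r.2 :=
  (hM.contMDiff _ hc).comp (contMDiff_fst.prodMk (hσ.comp
    (contMDiff_inducedMap hτ hX (c := fun t => (c t)⁻¹) (LieAlgebraOf.isSmoothCurve_inv _ hc))))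

theorem contMDiff_inducedMap_const (hτ : Manifold.IsSmoothEmbedding (𝓡 n) (𝓡 (n + 1)) ∞ τ)
    (hX : IsSmoothAction (𝓡 (n + 1)) X G 𝔤) (η : surfaceStabilizer G τ) :
    ContMDiff (𝓡 n) (𝓡 n) ∞ (inducedMap η) :=
  (contMDiff_inducedMap hτ hX (c := fun _ => η) (LieAlgebraOf.isSmoothCurve_const _)).comp
    (contMDiff_const (c := (0 : ℝ)).prodMk contMDiff_id)

theorem contMDiff_smul_const (hM : IsSmoothAction I M G 𝔤) (η : G) :
    ContMDiff I I ∞ fun m : M => η • m :=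
  (hM.contMDiff _ (LieAlgebraOf.isSmoothCurve_const η)).comp
    (contMDiff_const (c := (0 : ℝ)).prodMk contMDiff_id)

theorem fieldAction_mem_fieldSpace (hτ : Manifold.IsSmoothEmbedding (𝓡 n) (𝓡 (n + 1)) ∞ τ)
    (hX : IsSmoothAction (𝓡 (n + 1)) X G 𝔤) (hM : IsSmoothAction I M G 𝔤)
    (hq : ∀ (η : G) (z : M), q (η • z) = η • q z) {σ : S → M} (hσ : σ ∈ fieldSpace I n q τ)
    (η : surfaceStabilizer G τ) : fieldAction η σ ∈ fieldSpace I n q τ :=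
  ⟨(contMDiff_smul_const hM (η : G)).comp
    (hσ.1.comp (contMDiff_inducedMap_const hτ hX η⁻¹)), proj_fieldAction hq hσ.2 η⟩

theorem isSmoothFamily_fieldAction (hτ : Manifold.IsSmoothEmbedding (𝓡 n) (𝓡 (n + 1)) ∞ τ)
    (hX : IsSmoothAction (𝓡 (n + 1)) X G 𝔤) (hM : IsSmoothAction I M G 𝔤)
    (hq : ∀ (η : G) (z : M), q (η • z) = η • q z) {σ : S → M} (hσ : σ ∈ fieldSpace I n q τ)
    {c : ℝ → surfaceStabilizer G τ} (hc : LieAlgebraOf.IsSmoothCurve 𝔤 fun t => (c t : G)) :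
    IsSmoothFamily I n q τ fun t => fieldAction (c t) σ :=
  ⟨contMDiff_fieldAction hτ hX hM hc hσ.1,
    fun t => fieldAction_mem_fieldSpace hτ hX hM hq hσ (c t)⟩

/-- The generator of the action on sections is the generator of the action on `M` along the
section, up to a vector field tangent to the section. -/
theorem exists_fieldVelocity_fieldAction (hτ : Manifold.IsSmoothEmbedding (𝓡 n) (𝓡 (n + 1)) ∞ τ)
    (hX : IsSmoothAction (𝓡 (n + 1)) X G 𝔤) (hM : IsSmoothAction I M G 𝔤)
    {σ : S → M} (hσ : ContMDiff (𝓡 n) I ∞ σ) {c : ℝ → surfaceStabilizer G τ} {ξ : 𝔤}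
    (hc : IsCurveWithVelocity (fun t => (c t : G)) ξ) (p : S) :
    ∃ w : EuclideanSpace ℝ (Fin n), fieldVelocity I (fun t => fieldAction (c t) σ) 0 p =
      infinitesimalGenerator I G ξ (σ p) + derivAt (𝓡 n) I σ p w := by
  have hc0 : c 0 = 1 := Subtype.ext hc.2.1
  have hinj := hτ.isEmbedding.injective
  have hind : ContMDiff 𝓘(ℝ, ℝ) (𝓡 n) ∞ fun t : ℝ => inducedMap (c t)⁻¹ p :=
    (contMDiff_inducedMap hτ hX (c := fun t => (c t)⁻¹)
      (LieAlgebraOf.isSmoothCurve_inv _ hc.1)).comp (contMDiff_id.prodMk contMDiff_const)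
  have hind0 : inducedMap (c 0)⁻¹ p = p := by rw [hc0, inv_one, inducedMap_one hinj]
  refine ⟨velocityAt (𝓡 n) (fun t => inducedMap (c t)⁻¹ p) 0, ?_⟩
  have hσp : MDifferentiableAt (𝓡 n) I σ p := hσ.mdifferentiableAt (by simp)
  have hγ : MDifferentiableAt 𝓘(ℝ, ℝ) I (fun t => σ (inducedMap (c t)⁻¹ p)) 0 :=
    (hσ.comp hind).mdifferentiableAt (by simp)
  have hγv : velocityAt I (fun t => σ (inducedMap (c t)⁻¹ p)) 0 =
      derivAt (𝓡 n) I σ p (velocityAt (𝓡 n) (fun t => inducedMap (c t)⁻¹ p) 0) :=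
    velocityAt_comp hind0 hσp (hind.mdifferentiableAt (by simp))
  have hid : MDifferentiableAt 𝓘(ℝ, ℝ) 𝓘(ℝ, ℝ) (fun t : ℝ => t) 0 := mdifferentiableAt_id
  have hmul : MDifferentiableAt (𝓘(ℝ, ℝ).prod I) I (fun r : ℝ × M => (c r.1 : G) • r.2)
      ((0 : ℝ), σ p) := (hM.contMDiff _ hc.1).mdifferentiableAt (by simp)
  have hpair : velocityAt (𝓘(ℝ, ℝ).prod I) (fun t : ℝ => (t, σ (inducedMap (c t)⁻¹ p))) 0 =
      (((1 : ℝ), velocityAt I (fun t => σ (inducedMap (c t)⁻¹ p)) 0) : ℝ × E) := by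
    unfold velocityAt
    rw [mfderiv_prodMk hid hγ]
    refine Prod.ext ?_ rfl
    exact congrArg (fun L : ℝ →L[ℝ] ℝ => L 1) (mfderiv_id (I := 𝓘(ℝ, ℝ)) (x := (0 : ℝ)))
  have h1 : fieldVelocity I (fun t => fieldAction (c t) σ) 0 p =
      derivAt (𝓘(ℝ, ℝ).prod I) I (fun r : ℝ × M => (c r.1 : G) • r.2) ((0 : ℝ), σ p)
        (velocityAt (𝓘(ℝ, ℝ).prod I) (fun t : ℝ => (t, σ (inducedMap (c t)⁻¹ p))) 0) :=
    velocityAt_comp (c := fun t : ℝ => (t, σ (inducedMap (c t)⁻¹ p)))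
      (f := fun r : ℝ × M => (c r.1 : G) • r.2) (x := ((0 : ℝ), σ p))
      (Prod.ext rfl (by simp only [hind0])) hmul (hid.prodMk hγ)
  have h2 := mfderiv_prod_eq_add_apply hmul
    (v := (((1 : ℝ), velocityAt I (fun t => σ (inducedMap (c t)⁻¹ p)) 0) : ℝ × E))
  rw [h1, hpair]
  refine Eq.trans h2 (congrArg₂ (fun a b : E => a + b) ?_ ?_)
  · exact hM.velocity_eq ξ _ _ hc (LieAlgebraOf.exists_curve (G := G) ξ).choose_spec (σ p)
  · rw [← hγv]
    exact congrArg (fun L : E →L[ℝ] E => L (velocityAt I (fun t => σ (inducedMap (c t)⁻¹ p)) 0))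
      (mfderiv_eq_id (I := I) (f := fun z : M => (c 0 : G) • z)
        (by funext z; simp [hc0]) (σ p))

end StabilizerAction

section Degree
variable {E : Type*} [NormedAddCommGroup E] [NormedSpace ℝ E] {n : ℕ}

theorem topForm_succ_eq_zero (a : EuclideanSpace ℝ (Fin n) [⋀^Fin (n + 1)]→L[ℝ] ℝ) : a = 0 := by
  ext v
  refine a.toAlternatingMap.map_linearDependent v fun h => ?_
  have := h.fintype_card_le_finrank
  simp at this

theorem curryLeft_curryLeft_swap {k : ℕ} (a : E [⋀^Fin (k + 2)]→L[ℝ] ℝ) (x y : E) :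
    (a.curryLeft x).curryLeft y = -(a.curryLeft y).curryLeft x := by
  have h := a.curryLeft_same (x + y)
  simp only [map_add, ContinuousAlternatingMap.curryLeft_add, add_apply,
    ContinuousAlternatingMap.curryLeft_same, zero_add, add_zero] at h
  exact eq_neg_of_add_eq_zero_right h

/-- A vector tangent to the image of `ℝⁿ` does not contribute to the pullback to `ℝⁿ` of the
`n`-form `i_V i_(·) a`, because an `(n+1)`-form on `ℝⁿ` vanishes. -/
theorem curryLeft_curryLeft_comp_eq_zero (a : E [⋀^Fin (n + 2)]→L[ℝ] ℝ)
    (L : EuclideanSpace ℝ (Fin n) →L[ℝ] E) (w : EuclideanSpace ℝ (Fin n)) (v : E) :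
    ((a.curryLeft (L w)).curryLeft v).compContinuousLinearMap L = 0 := by
  have h : ((a.curryLeft v).curryLeft (L w)).compContinuousLinearMap L = 0 := by
    rw [← ContinuousAlternatingMap.curryLeft_compContinuousLinearMap,
      topForm_succ_eq_zero ((a.curryLeft v).compContinuousLinearMap L)]
    rfl
  rw [curryLeft_curryLeft_swap]
  change -((a.curryLeft v).curryLeft (L w)).compContinuousLinearMap L = 0
  rw [h, neg_zero]

end Degree

/-! ### The forms and the momentum map on the space of sections -/

section Sections
variable {E H : Type*} [NormedAddCommGroup E] [NormedSpace ℝ E] [TopologicalSpace H]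
  {I : ModelWithCorners ℝ E H} [I.Boundaryless] {M : Type*} [TopologicalSpace M]
  [ChartedSpace H M] [IsManifold I ∞ M]
  {n : ℕ} {S : Type*} [TopologicalSpace S] [ChartedSpace (EuclideanSpace ℝ (Fin n)) S]
  [IsManifold (𝓡 n) ∞ S] [CompactSpace S] [T2Space S] {ν : DiffForm (𝓡 n) S n}
  {X : Type*} [TopologicalSpace X] [ChartedSpace (EuclideanSpace ℝ (Fin (n + 1))) X]
  {q : M → X} {τ : S → X}

/-- The derivative of the integral of the pullbacks of a form along a curve of maps. The exact term
in Cartan's formula has integral zero by Stokes' theorem. -/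
theorem hasDerivAt_integral_pullback (hν : IsVolumeForm ν) {α : DiffForm I M n}
    (hα : α.IsSmooth) {Γ : ℝ → S → M}
    (hΓ : ContMDiff (𝓘(ℝ, ℝ).prod (𝓡 n)) I ∞ fun r : ℝ × S => Γ r.1 r.2) :
    HasDerivAt (fun t => integral ν (DiffForm.pullback (I := 𝓡 n) (I' := I) (Γ t) α))
      (integral ν (sliceContract Γ α.extDerivative 0 1)) 0 := by
  have h := hasDerivAt_integral hν (isSmoothFormCurve_pullback hΓ hα 0 1)
  obtain ⟨ζ, hζ, e⟩ := exists_formVelocity_pullback_eq hΓ hα 0 1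
  rw [e, integral_add hν (isSmooth_sliceContract hΓ hα.extDerivative 0 1) hζ.isSmooth,
    hζ.integral_eq_zero hν, add_zero] at h
  simpa using h

/-- The derivative of a family in a direction of the parameter space is the velocity of the family
along a curve with this direction. -/
theorem paramDeriv_eq_velocityAt {P : Type*} [NormedAddCommGroup P] [NormedSpace ℝ P]
    {Γ : P → S → M} (hΓ : ContMDiff (𝓘(ℝ, P).prod (𝓡 n)) I ∞ fun r : P × S => Γ r.1 r.2)
    {ℓ : ℝ → P} {v : P} (hℓ : HasDerivAt ℓ v 0) (p : S) :
    paramDeriv I Γ (ℓ 0) v p = velocityAt I (fun s => Γ (ℓ s) p) 0 := by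
  have h1 := velocityAt_comp (c := ℓ) (f := fun t => Γ t p) (t := (0 : ℝ)) rfl
    ((contMDiff_param hΓ p).mdifferentiableAt (by simp)) hℓ.differentiableAt.mdifferentiableAt
  rw [h1]
  have h2 : velocityAt 𝓘(ℝ, P) ℓ 0 = v := by
    unfold velocityAt
    rw [mfderiv_eq_fderiv]
    exact hℓ.deriv
  rw [h2]
  rfl

/-- On the space of sections, `Ω_τ = -dΘ_τ` if `Ω = -dΘ`: the exact term in
`exists_formVelocity_sliceContract_eq` has integral zero by Stokes' theorem. -/
theorem isMinusDifferential_extDerivative (hν : IsVolumeForm ν) {Θ : DiffForm I M (n + 1)}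
    (hΘ : Θ.IsSmooth) : IsMinusDifferential q τ ν Θ fun z => -Θ.extDerivative z := by
  intro Γ hΓ
  have hs := hΓ.contMDiff
  have hb : ∀ s : ℝ, HasDerivAt (fun t : ℝ => (s, t)) ((0, 1) : ℝ × ℝ) 0 := fun s =>
    (hasDerivAt_const (0 : ℝ) s).prodMk (hasDerivAt_id (0 : ℝ))
  have ha : ∀ t : ℝ, HasDerivAt (fun s : ℝ => (s, t)) ((1, 0) : ℝ × ℝ) 0 := fun t =>
    (hasDerivAt_id (0 : ℝ)).prodMk (hasDerivAt_const (0 : ℝ) t)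
  have hB : ∀ s : ℝ, instantTheta ν Θ (Γ (s, 0)) (fieldVelocity I (fun t => Γ (s, t)) 0) =
      integral ν (sliceContract Γ Θ (0 + s • ((1, 0) : ℝ × ℝ)) (0, 1)) := fun s => by
    have e : (0 : ℝ × ℝ) + s • ((1, 0) : ℝ × ℝ) = (s, 0) := by simp
    rw [e]
    unfold instantTheta sliceContract fieldVelocity
    simp only [← paramDeriv_eq_velocityAt hs (hb s)]
  have hA : ∀ t : ℝ, instantTheta ν Θ (Γ (0, t)) (fieldVelocity I (fun s => Γ (s, t)) 0) =
      integral ν (sliceContract Γ Θ (0 + t • ((0, 1) : ℝ × ℝ)) (1, 0)) := fun t => by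
    have e : (0 : ℝ × ℝ) + t • ((0, 1) : ℝ × ℝ) = (0, t) := by simp
    rw [e]
    unfold instantTheta sliceContract fieldVelocity
    simp only [← paramDeriv_eq_velocityAt hs (ha t)]
  have hcB := isSmoothFormCurve_sliceContract hs hΘ 0 (1, 0) (0, 1)
  have hcA := isSmoothFormCurve_sliceContract hs hΘ 0 (0, 1) (1, 0)
  obtain ⟨ζ, hζ, e⟩ := exists_formVelocity_sliceContract_eq hs hΘ 0 (1, 0) (0, 1)
  have hC := isSmooth_sliceContract₂ hs hΘ.extDerivative 0 (1, 0) (0, 1)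
  refine ⟨_, _, (hasDerivAt_integral hν hcB).congr_of_eventuallyEq (.of_forall hB),
    (hasDerivAt_integral hν hcA).congr_of_eventuallyEq (.of_forall hA), ?_⟩
  have h1 := congrArg (integral ν) e
  rw [integral_add hν hcB.isSmooth_formVelocity hζ.isSmooth, hζ.integral_eq_zero hν, add_zero,
    integral_add hν hcA.isSmooth_formVelocity hC] at h1
  have h2 : instantOmega (I := I) ν (fun z => -Θ.extDerivative z) (Γ (0, 0))
      (fieldVelocity I (fun s => Γ (s, 0)) 0) (fieldVelocity I (fun t => Γ (0, t)) 0) =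
      integral ν (-sliceContract₂ Γ Θ.extDerivative (0 : ℝ × ℝ) (1, 0) (0, 1)) := by
    unfold instantOmega sliceContract₂ fieldVelocity
    simp only [← paramDeriv_eq_velocityAt hs (ha 0), ← paramDeriv_eq_velocityAt hs (hb 0)]
    rfl
  rw [h2, integral_neg, h1]
  ring

variable {G 𝔤 : Type*} [Group G] [MulAction G X] [MulAction G M]
  [AddCommGroup 𝔤] [Module ℝ 𝔤] [LieAlgebraOf G 𝔤] {J : 𝔤 →ₗ[ℝ] DiffForm I M n}

theorem isLinearMap_instantMomentum (hν : IsVolumeForm ν)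
    (hJ : ∀ ξ, DiffForm.IsSmooth (I := I) (J ξ)) {σ : S → M} (hσ : ContMDiff (𝓡 n) I ∞ σ) :
    IsLinearMap ℝ fun ξ : surfaceLieAlgebra G τ 𝔤 => instantMomentum τ ν J σ ξ where
  map_add ξ ζ := by
    unfold instantMomentum
    rw [← integral_add hν ((hJ ξ).pullback hσ) ((hJ ζ).pullback hσ), Submodule.coe_add, map_add]
    rfl
  map_smul a ξ := by
    unfold instantMomentum
    rw [smul_eq_mul, ← integral_const_smul, Submodule.coe_smul, map_smul]
    rfl

/-- The integrals of a covariant momentum map over sections form a momentum map. By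
`hasDerivAt_integral_pullback` the derivative of the integral is the integral of `i_V i_{ξ_M} Ω`,
and the generator on sections differs from `ξ_M` by a vector tangent to the section, which does not
contribute. -/
theorem isInstantMomentumMap_instantMomentum [IsManifold I 1 M] (hν : IsVolumeForm ν)
    (hτ : Manifold.IsSmoothEmbedding (𝓡 n) (𝓡 (n + 1)) ∞ τ)
    (hX : IsSmoothAction (𝓡 (n + 1)) X G 𝔤) (hM : IsSmoothAction I M G 𝔤)
    (hq : ∀ (η : G) (z : M), q (η • z) = η • q z) {Ω : DiffForm I M (n + 1 + 1)}
    (hJ : IsCovariantMomentumMap G Ω J) :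
    IsInstantMomentumMap q τ ν Ω
      (fun σ (ξ : surfaceLieAlgebra G τ 𝔤) => instantMomentum τ ν J σ ξ) := by
  refine fun σ hσ => ⟨isLinearMap_instantMomentum hν hJ.smooth hσ.1, fun ξ c hc =>
    ⟨isSmoothFamily_fieldAction hτ hX hM hq hσ hc.1, fun V _ Γ hΓ hΓ0 hΓV => ?_⟩⟩
  refine (hasDerivAt_integral_pullback hν (hJ.smooth ξ) hΓ.contMDiff).congr_deriv ?_
  unfold instantOmega
  congr 1
  funext p
  obtain ⟨w, hw⟩ := exists_fieldVelocity_fieldAction hτ hX hM hσ.1 hc p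
  have hV : paramDeriv I Γ 0 1 p = V p := congrFun hΓV p
  have h0 : (((Ω (σ p)).curryLeft (derivAt (𝓡 n) I σ p w)).curryLeft
      (V p)).compContinuousLinearMap (derivAt (𝓡 n) I σ p) = 0 :=
    curryLeft_curryLeft_comp_eq_zero _ _ w (V p)
  unfold sliceContract
  rw [hV, hΓ0, hJ.extDerivative_eq, hw, map_add, ContinuousAlternatingMap.curryLeft_add]
  ext v
  change _ = _ + (((Ω (σ p)).curryLeft (derivAt (𝓡 n) I σ p w)).curryLeft
      (V p)).compContinuousLinearMap (derivAt (𝓡 n) I σ p) v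
  rw [h0]
  exact (add_zero _).symm

/-- Equivariance. The change of variables `η_τ` in the integral turns the section `η · σ` into
`η ∘ σ`, along which pulling back a form amounts to pulling back its transform by `η` along `σ`. -/
theorem instantMomentum_fieldAction (hν : IsVolumeForm ν)
    (hτ : Manifold.IsSmoothEmbedding (𝓡 n) (𝓡 (n + 1)) ∞ τ)
    (hX : IsSmoothAction (𝓡 (n + 1)) X G 𝔤) (hM : IsSmoothAction I M G 𝔤)
    (hJ : ∀ ξ, DiffForm.IsSmooth (I := I) (J ξ)) (hAd : IsAdEquivariant G J)
    (η : surfaceStabilizer G τ) (hη : PreservesOrientation ν (inducedMap η))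
    {σ : S → M} (hσ : ContMDiff (𝓡 n) I ∞ σ) (ξ : surfaceLieAlgebra G τ 𝔤) :
    instantMomentum τ ν J (fieldAction η σ) ξ = instantMomentum τ ν J σ (surfaceAd η⁻¹ ξ) := by
  have hinj := hτ.isEmbedding.injective
  have hf := contMDiff_inducedMap_const hτ hX η
  have hg := contMDiff_inducedMap_const hτ hX η⁻¹
  have hησ : ContMDiff (𝓡 n) I ∞ (fieldAction η σ) :=
    (contMDiff_smul_const hM (η : G)).comp (hσ.comp hg)
  unfold instantMomentum
  rw [← integral_pullback hν ((hJ ξ).pullback hησ) hf hg (inducedMap_inducedMap_inv hinj η)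
    (inducedMap_inv_inducedMap hinj η) hη]
  congr 1
  funext p
  rw [← DiffForm.pullback_comp (J ξ) (hησ.mdifferentiableAt (by simp))
    (hf.mdifferentiableAt (by simp))]
  have e : (fun y => fieldAction η σ (inducedMap η y)) = fun y => (η : G) • σ y := by
    funext y
    simp only [fieldAction, inducedMap_inv_inducedMap hinj]
  have hJη : J (surfaceAd η⁻¹ ξ : surfaceLieAlgebra G τ 𝔤) =
      DiffForm.pullback (I := I) (I' := I) (fun m => (η : G) • m) (J ξ) := by
    rw [← hAd]
    rfl
  rw [e, hJη, ← DiffForm.pullback_comp (J ξ)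
    ((contMDiff_smul_const hM (η : G)).mdifferentiableAt (by simp))
    (hσ.mdifferentiableAt (by simp))]

end Sections

end Multisymplectic

end

open Multisymplectic in
theorem proposition7p3
    {n : ℕ}
    -- the space-time `X`, the configuration space `Y` and the projection `π : Y → X`
    {X : Type*} [TopologicalSpace X] [ChartedSpace (EuclideanSpace ℝ (Fin (n + 1))) X]
    [IsManifold (𝓡 (n + 1)) ∞ X]
    {EY : Type*} [NormedAddCommGroup EY] [NormedSpace ℝ EY] [FiniteDimensional ℝ EY]
    {Y : Type*} [TopologicalSpace Y] [ChartedSpace EY Y] [IsManifold 𝓘(ℝ, EY) ∞ Y]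
    {F : Type*} [NormedAddCommGroup F] [NormedSpace ℝ F] [FiniteDimensional ℝ F]
    {π : Y → X} (hπ : Manifold.IsSubmersionOfComplement F 𝓘(ℝ, EY) (𝓡 (n + 1)) ∞ π)
    -- the compact oriented manifold `S` and its embedding `τ` in `X`
    {S : Type*} [TopologicalSpace S] [ChartedSpace (EuclideanSpace ℝ (Fin n)) S]
    [IsManifold (𝓡 n) ∞ S] [CompactSpace S] [T2Space S]
    (ν : DiffForm (𝓡 n) S n) (hν : IsVolumeForm ν)
    (τ : S → X) (hτ : Manifold.IsSmoothEmbedding (𝓡 n) (𝓡 (n + 1)) ∞ τ)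
    -- the group `G`, acting by covariant canonical transformations
    {G 𝔤 : Type*} [Group G] [AddCommGroup 𝔤] [Module ℝ 𝔤] [LieAlgebraOf G 𝔤]
    [MulAction G X] [MulAction G (PhaseSpace (n + 1) hπ)]
    (hX : IsSmoothAction (𝓡 (n + 1)) X G 𝔤)
    (hZ : IsSmoothAction (phaseModel n EY F) (PhaseSpace (n + 1) hπ) G 𝔤)
    (hproj : ∀ (η : G) (z : PhaseSpace (n + 1) hπ), phaseProj hπ (η • z) = η • phaseProj hπ z)
    (hcan : ∀ η : G, DiffForm.pullback (I := phaseModel n EY F) (I' := phaseModel n EY F)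
      (fun z : PhaseSpace (n + 1) hπ => η • z) (canonicalOmega hπ) = canonicalOmega hπ)
    -- the covariant momentum map
    (J : 𝔤 →ₗ[ℝ] DiffForm (phaseModel n EY F) (PhaseSpace (n + 1) hπ) n)
    (hJ : IsCovariantMomentumMap G (canonicalOmega hπ) J) :
    -- the stabilizer acts on the space of sections
    (∀ σ ∈ fieldSpace (phaseModel n EY F) n (phaseProj hπ) τ,
      (∀ η : surfaceStabilizer G τ,
        fieldAction η σ ∈ fieldSpace (phaseModel n EY F) n (phaseProj hπ) τ) ∧
      fieldAction (1 : surfaceStabilizer G τ) σ = σ ∧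
      ∀ η η' : surfaceStabilizer G τ,
        fieldAction (η * η') σ = fieldAction η (fieldAction η' σ)) ∧
    -- the two-form `Ω_τ` is `-dΘ_τ`
    IsMinusDifferential (phaseProj hπ) τ ν (canonicalTheta hπ) (canonicalOmega hπ) ∧
    -- `J_τ` is a momentum map
    IsInstantMomentumMap (phaseProj hπ) τ ν (canonicalOmega hπ)
      (fun σ (ξ : surfaceLieAlgebra G τ 𝔤) => instantMomentum τ ν J σ ξ) ∧
    -- `J_τ` is equivariant if `J` is
    (IsAdEquivariant G J →
      ∀ η : surfaceStabilizer G τ, PreservesOrientation ν (inducedMap η) →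
        ∀ σ ∈ fieldSpace (phaseModel n EY F) n (phaseProj hπ) τ,
          ∀ ξ : surfaceLieAlgebra G τ 𝔤,
            instantMomentum τ ν J (fieldAction η σ) ξ =
              instantMomentum τ ν J σ (surfaceAd η⁻¹ ξ)) := by
  have hinj := hτ.isEmbedding.injective
  refine ⟨fun σ hσ => ⟨fieldAction_mem_fieldSpace hτ hX hZ hproj hσ, fieldAction_one hinj σ,
    fun η η' => fieldAction_mul hinj η η' σ⟩, ?_, ?_, ?_⟩
  · exact isMinusDifferential_extDerivative hν (isSmooth_canonicalTheta hπ)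
  · exact isInstantMomentumMap_instantMomentum hν hτ hX hZ hproj hJ
  · exact fun hAd η hη σ hσ ξ =>
      instantMomentum_fieldAction hν hτ hX hZ hJ.smooth hAd η hη hσ.1 ξ
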